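/- An overpartition of an integer $n\ge 0$ is a partition of $n$ in which the first occurrence of each distinct part size may be overlined. For an overpartition $\lambda$ let $\ell(\lambda)$ be its largest part ($0$ if $\lambda$ is empty), $n(\lambda)$ its number of parts, $\lambda_o$ the subpartition of its odd non-overlined parts, and let $\chi(\lambda)=1$ if the largest part is odd and its first occurrence is not overlined, $\chi(\lambda)=0$ otherwise. The rank of $\lambda$ is $\ell(\lambda)-n(\lambda)$ and its $M2$-rank is $\lceil \ell(\lambda)/2\rceil-n(\lambda)+n(\lambda_o)-\chi(\lambda)$. Let $\overline{N}(m,n)$ (resp. $\overline{N2}(m,n)$) be the number of overpartitions of $n$ with rank (resp. $M2$-rank) $m$. The crank of a partition is its largest part if $1$ is not a part ($0$ for the empty partition), and otherwise the number of parts larger than the number of $1$'s minus the number of $1$'s. The first residual crank of an overpartition is the crank of the partition formed by its non-overlined parts; the second residual crank is the crank of the partition formed by its even non-overlined parts divided by two. Let $\overline{M}(m,n)$ (resp. $\overline{M2}(m,n)$) be the number of overpartitions of $n$ with first (resp. second) residual crank $m$, with the convention that an overpartition for which the partition in question is the one-part partition $1$ is counted with weight $-1$ for $m=0$, weight $+1$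 for each of $m=\pm1$, and weight $0$ for all other $m$. Put $$\overline{N}_k(n)=\sum_{m\in\mathbb{Z}}m^k\overline{N}(m,n),\quad \overline{N2}_k(n)=\sum_{m\in\mathbb{Z}}m^k\overline{N2}(m,n),\quad \overline{M}_k(n)=\sum_{m\in\mathbb{Z}}m^k\overline{M}(m,n),\quad \overline{M2}_k(n)=\sum_{m\in\mathbb{Z}}m^k\overline{M2}(m,n).$$ Then for every integer $n\ge 0$, $$\overline{N}_4(n)=(-8n-1)\overline{N}_2(n)+\frac{-216+24n}{77}\,\overline{M}_2(n)+\frac{192}{77}\,\overline{M}_4(n)+\frac{260+184n}{77}\,\overline{M2}_2(n)-\frac{40}{11}\,\overline{M2}_4(n)$$ and $$\overline{N2}_4(n)=(-2n-1)\overline{N2}_2(n)+\frac{-27+3n}{77}\,\overline{M}_2(n)+\frac{24}{77}\,\overline{M}_4(n)+\frac{71-131n}{77}\,\overline{M2}_2(n)-\frac{16}{11}\,\overline{M2}_4(n).$$ -/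

import Mathlib

/-- An overpartition of `n`: a partition of `n` in which the first occurrence of each distinct
part may be overlined.  It is given by the underlying partition together with the set of those
part sizes whose first occurrence is overlined. -/
@[ext]
structure Overpartition (n : ℕ) where
  toPartition : n.Partition
  overlined : Finset ℕ
  overlined_subset : overlined ⊆ toPartition.parts.toFinset

namespace Overpartition

/-- An overpartition is a partition together with a subset of its set of part sizes. -/
def equivSigma (n : ℕ) :
    Overpartition n ≃ (p : n.Partition) × {s : Finset ℕ // s ∈ p.parts.toFinset.powerset} where
  toFun l := ⟨l.toPartition, l.overlined, Finset.mem_powerset.2 l.overlined_subset⟩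
  invFun x := ⟨x.1, x.2.1, Finset.mem_powerset.1 x.2.2⟩
  left_inv _ := rfl
  right_inv _ := rfl

instance (n : ℕ) : Fintype (Overpartition n) :=
  Fintype.ofEquiv _ (equivSigma n).symm

variable {n : ℕ}

/-- All parts, overlined or not. -/
def parts (l : Overpartition n) : Multiset ℕ := l.toPartition.parts

/-- The non-overlined parts: one copy of each overlined size is removed. -/
def nonOverlined (l : Overpartition n) : Multiset ℕ := l.parts - l.overlined.val

/-- The largest part (`0` for the empty overpartition). -/
def largestPart (l : Overpartition n) : ℕ := l.parts.sup

/-- Dyson's rank: the largest part minus the number of parts. -/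
def rank (l : Overpartition n) : ℤ := (l.largestPart : ℤ) - (l.parts.card : ℤ)

/-- `χ(λ) = 1` if the largest part is odd and non-overlined (i.e. its size does not occur
overlined), and `0` otherwise. -/
def chi (l : Overpartition n) : ℤ :=
  if Odd l.largestPart ∧ l.largestPart ∉ l.overlined then 1 else 0

/-- The `M2`-rank `⌈ℓ(λ)/2⌉ - n(λ) + n(λ_o) - χ(λ)`, where `λ_o` consists of the odd
non-overlined parts; `⌈ℓ/2⌉` is written as the natural number quotient `(ℓ + 1) / 2`. -/
def m2Rank (l : Overpartition n) : ℤ :=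
  (((l.largestPart + 1) / 2 : ℕ) : ℤ) - (l.parts.card : ℤ)
    + ((l.nonOverlined.filter (fun x => Odd x)).card : ℤ) - l.chi

end Overpartition

/-- The Andrews-Garvan crank of the partition with the given multiset of (positive) parts: the
largest part if `1` does not occur, and otherwise the number of parts larger than the number of
`1`'s minus the number of `1`'s.  The empty partition has crank `0`. -/
def partitionCrank (μ : Multiset ℕ) : ℤ :=
  if 1 ∈ μ then
    ((μ.filter (fun x => μ.count 1 < x)).card : ℤ) - (μ.count 1 : ℤ)
  else (μ.sup : ℤ)

/-- The contribution of a partition to the number of partitions with crank `m`: `1` if its crank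
is `m` and `0` otherwise, except that the partition `1` of `1` contributes `-1` for `m = 0` and
`1` for `m = 1` and `m = -1`. -/
def crankContribution (μ : Multiset ℕ) (m : ℤ) : ℤ :=
  if μ = {1} then
    if m = 0 then -1 else if m = 1 ∨ m = -1 then 1 else 0
  else if partitionCrank μ = m then 1 else 0

/-- The number of overpartitions of `n` with rank `m`. -/
def rankCount (m : ℤ) (n : ℕ) : ℕ :=
  (Finset.univ.filter (fun l : Overpartition n => l.rank = m)).card

/-- The number of overpartitions of `n` with `M2`-rank `m`. -/
def m2RankCount (m : ℤ) (n : ℕ) : ℕ :=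
  (Finset.univ.filter (fun l : Overpartition n => l.m2Rank = m)).card

/-- The (modified) number of overpartitions of `n` with first residual crank `m`, the crank of
the partition formed by the non-overlined parts. -/
def crankCount (m : ℤ) (n : ℕ) : ℤ :=
  ∑ l : Overpartition n, crankContribution l.nonOverlined m

/-- The (modified) number of overpartitions of `n` with second residual crank `m`, the crank of
the partition formed by the even non-overlined parts divided by two. -/
def crank2Count (m : ℤ) (n : ℕ) : ℤ :=
  ∑ l : Overpartition n,
    crankContribution ((l.nonOverlined.filter (fun x => Even x)).map (fun x => x / 2)) m

/-- The `k`th rank moment `∑ m ∈ ℤ, m ^ k * N(m, n)`.  Here and below only finitely many terms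
of the sum are nonzero, because there are finitely many overpartitions of `n`. -/
noncomputable def rankMoment (k n : ℕ) : ℤ := ∑ᶠ m : ℤ, m ^ k * (rankCount m n : ℤ)

/-- The `k`th `M2`-rank moment. -/
noncomputable def m2RankMoment (k n : ℕ) : ℤ := ∑ᶠ m : ℤ, m ^ k * (m2RankCount m n : ℤ)

/-- The `k`th first residual crank moment. -/
noncomputable def crankMoment (k n : ℕ) : ℤ := ∑ᶠ m : ℤ, m ^ k * crankCount m n

/-- The `k`th second residual crank moment. -/
noncomputable def crank2Moment (k n : ℕ) : ℤ := ∑ᶠ m : ℤ, m ^ k * crank2Count m n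

open PowerSeries
open scoped PowerSeries.WithPiTopology

/-! ### Formal sums of power series -/

/-! Write q for `X`, θ = q d/dq for `euler`, φ = ∑ (-1)^n q^(n²) for `phi`, P for the generating
function of overpartitions, L_r = ∑ k^r q^k / (1 - q^k) for `lambert r`, and L_r' = L_r(q²) for
`lambert2 r`. A factor n in front of a moment becomes θ on its generating function, so the two
claims are the power series identities `rank_identity` and `m2Rank_identity`.

Crank side. The crank generating function of partitions times ∑ (-1)^n z^n q^(n(n-1)/2) has only two
nonzero coefficients in z (`conv_ct_crankGf`). Taking moments in z expresses the second and fourth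
crank moments, relative to the zeroth, as 2 L_1 and 2 L_3 + 12 L_1². Overlined parts split off as an
independent factor, so the first residual crank moments have generating functions 2 L_1 P and (2 L_3
+ 12 L_1²) P. The second residual crank gives the same with L_r' in place of L_r.

Rank side. Difference equations for the numbers of overpartitions with bounded rank are solved by
the partial theta series p(m) = ∑_{n ≥ 1} (-1)^n q^(n² + nm) (`pt`). With S_r = ∑_{k ≥ 1} k^r p(sk),
where s = 1 for the rank and s = 2 for the M2-rank, the second and fourth moments are -4 P S_1 and
-4 P (2 S_3 - S_1). The same equations yield P φ = 1. An identity of rank-crank type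
(`phi_mul_moment_od`) links S_3, θS_1 - (θφ/φ) S_1 = P⁻¹ θ(P S_1) and the Lambert series.

What is left involves only Lambert series and their θ-derivatives. The relations are θφ/φ = 2 (L_1'
- L_1), the quadratic relation `dlogPhi_sq`, Ramanujan's equation `six_mul_euler_lambert`, and its
image under q ↦ q². Both identities are linear combinations of these with the rank-crank identity.
-/

/-- A family of power series decays if for each `d` all but finitely many members are divisible
by `X ^ d`. -/
def Decay {ι : Type*} (f : ι → ℚ⟦X⟧) : Prop := ∀ d : ℕ, {i | ¬ (X : ℚ⟦X⟧) ^ d ∣ f i}.Finite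

namespace Decay

variable {ι κ : Type*} {f g : ι → ℚ⟦X⟧}

theorem hasFiniteSupport_coeff (hf : Decay f) (d : ℕ) :
    (Function.support fun i => coeff d (f i)).Finite :=
  (hf (d + 1)).subset fun _ hi h => hi (X_pow_dvd_iff.1 h d (Nat.lt_succ_self d))

theorem summable (hf : Decay f) : Summable f :=
  (WithPiTopology.summable_iff_summable_coeff ℚ).2 fun d =>
    summable_of_hasFiniteSupport (hf.hasFiniteSupport_coeff d)

theorem coeff_tsum (hf : Decay f) (d : ℕ) : coeff d (∑' i, f i) = ∑ᶠ i, coeff d (f i) := by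
  rw [hf.summable.map_tsum _ (WithPiTopology.continuous_coeff ℚ d)]
  exact tsum_eq_finsum (hf.hasFiniteSupport_coeff d)

theorem of_dvd (e : ι → ℕ) (he : ∀ d, {i | e i < d}.Finite) (h : ∀ i, (X : ℚ⟦X⟧) ^ e i ∣ f i) :
    Decay f := fun d => (he d).subset fun i hi => by
  by_contra h'
  exact hi ((pow_dvd_pow X (not_lt.1 h')).trans (h i))

theorem mono (hf : Decay f) (h : ∀ i, f i ∣ g i) : Decay g := fun d =>
  (hf d).subset fun i hi h' => hi (h'.trans (h i))

theorem mul_left (hf : Decay f) (g : ι → ℚ⟦X⟧) : Decay fun i => g i * f i :=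
  hf.mono fun _ => dvd_mul_left _ _

theorem mul_right (hf : Decay f) (g : ι → ℚ⟦X⟧) : Decay fun i => f i * g i :=
  hf.mono fun _ => dvd_mul_right _ _

theorem neg (hf : Decay f) : Decay fun i => - f i :=
  hf.mono fun _ => (dvd_neg.2 dvd_rfl)

theorem add (hf : Decay f) (hg : Decay g) : Decay fun i => f i + g i := fun d =>
  ((hf d).union (hg d)).subset fun i hi => by
    by_contra h
    simp only [Set.mem_union, Set.mem_ofPred_eq, not_or, not_not] at h
    exact hi (dvd_add h.1 h.2)

theorem sub (hf : Decay f) (hg : Decay g) : Decay fun i => f i - g i := by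
  simpa only [sub_eq_add_neg] using hf.add hg.neg

theorem comp (hf : Decay f) {e : κ → ι} (he : Function.Injective e) : Decay fun k => f (e k) :=
  fun d => (hf d).preimage he.injOn

theorem prod {h : κ → ℚ⟦X⟧} (hf : Decay f) (hh : Decay h) :
    Decay fun x : ι × κ => f x.1 * h x.2 := fun d =>
  ((hf d).prod (hh d)).subset fun _ hx =>
    ⟨fun h' => hx (h'.mul_right _), fun h' => hx (h'.mul_left _)⟩

theorem tsum_dvd {n : ℕ} (hf : Decay f) (h : ∀ i, (X : ℚ⟦X⟧) ^ n ∣ f i) :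
    (X : ℚ⟦X⟧) ^ n ∣ ∑' i, f i := by
  refine X_pow_dvd_iff.2 fun m hm => ?_
  rw [hf.coeff_tsum]
  exact finsum_eq_zero_of_forall_eq_zero fun i => X_pow_dvd_iff.1 (h i) m hm

theorem tsum_prod {f : ι × κ → ℚ⟦X⟧} (hf : Decay f) :
    ∑' x, f x = ∑' i, ∑' k, f (i, k) :=
  hf.summable.tsum_prod' fun i =>
    (hf.comp (e := fun k => (i, k)) fun _ _ h => (Prod.ext_iff.1 h).2).summable

theorem tsum_fst {f : ι × κ → ℚ⟦X⟧} (hf : Decay f) : Decay fun i => ∑' k, f (i, k) := fun d =>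
  ((hf d).image Prod.fst).subset fun i hi => by
    by_contra h
    refine hi ((hf.comp (e := fun k => (i, k)) fun _ _ h => (Prod.ext_iff.1 h).2).tsum_dvd
      fun k => ?_)
    by_contra h'
    exact h ⟨(i, k), h', rfl⟩

theorem tsum_comm {f : ι → κ → ℚ⟦X⟧} (hf : Decay (Function.uncurry f)) :
    ∑' i, ∑' k, f i k = ∑' k, ∑' i, f i k := by
  have h := hf.comp (e := (Equiv.prodComm κ ι)) (Equiv.injective _)
  calc ∑' i, ∑' k, f i k = ∑' x, Function.uncurry f x := hf.tsum_prod.symm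
    _ = ∑' y, Function.uncurry f (Equiv.prodComm κ ι y) := ((Equiv.prodComm κ ι).tsum_eq _).symm
    _ = _ := h.tsum_prod

end Decay

/-! ### The derivation q d/dq and the substitution q ↦ q². -/

/-- Multiplication of the `n`th coefficient by `n`, i.e. `X d/dX`. -/
noncomputable def euler : Derivation ℚ ℚ⟦X⟧ ℚ⟦X⟧ := (X : ℚ⟦X⟧) • derivative ℚ

theorem coeff_euler (f : ℚ⟦X⟧) (n : ℕ) : coeff n (euler f) = n * coeff n f := by
  simp only [euler, Derivation.coe_smul, Pi.smul_apply, smul_eq_mul]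
  cases n with
  | zero => simp
  | succ n => rw [coeff_succ_X_mul, coeff_derivative]; push_cast; ring

theorem euler_X_pow (n : ℕ) : euler ((X : ℚ⟦X⟧) ^ n) = (n : ℚ⟦X⟧) * X ^ n := by
  ext m
  rw [coeff_euler, ← map_natCast (C (R := ℚ)), coeff_C_mul, coeff_X_pow]
  split_ifs with h <;> simp [h]

theorem Decay.euler_tsum {ι : Type*} {f : ι → ℚ⟦X⟧} (hf : Decay f) :
    euler (∑' i, f i) = ∑' i, euler (f i) := by
  have h : Decay fun i => euler (f i) := fun d => (hf d).subset fun i hi h => hi <| by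
    rw [X_pow_dvd_iff] at h ⊢
    intro m hm
    rw [coeff_euler, h m hm, mul_zero]
  ext n
  rw [coeff_euler, hf.coeff_tsum, h.coeff_tsum, mul_finsum' _ _ (hf.hasFiniteSupport_coeff n)]
  simp only [coeff_euler]

theorem euler_expand (f : ℚ⟦X⟧) :
    euler (expand 2 two_ne_zero f) = 2 * expand 2 two_ne_zero (euler f) := by
  ext n
  rw [coeff_euler, ← map_ofNat (C (R := ℚ)), coeff_C_mul]
  by_cases h : 2 ∣ n
  · obtain ⟨m, rfl⟩ := h
    rw [coeff_expand_mul, coeff_expand_mul, coeff_euler]; push_cast; ring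
  · rw [coeff_expand_of_not_dvd _ _ _ h, coeff_expand_of_not_dvd _ _ _ h]; ring

theorem X_pow_dvd_expand {f : ℚ⟦X⟧} {n : ℕ} (h : X ^ n ∣ f) :
    X ^ n ∣ expand 2 two_ne_zero f := by
  obtain ⟨g, rfl⟩ := h
  rw [map_mul, map_pow, expand_X, ← pow_mul]
  exact (pow_dvd_pow X (by omega)).mul_right _

theorem Decay.expand {ι : Type*} {f : ι → ℚ⟦X⟧} (hf : Decay f) :
    Decay fun i => expand 2 two_ne_zero (f i) := fun d =>
  (hf d).subset fun _ hi h => hi (X_pow_dvd_expand h)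

theorem Decay.expand_tsum {ι : Type*} {f : ι → ℚ⟦X⟧} (hf : Decay f) :
    PowerSeries.expand 2 two_ne_zero (∑' i, f i) = ∑' i, PowerSeries.expand 2 two_ne_zero (f i) := by
  ext n
  rw [hf.expand.coeff_tsum]
  by_cases h : 2 ∣ n
  · obtain ⟨m, rfl⟩ := h
    simp only [coeff_expand_mul, hf.coeff_tsum]
  · simp only [coeff_expand_of_not_dvd _ _ _ h, finsum_zero]

/-! ### Integer powers of `X` with nonnegative exponents -/

/-- `X ^ k` for an integer `k ≥ 0`. -/
noncomputable def xpow (k : ℤ) : ℚ⟦X⟧ := X ^ k.toNat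

theorem xpow_natCast (k : ℕ) : xpow k = X ^ k := by simp [xpow]

theorem xpow_mul_xpow {a b : ℤ} (ha : 0 ≤ a) (hb : 0 ≤ b) : xpow a * xpow b = xpow (a + b) := by
  rw [xpow, xpow, xpow, ← pow_add, Int.toNat_add ha hb]

theorem xpow_mul_xpow' {a b c : ℤ} (ha : 0 ≤ a) (hb : 0 ≤ b) (h : a + b = c) :
    xpow a * xpow b = xpow c := by
  rw [xpow_mul_xpow ha hb, h]

theorem xpow_zero : xpow 0 = 1 := by simp [xpow]

theorem euler_xpow {k : ℤ} (hk : 0 ≤ k) : euler (xpow k) = k * xpow k := by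
  lift k to ℕ using hk
  rw [xpow_natCast, euler_X_pow]; simp

theorem euler_intCast_mul (m : ℤ) (f : ℚ⟦X⟧) : euler ((m : ℚ⟦X⟧) * f) = m * euler f := by
  simp

theorem decay_xpow {ι : Type*} {e : ι → ℤ} (he : ∀ d : ℕ, {i | e i < d}.Finite) :
    Decay fun i => xpow (e i) := by
  refine Decay.of_dvd (fun i => (e i).toNat) (fun d => (he d).subset fun i hi => ?_) fun i => dvd_rfl
  simp only [Set.mem_ofPred_eq] at hi ⊢
  omega

/-- The sign `(-1) ^ n`. -/
noncomputable def sg (n : ℤ) : ℚ⟦X⟧ := (n.negOnePow : ℤ)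

theorem sg_zero : sg 0 = 1 := by simp [sg]
theorem sg_succ (n : ℤ) : sg (n + 1) = - sg n := by simp [sg, Int.negOnePow_succ]
theorem sg_neg (n : ℤ) : sg (-n) = sg n := by simp [sg]
theorem euler_sg (n : ℤ) : euler (sg n) = 0 := by rw [sg]; simp

theorem one_sub_X_pow_ne_zero {k : ℕ} (hk : k ≠ 0) : (1 - X ^ k : ℚ⟦X⟧) ≠ 0 := fun h => by
  have := congrArg constantCoeff h
  simp [hk] at this

theorem one_sub_X_pow_mul_inv {k : ℕ} (hk : k ≠ 0) : (1 - X ^ k : ℚ⟦X⟧) * (1 - X ^ k)⁻¹ = 1 :=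
  PowerSeries.mul_inv_cancel _ (by simp [hk])

/-- A finite set of integers is one that is bounded in absolute value. -/
theorem finite_of_abs_le {s : Set ℤ} (B : ℤ) (h : ∀ x ∈ s, |x| ≤ B) : s.Finite :=
  (Set.finite_Icc (-B) B).subset fun x hx => abs_le.1 (h x hx)

instance : CharZero ℚ⟦X⟧ := algebraRat.charZero _

/-! ### Moments and convolutions of families indexed by `ℤ` -/

/-- The sum of a family of power series with integer weights. -/
noncomputable def moment (w : ℤ → ℤ) (c : ℤ → ℚ⟦X⟧) : ℚ⟦X⟧ := ∑' n, (w n : ℚ⟦X⟧) * c n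

/-- The convolution of two families of power series. -/
noncomputable def conv (c o : ℤ → ℚ⟦X⟧) (n : ℤ) : ℚ⟦X⟧ := ∑' j, c (n - j) * o j

section
variable {c o : ℤ → ℚ⟦X⟧}

/-- The shear `(n, j) ↦ (n - j, j)`. -/
def shear : ℤ × ℤ ≃ ℤ × ℤ where
  toFun x := (x.1 - x.2, x.2)
  invFun x := (x.1 + x.2, x.2)
  left_inv x := by simp
  right_inv x := by simp

theorem decay_shear (hc : Decay c) (ho : Decay o) : Decay fun x : ℤ × ℤ => c (x.1 - x.2) * o x.2 :=
  (hc.prod ho).comp shear.injective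

theorem summable_conv (hc : Decay c) (n : ℤ) : Decay fun j => c (n - j) * o j :=
  (hc.comp (e := fun j => n - j) fun _ _ h => by simpa using h).mul_right _

theorem moment_conv_eq (hc : Decay c) (ho : Decay o) (w : ℤ → ℤ) :
    moment w (conv c o) = ∑' x : ℤ × ℤ, (w (x.1 + x.2) : ℚ⟦X⟧) * (c x.1 * o x.2) := by
  have h := (decay_shear hc ho).mul_left fun x => (w x.1 : ℚ⟦X⟧)
  calc moment w (conv c o) = ∑' n, ∑' j, (w n : ℚ⟦X⟧) * (c (n - j) * o j) :=
        tsum_congr fun n => ((summable_conv hc n).summable.tsum_mul_left _).symm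
    _ = ∑' x : ℤ × ℤ, (w x.1 : ℚ⟦X⟧) * (c (x.1 - x.2) * o x.2) := h.tsum_prod.symm
    _ = _ := by
        rw [← shear.symm.tsum_eq]
        simp [shear]

theorem Decay.tsum_mul_tsum {ι κ : Type*} {f : ι → ℚ⟦X⟧} {g : κ → ℚ⟦X⟧} (hf : Decay f)
    (hg : Decay g) : (∑' i, f i) * ∑' k, g k = ∑' x : ι × κ, f x.1 * g x.2 :=
  hf.summable.tsum_mul_tsum hg.summable (hf.prod hg).summable

/-- The binomial theorem after the shear (n, j) ↦ (n - j, j). Every relation between moments below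
comes from applying it to an explicitly known convolution. The shifts `u`, `v` allow each factor to
be centred at its own point of symmetry. -/
theorem moment_conv (hc : Decay c) (ho : Decay o) (r : ℕ) {w u v : ℤ → ℤ}
    (h : ∀ m j, w (m + j) = (u m + v j) ^ r) :
    moment w (conv c o) = ∑ i ∈ Finset.range (r + 1),
      (r.choose i : ℚ⟦X⟧) * (moment (fun n => u n ^ i) c * moment (fun n => v n ^ (r - i)) o) := by
  obtain ⟨F, hF⟩ : ∃ F : ℕ → ℤ → ℚ⟦X⟧, ∀ i n, F i n = ((u n ^ i : ℤ) : ℚ⟦X⟧) * c n :=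
    ⟨_, fun _ _ => rfl⟩
  obtain ⟨G, hG⟩ : ∃ G : ℕ → ℤ → ℚ⟦X⟧, ∀ i n, G i n = ((v n ^ i : ℤ) : ℚ⟦X⟧) * o n :=
    ⟨_, fun _ _ => rfl⟩
  have hF' (i : ℕ) : Decay (F i) := hc.mono fun n => by rw [hF]; exact dvd_mul_left _ _
  have hG' (i : ℕ) : Decay (G i) := ho.mono fun n => by rw [hG]; exact dvd_mul_left _ _
  have hp (i : ℕ) : Decay fun x : ℤ × ℤ => F i x.1 * G (r - i) x.2 := (hF' i).prod (hG' (r - i))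
  have e1 (x : ℤ × ℤ) : (w (x.1 + x.2) : ℚ⟦X⟧) * (c x.1 * o x.2) =
      ∑ i ∈ Finset.range (r + 1), (r.choose i : ℚ⟦X⟧) * (F i x.1 * G (r - i) x.2) := by
    rw [h, add_pow, Int.cast_sum, Finset.sum_mul]
    refine Finset.sum_congr rfl fun i _ => ?_
    rw [hF, hG]; push_cast; ring
  rw [moment_conv_eq hc ho, tsum_congr e1,
    Summable.tsum_finsetSum fun i _ => ((hp i).mul_left fun _ => (r.choose i : ℚ⟦X⟧)).summable]
  refine Finset.sum_congr rfl fun i _ => ?_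
  rw [(hp i).summable.tsum_mul_left, ← (hF' i).tsum_mul_tsum (hG' (r - i))]
  simp only [hF, hG, moment]

/-- The reflection n ↦ s - n shows that the sum equals its own negative. -/
theorem moment_eq_zero_of_odd {w : ℤ → ℤ} (s : ℤ) (h : ∀ n, (w (s - n) : ℚ⟦X⟧) * c (s - n) =
    - ((w n : ℚ⟦X⟧) * c n)) : moment w c = 0 := by
  have : moment w c = - moment w c := by
    conv_lhs => rw [moment, ← (Equiv.subLeft s).tsum_eq]
    simp only [Equiv.subLeft_apply, h, tsum_neg, moment]
  have h2 : (2 : ℚ⟦X⟧) * moment w c = 0 := by linear_combination this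
  simpa using h2

theorem moment_shift {w : ℤ → ℤ} (s : ℤ) : moment w (fun n => c (n - s)) =
    moment (fun n => w (n + s)) c := by
  rw [moment, ← (Equiv.addRight s).tsum_eq]
  simp [moment]

theorem moment_sub {c' : ℤ → ℚ⟦X⟧} (hc : Decay c) (hc' : Decay c') (w : ℤ → ℤ) :
    moment w (fun n => c n - c' n) = moment w c - moment w c' := by
  simp only [moment, mul_sub]
  exact (hc.mul_left _).summable.tsum_sub (hc'.mul_left _).summable

theorem moment_weight_mul (f w : ℤ → ℤ) :
    moment w (fun n => (f n : ℚ⟦X⟧) * c n) = moment (fun n => w n * f n) c := by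
  simp only [moment, Int.cast_mul, mul_assoc]

theorem moment_weight_add (hc : Decay c) (v w : ℤ → ℤ) :
    moment (fun n => v n + w n) c = moment v c + moment w c := by
  simp only [moment, Int.cast_add, add_mul]
  exact (hc.mul_left _).summable.tsum_add (hc.mul_left _).summable

theorem moment_weight_const_mul (hc : Decay c) (a : ℤ) (w : ℤ → ℤ) :
    moment (fun n => a * w n) c = a * moment w c := by
  simp only [moment, Int.cast_mul, mul_assoc]
  exact (hc.mul_left _).summable.tsum_mul_left _

theorem moment_congr {w w' : ℤ → ℤ} (h : ∀ n, w n = w' n) : moment w c = moment w' c := by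
  rw [funext h]

end

/-! ### Lambert series -/

/-- The coefficients `sgn(k) q^|k| / (1 - q^|k|)`. -/
noncomputable def lam (k : ℤ) : ℚ⟦X⟧ := (k.sign : ℚ⟦X⟧) * (X ^ k.natAbs * (1 - X ^ k.natAbs)⁻¹)

theorem lam_neg (k : ℤ) : lam (-k) = - lam k := by simp [lam]

theorem lam_zero : lam 0 = 0 := by simp [lam]

theorem one_sub_mul_lam {k : ℕ} (hk : k ≠ 0) : (1 - X ^ k) * lam k = X ^ k := by
  have h : (k : ℤ).sign = 1 := Int.sign_eq_one_of_pos (by omega)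
  rw [lam, h]
  simp only [Int.natAbs_natCast, Int.cast_one, one_mul]
  linear_combination X ^ k * one_sub_X_pow_mul_inv hk

theorem decay_of_natAbs {c : ℤ → ℚ⟦X⟧} (h : ∀ k, X ^ k.natAbs ∣ c k) : Decay c :=
  Decay.of_dvd Int.natAbs
    (fun d => finite_of_abs_le d fun x hx => by
      simp only [Set.mem_ofPred_eq] at hx
      rw [Int.abs_eq_natAbs]; omega) h

theorem decay_lam : Decay lam :=
  decay_of_natAbs fun k => (Dvd.intro _ rfl : X ^ k.natAbs ∣ X ^ k.natAbs * _).mul_left _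

/-- `∑ k q^k / (1 - q^k)`. -/
noncomputable def lambert (r : ℕ) : ℚ⟦X⟧ := ∑' k : ℕ, ((k + 1 : ℕ) : ℚ⟦X⟧) ^ r * lam (k + 1)

theorem tsum_int_even {f : ℤ → ℚ⟦X⟧} (hf : Decay f) (he : ∀ k, f (-k) = f k) (h0 : f 0 = 0) :
    ∑' k, f k = 2 * ∑' k : ℕ, f (k + 1) := by
  have h1 : Summable fun k : ℕ => f k := (hf.comp Nat.cast_injective).summable
  have h2 : Summable fun k : ℕ => f (-(k + 1 : ℤ)) :=
    (hf.comp (e := fun k : ℕ => (-(k + 1 : ℤ))) fun a b h => by simpa using h).summable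
  rw [tsum_of_nat_of_neg_add_one h1 h2, h1.tsum_eq_zero_add]
  simp only [he, Nat.cast_zero, h0, zero_add, Nat.cast_add, Nat.cast_one, two_mul]

theorem moment_lam {r : ℕ} (hr : Odd r) : moment (fun n => n ^ r) lam = 2 * lambert r := by
  rw [moment, tsum_int_even (decay_lam.mul_left _) _ (by simp [lam_zero])]
  · simp [lambert]
  · intro k
    rw [lam_neg, hr.neg_pow]; push_cast; ring

theorem moment_lam_even {r : ℕ} (hr : Even r) : moment (fun n => n ^ r) lam = 0 :=
  moment_eq_zero_of_odd 0 fun n => by rw [zero_sub, lam_neg, hr.neg_pow]; ring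

/-! ### The theta series `∑ (-1)^n q^(n^2)` -/

/-- The terms `(-1)^n q^(n^2)`. -/
noncomputable def th (n : ℤ) : ℚ⟦X⟧ := sg n * xpow (n ^ 2)

theorem th_neg (n : ℤ) : th (-n) = th n := by rw [th, th, sg_neg, neg_sq]

theorem th_zero : th 0 = 1 := by simp [th, sg_zero, xpow_zero]

theorem decay_th : Decay th := by
  refine (decay_xpow (e := fun n : ℤ => n ^ 2) fun d => finite_of_abs_le d fun x hx => ?_).mul_left _
  simp only [Set.mem_ofPred_eq] at hx
  rw [← sq_abs] at hx
  nlinarith [abs_nonneg x]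

theorem tsum_eq_zero_of_reflect {f : ℤ → ℚ⟦X⟧} (s : ℤ) (h : ∀ n, f (s - n) = - f n) :
    ∑' n, f n = 0 := by
  have : moment 1 f = 0 := moment_eq_zero_of_odd s fun n => by simp [h]
  simpa [moment] using this

/-- The coefficients `q^j / (1 - q^(2j))`, extended to an odd function of `j`. -/
noncomputable def lamOdd (j : ℤ) : ℚ⟦X⟧ := lam j - expand 2 two_ne_zero (lam j)

theorem lamOdd_neg (k : ℤ) : lamOdd (-k) = - lamOdd k := by simp [lamOdd, lam_neg]; ring

theorem lamOdd_zero : lamOdd 0 = 0 := by simp [lamOdd, lam_zero]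

theorem decay_lamOdd : Decay lamOdd := decay_lam.sub decay_lam.expand

theorem one_sub_mul_expand_lam {k : ℕ} (hk : k ≠ 0) :
    (1 - X ^ (2 * k)) * expand 2 two_ne_zero (lam k) = X ^ (2 * k) := by
  have := congrArg (expand 2 two_ne_zero) (one_sub_mul_lam hk)
  simpa [← pow_mul] using this

theorem one_sub_mul_lamOdd {k : ℕ} (hk : k ≠ 0) : (1 - X ^ (2 * k)) * lamOdd k = X ^ k := by
  rw [lamOdd]
  linear_combination (1 + X ^ k) * one_sub_mul_lam hk - one_sub_mul_expand_lam hk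

/-- With m = n - k and E = m² + m + n + 1, the terms in th(m + 1) and q^(2n+1) th(m) have numerators
-(-1)^m q^E and (-1)^m q^(E + 2k). Adding them produces the factor 1 - q^(2k), which cancels the
denominator of `lamOdd`. What remains is odd under m ↦ -1 - m, so it disappears on summation
(`tsum_sg_mul_xpow`). -/
theorem th_mul_lamOdd_natCast (n k : ℕ) (hk : k ≠ 0) :
    th (n + 1 - k) * lamOdd k = - (xpow (2 * n + 1) * (th (n - k) * lamOdd k))
      - sg (n - k) * xpow ((n - k) ^ 2 + (n - k) + n + 1) := by
  obtain ⟨m, hm⟩ : ∃ m : ℤ, (n : ℤ) - k = m := ⟨_, rfl⟩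
  have hn : (n : ℤ) = m + k := by omega
  have h0 := one_sub_mul_lamOdd hk
  refine mul_left_cancel₀ (one_sub_X_pow_ne_zero (k := 2 * k) (by omega)) ?_
  rw [show (n : ℤ) + 1 - k = m + 1 by omega, hm, th, th, sg_succ]
  have e1 : xpow ((m + 1) ^ 2) * X ^ k = xpow (m ^ 2 + m + n + 1) := by
    rw [← xpow_natCast]; exact xpow_mul_xpow' (by positivity) (by positivity) (by rw [hn]; ring)
  have e2 : xpow (2 * n + 1) * xpow (m ^ 2) * X ^ k = X ^ (2 * k) * xpow (m ^ 2 + m + n + 1) := by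
    rw [← xpow_natCast, ← xpow_natCast, xpow_mul_xpow (by positivity) (by positivity),
      xpow_mul_xpow (by positivity) (by positivity), xpow_mul_xpow (by positivity) (by nlinarith)]
    congr 1; push_cast; rw [hn]; ring
  linear_combination (-sg m * xpow ((m + 1) ^ 2) + xpow (2 * n + 1) * sg m * xpow (m ^ 2)) * h0
    - sg m * e1 + sg m * e2

theorem th_mul_lamOdd_neg (n k : ℕ) (hk : k ≠ 0) :
    th (n + 1 + k) * lamOdd (-k) = - (xpow (2 * n + 1) * (th (n + k) * lamOdd (-k)))
      - sg (n + k) * xpow ((n + k) ^ 2 + (n + k) + n + 1) := by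
  obtain ⟨m, hm⟩ : ∃ m : ℤ, (n : ℤ) + k = m := ⟨_, rfl⟩
  have hn : (n : ℤ) = m - k := by omega
  have h0 := one_sub_mul_lamOdd hk
  refine mul_left_cancel₀ (one_sub_X_pow_ne_zero (k := 2 * k) (by omega)) ?_
  rw [show (n : ℤ) + 1 + k = m + 1 by omega, hm, th, th, sg_succ, lamOdd_neg]
  have e1 : xpow ((m + 1) ^ 2) * X ^ k = X ^ (2 * k) * xpow (m ^ 2 + m + n + 1) := by
    rw [← xpow_natCast, ← xpow_natCast, xpow_mul_xpow (by positivity) (by positivity),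
      xpow_mul_xpow (by positivity) (by nlinarith)]
    congr 1; push_cast; rw [hn]; ring
  have e2 : xpow (2 * n + 1) * xpow (m ^ 2) * X ^ k = xpow (m ^ 2 + m + n + 1) := by
    rw [← xpow_natCast, xpow_mul_xpow (by positivity) (by positivity),
      xpow_mul_xpow (by positivity) (by positivity)]
    congr 1; rw [hn]; ring
  linear_combination (sg m * xpow ((m + 1) ^ 2) - xpow (2 * n + 1) * sg m * xpow (m ^ 2)) * h0
    + sg m * e1 - sg m * e2

theorem th_mul_lamOdd (n : ℕ) (j : ℤ) :
    th (n + 1 - j) * lamOdd j = - (xpow (2 * n + 1) * (th (n - j) * lamOdd j))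
      - sg (n - j) * xpow ((n - j) ^ 2 + (n - j) + n + 1)
      - if j = 0 then th (n + 1) else 0 := by
  rcases lt_trichotomy j 0 with h | rfl | h
  · obtain ⟨k, rfl⟩ : ∃ k : ℕ, j = -k := ⟨j.natAbs, by omega⟩
    have := th_mul_lamOdd_neg n k (by omega)
    simp only [sub_neg_eq_add, if_neg h.ne, sub_zero]
    exact this
  -- Here `lamOdd 0 = 0`, while the general formula would leave -(-1)^n q^((n+1)²) = th(n + 1); the
  -- conditional term removes it.
  · simp only [lamOdd_zero, sub_zero, if_true, th, sg_succ, mul_zero]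
    rw [show ((n : ℤ) + 1) ^ 2 = n ^ 2 + n + n + 1 by ring]
    ring
  · obtain ⟨k, rfl⟩ : ∃ k : ℕ, j = k := ⟨j.natAbs, by omega⟩
    rw [if_neg h.ne', sub_zero]
    exact th_mul_lamOdd_natCast n k (by omega)

theorem decay_sg_mul_xpow (n : ℕ) :
    Decay fun j : ℤ => sg (n - j) * xpow ((n - j) ^ 2 + (n - j) + n + 1) := by
  have : Decay fun m : ℤ => sg m * xpow (m ^ 2 + m + n + 1) := by
    refine (decay_xpow (e := fun m : ℤ => m ^ 2 + m + n + 1) fun d =>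
      finite_of_abs_le (d + 1) fun x hx => ?_).mul_left _
    simp only [Set.mem_ofPred_eq] at hx
    rw [abs_le]; constructor <;> nlinarith
  exact this.comp (e := fun j => n - j) fun _ _ h => by simpa using h

theorem tsum_sg_mul_xpow (n : ℕ) :
    ∑' j : ℤ, sg (n - j) * xpow ((n - j) ^ 2 + (n - j) + n + 1) = 0 := by
  refine tsum_eq_zero_of_reflect (2 * n + 1) fun j => ?_
  rw [show (n : ℤ) - (2 * n + 1 - j) = -(n - j + 1) by ring, sg_neg, sg_succ]
  rw [show (-((n : ℤ) - j + 1)) ^ 2 + -(n - j + 1) + n + 1 = (n - j) ^ 2 + (n - j) + n + 1 by ring]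
  ring

theorem conv_th_lamOdd_succ (n : ℕ) :
    conv th lamOdd (n + 1) = - (xpow (2 * n + 1) * conv th lamOdd n) - th (n + 1) := by
  have h1 := (summable_conv (o := lamOdd) decay_th n)
  have h3 : Decay fun j : ℤ => if j = 0 then th (n + 1) else 0 :=
    decay_of_natAbs fun k => by split_ifs with h <;> simp [h]
  rw [conv, tsum_congr (th_mul_lamOdd n), Summable.tsum_sub _ h3.summable, Summable.tsum_sub,
    tsum_neg, h1.summable.tsum_mul_left, tsum_sg_mul_xpow, tsum_ite_eq, conv, sub_zero]
  · exact ((h1.mul_left _).neg).summable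
  · exact (decay_sg_mul_xpow n).summable
  · exact ((h1.mul_left _).neg).summable.sub (decay_sg_mul_xpow n).summable

theorem conv_neg_of_even_odd {c o : ℤ → ℚ⟦X⟧} (hc : ∀ n, c (-n) = c n) (ho : ∀ n, o (-n) = - o n)
    (n : ℤ) : conv c o (-n) = - conv c o n := by
  rw [conv, ← (Equiv.neg ℤ).tsum_eq, conv, ← tsum_neg]
  refine tsum_congr fun j => ?_
  rw [Equiv.neg_apply, ho, show -n - -j = -(n - j) by ring, hc]
  ring

/-- The logarithmic derivative of the theta function `∑ (-1)^n q^(n^2) z^n`. -/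
theorem conv_th_lamOdd (n : ℤ) : conv th lamOdd n = - ((n : ℚ⟦X⟧) * th n) := by
  -- The convolution of an even with an odd family is odd; this starts the induction.
  have h0 : conv th lamOdd 0 = 0 := by
    have := conv_neg_of_even_odd th_neg lamOdd_neg 0
    rw [neg_zero] at this
    exact self_eq_neg.1 this
  have key (n : ℕ) : conv th lamOdd n = - ((n : ℚ⟦X⟧) * th n) := by
    induction n with
    | zero => simpa using h0
    | succ n ih =>
      -- The coefficient form of the quasi-periodicity of the theta function under z ↦ z q². It
      -- makes -n th(n) satisfy the recurrence `conv_th_lamOdd_succ`.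
      have e : xpow (2 * n + 1) * th n = - th (n + 1) := by
        rw [th, th, sg_succ, mul_left_comm, xpow_mul_xpow (by positivity) (by positivity),
          show 2 * (n : ℤ) + 1 + n ^ 2 = (n + 1) ^ 2 by ring]
        ring
      push_cast
      rw [conv_th_lamOdd_succ, ih]
      linear_combination (n : ℚ⟦X⟧) * e
  rcases n.eq_nat_or_neg with ⟨k, rfl | rfl⟩
  · simpa using key k
  · rw [conv_neg_of_even_odd th_neg lamOdd_neg, key, th_neg]; simp

/-- `φ(-q) = ∑ (-1)^n q^(n^2)`. -/
noncomputable def phi : ℚ⟦X⟧ := ∑' n, th n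

theorem moment_th_zero : moment (fun n => n ^ 0) th = phi := by simp [moment, phi]

theorem euler_th (n : ℤ) : euler (th n) = ((n ^ 2 : ℤ) : ℚ⟦X⟧) * th n := by
  rw [th, Derivation.leibniz, euler_sg, euler_xpow (by positivity), smul_zero, add_zero, smul_eq_mul]
  ring

theorem euler_moment_th (r : ℕ) :
    euler (moment (fun n => n ^ r) th) = moment (fun n => n ^ (r + 2)) th := by
  rw [moment, (decay_th.mul_left _).euler_tsum, moment]
  refine tsum_congr fun n => ?_
  rw [euler_intCast_mul, euler_th]; push_cast; ring

theorem moment_th_two : moment (fun n => n ^ 2) th = euler phi := by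
  rw [← moment_th_zero, euler_moment_th]

theorem moment_th_four : moment (fun n => n ^ 4) th = euler (euler phi) := by
  rw [← moment_th_zero, euler_moment_th, euler_moment_th]

theorem moment_th_odd {r : ℕ} (hr : Odd r) : moment (fun n => n ^ r) th = 0 :=
  moment_eq_zero_of_odd 0 fun n => by rw [zero_sub, th_neg, hr.neg_pow]; push_cast; ring

/-- `∑ k^r q^(2k) / (1 - q^(2k))`. -/
noncomputable def lambert2 (r : ℕ) : ℚ⟦X⟧ := expand 2 two_ne_zero (lambert r)

theorem moment_expand {c : ℤ → ℚ⟦X⟧} (hc : Decay c) (w : ℤ → ℤ) :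
    moment w (fun n => expand 2 two_ne_zero (c n)) = expand 2 two_ne_zero (moment w c) := by
  rw [moment, moment, (hc.mul_left _).expand_tsum]
  exact tsum_congr fun n => by rw [map_mul, map_intCast]

theorem moment_lamOdd {r : ℕ} (hr : Odd r) :
    moment (fun n => n ^ r) lamOdd = 2 * (lambert r - lambert2 r) := by
  have := moment_sub decay_lam decay_lam.expand fun n => n ^ r
  rw [moment_expand decay_lam, moment_lam hr] at this
  rw [show lamOdd = fun n => lam n - expand 2 two_ne_zero (lam n) from rfl, this, lambert2]
  simp only [map_mul, map_ofNat]; ring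

theorem phi_constantCoeff : constantCoeff phi = 1 := by
  rw [← coeff_zero_eq_constantCoeff_apply, phi, decay_th.coeff_tsum, finsum_eq_single _ 0]
  · simp [th_zero]
  · intro n hn
    rw [th, xpow]
    refine X_pow_dvd_iff.1 (dvd_mul_left _ _) 0 ?_
    have := sq_pos_of_ne_zero hn
    omega

theorem phi_ne_zero : phi ≠ 0 := fun h => by
  have := phi_constantCoeff
  simp [h] at this

/-- The logarithmic derivative of `phi`. -/
noncomputable def dlogPhi : ℚ⟦X⟧ := 2 * (lambert2 1 - lambert 1)

theorem moment_conv_th_lamOdd (r : ℕ) :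
    moment (fun n => n ^ r) (conv th lamOdd) = - moment (fun n => n ^ (r + 1)) th := by
  rw [moment, moment, ← tsum_neg]
  refine tsum_congr fun n => ?_
  rw [conv_th_lamOdd]; push_cast; ring

/-- The first moment of `conv_th_lamOdd`: one side is -θφ, and on the other only φ times the first
moment of `lamOdd` survives by parity. -/
theorem euler_phi : euler phi = phi * dlogPhi := by
  have h := moment_conv decay_th decay_lamOdd 1 (w := fun n => n ^ 1) (u := id) (v := id)
    fun m j => rfl
  rw [moment_conv_th_lamOdd, moment_th_two] at h
  simp only [id, Finset.sum_range_succ, Finset.sum_range_zero, Nat.choose, Nat.reduceSub,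
    Nat.reduceAdd, moment_th_zero, moment_lamOdd odd_one, moment_th_odd odd_one, zero_mul] at h
  rw [dlogPhi]
  push_cast at h
  linear_combination -h

/-- The third moment of `conv_th_lamOdd`. It reads -θ²φ = 2 (L_3 - L_3') φ + 6 (L_1 - L_1') θφ, and
θ²φ / φ = θ(dlogPhi) + dlogPhi². -/
theorem dlogPhi_sq : 2 * dlogPhi ^ 2 = euler dlogPhi + 2 * (lambert 3 - lambert2 3) := by
  have h3 : Odd 3 := by decide
  have h := moment_conv decay_th decay_lamOdd 3 (w := fun n => n ^ 3) (u := id) (v := id)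
    fun m j => rfl
  rw [moment_conv_th_lamOdd, moment_th_four] at h
  simp only [id, Finset.sum_range_succ, Finset.sum_range_zero, Nat.choose, Nat.reduceSub,
    Nat.reduceAdd, moment_th_zero, moment_lamOdd odd_one, moment_lamOdd h3, moment_th_odd odd_one,
    moment_th_odd h3, zero_mul, moment_th_two] at h
  push_cast at h
  have e := congrArg euler euler_phi
  rw [Derivation.leibniz, smul_eq_mul, smul_eq_mul] at e
  have hl : dlogPhi = 2 * (lambert2 1 - lambert 1) := rfl
  refine mul_left_cancel₀ phi_ne_zero ?_
  linear_combination h + e + (-2 * dlogPhi) * euler_phi + 3 * euler phi * hl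

/-! ### The theta series `∑ (-1)^n q^(n(n-1)/2)` and the Ramanujan differential equation -/

/-- Triangular numbers `n (n - 1) / 2`. -/
def tri (n : ℤ) : ℤ := n * (n - 1) / 2

theorem two_mul_tri (n : ℤ) : 2 * tri n = n * (n - 1) :=
  Int.mul_ediv_cancel' (even_iff_two_dvd.1 (Int.even_mul_pred_self n))

theorem tri_succ (n : ℤ) : tri (n + 1) = tri n + n := by
  have h1 := two_mul_tri n
  have h2 := two_mul_tri (n + 1)
  linarith [show (n + 1) * (n + 1 - 1) = n * (n - 1) + 2 * n by ring]

theorem tri_nonneg (n : ℤ) : 0 ≤ tri n := by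
  have h1 := two_mul_tri n
  rcases le_or_gt n 0 with h | h <;> nlinarith

theorem tri_reflect (n : ℤ) : tri (1 - n) = tri n := by
  have h1 := two_mul_tri n
  have h2 := two_mul_tri (1 - n)
  linarith [show (1 - n) * (1 - n - 1) = n * (n - 1) by ring]

/-- The terms `(-1)^n q^(n(n-1)/2)`. -/
noncomputable def ct (n : ℤ) : ℚ⟦X⟧ := sg n * xpow (tri n)

theorem ct_zero : ct 0 = 1 := by simp [ct, sg_zero, tri, xpow_zero]

theorem ct_reflect (n : ℤ) : ct (1 - n) = - ct n := by
  rw [ct, ct, tri_reflect, show 1 - n = -n + 1 by ring, sg_succ, sg_neg, neg_mul]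

theorem ct_one : ct 1 = -1 := by
  have := ct_reflect 0
  rwa [sub_zero, ct_zero] at this

theorem decay_ct : Decay ct := by
  refine (decay_xpow (e := tri) fun d => finite_of_abs_le (2 * d + 1) fun x hx => ?_).mul_left _
  simp only [Set.mem_ofPred_eq] at hx
  have := two_mul_tri x
  rw [abs_le]; constructor <;> nlinarith

theorem tsum_ct : ∑' n, ct n = 0 := tsum_eq_zero_of_reflect 1 ct_reflect

/-- The relation q^m ct(m) = -ct(m + 1), the quasi-periodicity under z ↦ z q, with `m` split as `n -
k` to avoid negative exponents. -/
theorem xpow_mul_ct {n k m : ℤ} (hn : 0 ≤ n) (hk : 0 ≤ k) (h : n = m + k) :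
    xpow n * ct m = - (xpow k * ct (m + 1)) := by
  rw [ct, ct, sg_succ, tri_succ]
  have h1 := tri_nonneg m
  have h2 := tri_nonneg (m + 1)
  rw [tri_succ] at h2
  have e : xpow n * xpow (tri m) = xpow k * xpow (tri m + m) := by
    rw [xpow_mul_xpow hn h1, xpow_mul_xpow hk h2, h]; congr 1; ring
  linear_combination sg m * e

/-- The coefficients `1 / (1 - q^k)` for `k ≠ 0`, written as power series. -/
noncomputable def lamGeom (k : ℤ) : ℚ⟦X⟧ := lam k + if 0 < k then 1 else 0

theorem lamGeom_zero : lamGeom 0 = 0 := by simp [lamGeom, lam_zero]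

theorem lamGeom_add_neg (k : ℤ) : lamGeom k + lamGeom (-k) = 1 - if k = 0 then 1 else 0 := by
  rw [lamGeom, lamGeom, lam_neg]
  rcases lt_trichotomy k 0 with h | rfl | h
  · simp [h, h.ne, not_lt.2 h.le]
  · simp
  · simp [h, h.ne', not_lt.2 h.le]

/-- Since q^n ct(n - k) = -q^k ct(n + 1 - k), the two terms combine to (1 - q^k) ct(n + 1 - k) / (1
- q^k). The surviving terms ct(n + 1 - k) sum to zero over `k`. The value `lamGeom 0 = 0` is what
the conditional corrects. -/
theorem ct_mul_lamGeom (n : ℕ) (k : ℤ) : ct (n + 1 - k) * lamGeom k =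
    - (xpow n * (ct (n - k) * lamGeom k)) + ct (n + 1 - k) - if k = 0 then ct (n + 1) else 0 := by
  rcases lt_trichotomy k 0 with h | rfl | h
  · obtain ⟨j, rfl⟩ : ∃ j : ℕ, k = -j := ⟨k.natAbs, by omega⟩
    have hj : j ≠ 0 := by omega
    refine mul_left_cancel₀ (one_sub_X_pow_ne_zero hj) ?_
    have h0 := one_sub_mul_lam hj
    have e := xpow_mul_ct (n := n + j) (k := 0) (m := n + j) (by positivity) le_rfl (by ring)
    rw [← xpow_mul_xpow (by positivity) (by positivity), xpow_zero, xpow_natCast j] at e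
    rw [lamGeom, lam_neg, if_neg h.ne, if_neg (not_lt.2 h.le),
      show (n : ℤ) + 1 - -j = n + j + 1 by ring, show (n : ℤ) - -j = n + j by ring]
    linear_combination (-ct (n + j + 1) - xpow n * ct (n + j)) * h0 - e
  · simp [lamGeom_zero]
  · obtain ⟨j, rfl⟩ : ∃ j : ℕ, k = j := ⟨k.natAbs, by omega⟩
    have hj : j ≠ 0 := by omega
    refine mul_left_cancel₀ (one_sub_X_pow_ne_zero hj) ?_
    have h0 := one_sub_mul_lam hj
    have e := xpow_mul_ct (n := n) (k := j) (m := n - j) (by positivity) (by positivity) (by ring)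
    rw [xpow_natCast j] at e
    rw [lamGeom, if_neg h.ne', if_pos h, show (n : ℤ) + 1 - j = n - j + 1 by ring]
    linear_combination (ct (n - j + 1) + xpow n * ct (n - j)) * h0 + e

theorem decay_comp_sub {c : ℤ → ℚ⟦X⟧} (hc : Decay c) (n : ℤ) : Decay fun j => c (n - j) :=
  hc.comp (e := fun j => n - j) fun _ _ h => by simpa using h

theorem tsum_comp_sub (c : ℤ → ℚ⟦X⟧) (n : ℤ) : ∑' j, c (n - j) = ∑' j, c j :=
  (Equiv.subLeft n).tsum_eq c

theorem decay_ite_eq_zero (x : ℚ⟦X⟧) : Decay fun j : ℤ => if j = 0 then x else 0 :=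
  decay_of_natAbs fun k => by split_ifs with h <;> simp [h]

theorem conv_ct_lamGeom_succ (n : ℕ) :
    conv ct lamGeom (n + 1) = - (xpow n * conv ct lamGeom n) - ct (n + 1) := by
  have h1 := (summable_conv (o := lamGeom) decay_ct n)
  have h2 := decay_comp_sub decay_ct (n + 1)
  rw [conv, tsum_congr (ct_mul_lamGeom n), Summable.tsum_sub _ (decay_ite_eq_zero _).summable,
    Summable.tsum_add, tsum_neg, h1.summable.tsum_mul_left, tsum_ite_eq, tsum_comp_sub, tsum_ct,
    conv, add_zero]
  · exact ((h1.mul_left _).neg).summable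
  · exact h2.summable
  · exact (((h1.mul_left _).neg).add h2).summable

theorem conv_ct_lamGeom (n : ℕ) : conv ct lamGeom n = - ((n : ℚ⟦X⟧) * ct n) := by
  induction n with
  | zero =>
    -- Reflection in the summation index relates the values at 0 and 1; the recurrence at n = 0 is a
    -- second equation between them, and together they determine both.
    have e1 : conv ct lamGeom 0 - conv ct lamGeom 1 = -1 := by
      have hr : conv ct lamGeom 0 = ∑' k, ct k * lamGeom (-k) := by
        rw [conv, ← (Equiv.neg ℤ).tsum_eq]; simp
      rw [hr, conv, ← Summable.tsum_sub]
      · have (k : ℤ) : ct k * lamGeom (-k) - ct (1 - k) * lamGeom k =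
            ct k - if k = 0 then 1 else 0 := by
          have := lamGeom_add_neg k
          rw [ct_reflect]
          split_ifs at this ⊢ with h
          · subst h; rw [ct_zero]; linear_combination this
          · linear_combination ct k * this
        rw [tsum_congr this, Summable.tsum_sub decay_ct.summable (decay_ite_eq_zero _).summable,
          tsum_ct, tsum_ite_eq, zero_sub]
      · exact (decay_ct.mul_right _).summable
      · exact (summable_conv decay_ct 1).summable
    have e2 := conv_ct_lamGeom_succ 0
    simp only [Nat.cast_zero, zero_add, xpow_zero, one_mul, ct_one] at e2
    have : 2 * conv ct lamGeom 0 = 0 := by linear_combination e1 + e2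
    simpa using this
  | succ n ih =>
    have e := xpow_mul_ct (n := n) (k := 0) (m := n) (by positivity) le_rfl (by ring)
    rw [xpow_zero] at e
    push_cast
    rw [conv_ct_lamGeom_succ, ih]
    linear_combination (n : ℚ⟦X⟧) * e

/-- The differences of the terms `ct n`. -/
noncomputable def dct (n : ℤ) : ℚ⟦X⟧ := ct n - ct (n - 1)

theorem decay_ct_sub_one : Decay fun n => ct (n - 1) :=
  decay_ct.comp (e := fun n => n - 1) fun _ _ h => by simpa using h

theorem decay_dct : Decay dct := decay_ct.sub decay_ct_sub_one

theorem dct_reflect (n : ℤ) : dct (2 - n) = dct n := by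
  rw [dct, dct, show 2 - n = 1 - (n - 1) by ring, ct_reflect,
    show 1 - (n - 1) - 1 = 1 - n by ring, ct_reflect]
  ring

/-- `lamGeom` does not decay as k → ∞, so `moment_conv` cannot be applied to it. It differs from the
decaying `lam` by the indicator of k > 0, whose convolution with `ct` is a partial sum of `ct`.
Taking differences in `n` reduces this partial sum to one term, which is why `dct` replaces `ct`. -/
theorem conv_dct_lam_natCast (n : ℕ) : conv dct lam (n + 1) =
    - ((n + 1 : ℚ⟦X⟧) * ct (n + 1) - (n - 1) * ct n) := by
  obtain ⟨I, hI⟩ : ∃ I : ℤ → ℚ⟦X⟧, ∀ k, I k = if 0 < k then 1 else 0 := ⟨_, fun _ => rfl⟩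
  have h1 : conv ct I (n + 1) - conv ct I n = ct n := by
    have hs : conv ct I n = ∑' k : ℤ, ct (n + 1 - k) * I (k - 1) := by
      rw [conv, ← (Equiv.subRight (1 : ℤ)).tsum_eq]
      refine tsum_congr fun k => ?_
      rw [Equiv.subRight_apply, show (n : ℤ) - (k - 1) = n + 1 - k by ring]
    rw [hs, conv, ← (summable_conv decay_ct _).summable.tsum_sub
      ((decay_comp_sub decay_ct _).mul_right _).summable, tsum_eq_single 1]
    · rw [hI, hI]; simp
    · intro k hk
      rw [hI, hI]
      rcases lt_or_gt_of_ne hk with h | h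
      · rw [if_neg (by omega), if_neg (by omega)]; ring
      · rw [if_pos (by omega), if_pos (by omega)]; ring
  have h2 (m : ℤ) : conv ct lamGeom m = conv ct lam m + conv ct I m := by
    simp only [conv]
    rw [← (summable_conv decay_ct m).summable.tsum_add (summable_conv decay_ct m).summable]
    exact tsum_congr fun k => by rw [lamGeom, hI]; ring
  have h3 : conv dct lam (n + 1) = conv ct lam (n + 1) - conv ct lam n := by
    simp only [conv]
    rw [← (summable_conv decay_ct _).summable.tsum_sub (summable_conv decay_ct _).summable]
    refine tsum_congr fun k => ?_
    rw [dct, show (n : ℤ) + 1 - k - 1 = n - k by ring]; ring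
  have h4 := conv_ct_lamGeom n
  have h5 := conv_ct_lamGeom (n + 1)
  push_cast at h5
  linear_combination h3 - h1 + h5 - h4 - h2 (n + 1) + h2 n

theorem conv_dct_lam (n : ℤ) :
    conv dct lam n = - ((n : ℚ⟦X⟧) * ct n - (n - 2 : ℤ) * ct (n - 1)) := by
  have key (n : ℕ) : conv dct lam (n + 1) =
      - (((n + 1 : ℤ) : ℚ⟦X⟧) * ct (n + 1) - (n + 1 - 2 : ℤ) * ct (n + 1 - 1)) := by
    rw [conv_dct_lam_natCast]
    rw [show (n : ℤ) + 1 - 1 = n by ring]; push_cast; ring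
  rcases le_or_gt n 0 with h | h
  -- `dct` is symmetric about 1 and `lam` is odd, so the nonpositive indices follow from the
  -- positive ones by n ↦ 2 - n.
  · obtain ⟨k, rfl⟩ : ∃ k : ℕ, n = 2 - (k + 1) := ⟨(1 - n).natAbs, by omega⟩
    have hr : conv dct lam (2 - (k + 1)) = - conv dct lam (k + 1) := by
      rw [conv, ← (Equiv.neg ℤ).tsum_eq, conv, ← tsum_neg]
      refine tsum_congr fun j => ?_
      rw [Equiv.neg_apply, lam_neg, show 2 - ((k : ℤ) + 1) - -j = 2 - (k + 1 - j) by ring,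
        dct_reflect]
      ring
    have e1 := ct_reflect (k + 1)
    have e2 := ct_reflect k
    rw [hr, key, show (k : ℤ) + 1 - 1 = k by ring, show (2 : ℤ) - (k + 1) = 1 - k by ring,
      show (1 : ℤ) - k - 1 = 1 - (k + 1) by ring, e1, e2]
    push_cast; ring
  · obtain ⟨k, rfl⟩ : ∃ k : ℕ, n = k + 1 := ⟨(n - 1).natAbs, by omega⟩
    exact key k

/-! ### Moments of the theta series centred at 1/2, and Ramanujan's equation. -/

/-- The moments `∑ (2n-1)^r (-1)^n q^(n(n-1)/2)`. -/
noncomputable def ctMoment (r : ℕ) : ℚ⟦X⟧ := moment (fun n => (2 * n - 1) ^ r) ct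

theorem euler_ct (n : ℤ) : 8 * euler (ct n) = (((2 * n - 1) ^ 2 - 1 : ℤ) : ℚ⟦X⟧) * ct n := by
  rw [ct, Derivation.leibniz, euler_sg, euler_xpow (tri_nonneg n), smul_zero, add_zero, smul_eq_mul,
    show ((2 * n - 1) ^ 2 - 1 : ℤ) = 8 * tri n by linarith [two_mul_tri n]]
  push_cast; ring

theorem euler_ctMoment (r : ℕ) : 8 * euler (ctMoment r) = ctMoment (r + 2) - ctMoment r := by
  have h (s : ℕ) := decay_ct.mul_left fun n : ℤ => (((2 * n - 1) ^ s : ℤ) : ℚ⟦X⟧)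
  rw [ctMoment, ctMoment, moment, moment, (h r).euler_tsum,
    ← (h _).summable.tsum_sub (h _).summable, ← Summable.tsum_mul_left]
  · refine tsum_congr fun n => ?_
    rw [euler_intCast_mul, mul_left_comm, euler_ct]; push_cast; ring
  · refine Decay.summable fun d => (h r d).subset fun n hn h' => hn ?_
    rw [X_pow_dvd_iff] at h' ⊢
    intro m hm
    rw [coeff_euler, h' m hm, mul_zero]

theorem moment_dct (w : ℤ → ℤ) : moment w dct = moment (fun n => w n - w (n + 1)) ct := by
  rw [show dct = fun n => ct n - ct (n - 1) from rfl, moment_sub decay_ct decay_ct_sub_one,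
    moment_shift, moment, moment, moment, ← (decay_ct.mul_left _).summable.tsum_sub
    (decay_ct.mul_left _).summable]
  exact tsum_congr fun n => by push_cast; ring

theorem moment_conv_dct_lam (w : ℤ → ℤ) : moment w (conv dct lam) =
    - moment (fun n => w n * n - w (n + 1) * (n - 1)) ct := by
  have h1 := decay_ct.mul_left fun n : ℤ => (n : ℚ⟦X⟧)
  have h2 := decay_ct_sub_one.mul_left fun n : ℤ => ((n - 2 : ℤ) : ℚ⟦X⟧)
  have : moment w (conv dct lam) = - moment w (fun n => (n : ℚ⟦X⟧) * ct n -
      (n - 2 : ℤ) * ct (n - 1)) := by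
    rw [moment, moment, ← tsum_neg]
    exact tsum_congr fun n => by rw [conv_dct_lam]; ring
  rw [this, moment_sub h1 h2, moment_weight_mul, moment_weight_mul (c := fun n => ct (n - 1)),
    moment_shift, moment, moment, moment, ← (decay_ct.mul_left _).summable.tsum_sub
    (decay_ct.mul_left _).summable]
  congr 1
  exact tsum_congr fun n => by push_cast; ring

/-- Re-expands a polynomial weight in powers of 2n - 1, the variable centred at the reflection n ↦ 1
- n; the factor `k` clears denominators. -/
theorem ctMoment_comb (a b : ℤ) (r s : ℕ) {w : ℤ → ℤ} (k : ℤ)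
    (h : ∀ n, k * w n = a * (2 * n - 1) ^ r + b * (2 * n - 1) ^ s) :
    (k : ℚ⟦X⟧) * moment w ct = a * ctMoment r + b * ctMoment s := by
  rw [← moment_weight_const_mul decay_ct, moment_congr h, moment_weight_add decay_ct,
    moment_weight_const_mul decay_ct, moment_weight_const_mul decay_ct, ctMoment, ctMoment]

/-- The third moment of `conv_dct_lam` about 1, the centre of `dct`. Even moments of `lam` vanish
and so does the zeroth moment of `dct`, so L_1 is the only Lambert series left. -/
theorem ctMoment_three : ctMoment 3 = ctMoment 1 * (1 - 24 * lambert 1) := by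
  have h3 : Odd 3 := by decide
  have e0 : Even 0 := by decide
  have e2 : Even 2 := by decide
  have h := moment_conv decay_dct decay_lam 3 (w := fun n => (n - 1) ^ 3) (u := fun n => n - 1)
    (v := id) fun m j => by simp only [id]; ring
  have l0 := ctMoment_comb (w := fun n => (n - 1) ^ 3 * n - (n + 1 - 1) ^ 3 * (n - 1)) (-1) 1 3 1 4
    fun n => by ring
  have l1 := ctMoment_comb (w := fun n => (n - 1) ^ 2 - (n + 1 - 1) ^ 2) (-1) 0 1 0 1
    fun n => by ring
  have l2 := ctMoment_comb (w := fun n => (n - 1) ^ 0 - (n + 1 - 1) ^ 0) 0 0 1 0 1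
    fun n => by ring
  simp only [id, Finset.sum_range_succ, Finset.sum_range_zero, Nat.choose, Nat.reduceSub,
    Nat.reduceAdd, moment_lam odd_one, moment_lam h3, moment_lam_even e2, moment_lam_even e0,
    moment_dct, moment_conv_dct_lam, mul_zero] at h
  push_cast at h l0 l1 l2
  linear_combination l0 + 4 * h + 24 * lambert 1 * l1 + 8 * lambert 3 * l2

/-- The fifth moment of the same convolution. L_5 could occur only with the zeroth moment of `dct`,
which is zero. -/
theorem ctMoment_five : ctMoment 5 = ctMoment 1 - 160 * lambert 3 * ctMoment 1
    - 40 * lambert 1 * (ctMoment 3 + ctMoment 1) := by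
  have h3 : Odd 3 := by decide
  have h5 : Odd 5 := by decide
  have e0 : Even 0 := by decide
  have e2 : Even 2 := by decide
  have e4 : Even 4 := by decide
  have h := moment_conv decay_dct decay_lam 5 (w := fun n => (n - 1) ^ 5) (u := fun n => n - 1)
    (v := id) fun m j => by simp only [id]; ring
  have l0 := ctMoment_comb (w := fun n => (n - 1) ^ 5 * n - (n + 1 - 1) ^ 5 * (n - 1)) (-1) 1 5 1 8
    fun n => by ring
  have l1 := ctMoment_comb (w := fun n => (n - 1) ^ 2 - (n + 1 - 1) ^ 2) (-1) 0 1 0 1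
    fun n => by ring
  have l2 := ctMoment_comb (w := fun n => (n - 1) ^ 0 - (n + 1 - 1) ^ 0) 0 0 1 0 1
    fun n => by ring
  have l4 := ctMoment_comb (w := fun n => (n - 1) ^ 4 - (n + 1 - 1) ^ 4) (-1) (-1) 3 1 2
    fun n => by ring
  simp only [id, Finset.sum_range_succ, Finset.sum_range_zero, Nat.choose, Nat.reduceSub,
    Nat.reduceAdd, moment_lam odd_one, moment_lam h3, moment_lam h5, moment_lam_even e2,
    moment_lam_even e4, moment_lam_even e0, moment_dct, moment_conv_dct_lam, mul_zero] at h
  push_cast at h l0 l1 l2 l4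
  linear_combination l0 + 8 * h + 40 * lambert 1 * l4 + 160 * lambert 3 * l1
    + 16 * lambert 5 * l2

theorem ctMoment_one_ne_zero : ctMoment 1 ≠ 0 := fun h => by
  have h2 := congrArg (coeff 0) h
  rw [ctMoment, moment, (decay_ct.mul_left _).coeff_tsum, finsum_eq_sum_of_support_subset
    (s := {0, 1})] at h2
  · rw [Finset.sum_pair zero_ne_one, ct_zero, ct_one] at h2
    norm_num at h2
  · intro n hn
    by_contra h'
    simp only [Finset.coe_insert, Finset.coe_singleton, Set.mem_insert_iff,
      Set.mem_singleton_iff, not_or] at h'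
    refine hn (X_pow_dvd_iff.1 (((dvd_mul_left _ _ : X ^ (tri n).toNat ∣ ct n).mul_left _)) 0 ?_)
    have := two_mul_tri n
    rcases lt_or_gt_of_ne h'.1 with h1 | h1
    · have : 0 < tri n := by nlinarith
      omega
    · have : 0 < tri n := by nlinarith [show (2 : ℤ) ≤ n by omega]
      omega

/-- The Ramanujan differential equation for the Eisenstein series of weight two. -/
theorem six_mul_euler_lambert :
    6 * euler (lambert 1) = lambert 1 - 12 * lambert 1 ^ 2 + 5 * lambert 3 := by
  -- Because 8 θ raises the moment index by two, applying θ to `ctMoment_three` relates the moments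
  -- 1, 3 and 5 to θL_1. Eliminating the moments 3 and 5 leaves a multiple of the nonzero first
  -- moment.
  have h1 := euler_ctMoment 1
  have h3 := euler_ctMoment 3
  have e := congrArg euler ctMoment_three
  have e' : euler (24 * lambert 1) = 24 * euler (lambert 1) := by
    simpa using euler_intCast_mul 24 (lambert 1)
  rw [Derivation.leibniz, smul_eq_mul, smul_eq_mul, map_sub, e', Derivation.map_one_eq_zero] at e
  refine mul_left_cancel₀ ctMoment_one_ne_zero (mul_left_cancel₀ (a := (32 : ℚ⟦X⟧)) (by norm_num) ?_)
  linear_combination 8 * e - h3 + (1 - 24 * lambert 1) * h1 - ctMoment_five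
    + (2 + 16 * lambert 1) * ctMoment_three

/-! ### Partial theta series -/

/-- The partial theta series `∑_{n ≥ 1} (-1)^n q^(n^2 + n m)`. -/
noncomputable def pt (m : ℕ) : ℚ⟦X⟧ :=
  ∑' n : ℕ, sg (n + 1) * xpow ((n + 1) ^ 2 + (n + 1) * m)

theorem decay_pt (m : ℕ) :
    Decay fun n : ℕ => sg (n + 1) * xpow ((n + 1) ^ 2 + (n + 1) * m) := by
  refine (decay_xpow (e := fun n : ℕ => ((n : ℤ) + 1) ^ 2 + (n + 1) * m) fun d =>
    (Set.finite_Iio d).subset fun x hx => ?_).mul_left _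
  simp only [Set.mem_ofPred_eq, Set.mem_Iio] at hx ⊢
  zify
  nlinarith [mul_nonneg (show (0 : ℤ) ≤ x + 1 by positivity) (show (0 : ℤ) ≤ m by positivity)]

/-- Removing the term n = 1 works because (n + 1)² + (n + 1)m = (m + 1) + n² + n(m + 2). -/
theorem pt_eq (m : ℕ) : pt m = - (X ^ (m + 1) * (1 + pt (m + 2))) := by
  have h := (decay_pt m).summable.tsum_eq_zero_add
  rw [pt, h, pt, mul_add, mul_one, neg_add, ← (decay_pt (m + 2)).summable.tsum_mul_left, ← tsum_neg]
  congr 1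
  · rw [← xpow_natCast]
    have : sg (((0 : ℕ) : ℤ) + 1) = -1 := by rw [sg_succ]; simp [sg_zero]
    rw [this]; push_cast; ring_nf
  · refine tsum_congr fun n => ?_
    rw [Nat.cast_add, Nat.cast_one, sg_succ, ← xpow_natCast, mul_left_comm,
      xpow_mul_xpow (by positivity) (by positivity)]
    push_cast
    ring_nf

theorem X_pow_dvd_pt (m : ℕ) : X ^ (m + 1) ∣ pt m := by
  rw [pt_eq]; exact (dvd_neg.2 (dvd_mul_right _ _))

theorem phi_eq : phi = 1 + 2 * pt 0 := by
  obtain ⟨f, hf⟩ : ∃ f : ℤ → ℚ⟦X⟧, ∀ n, f n = if n = 0 then 1 else 0 := ⟨_, fun _ => rfl⟩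
  have hfd : Decay f := by rw [funext hf]; exact decay_ite_eq_zero 1
  have h : ∑' n, (th n - f n) = 2 * ∑' n : ℕ, (th (n + 1) - f (n + 1)) :=
    tsum_int_even (decay_th.sub hfd) (fun k => by simp [th_neg, hf]) (by simp [th_zero, hf])
  rw [decay_th.summable.tsum_sub hfd.summable, tsum_congr hf, tsum_ite_eq] at h
  rw [phi, sub_eq_iff_eq_add.1 h, add_comm, pt]
  congr 2
  refine tsum_congr fun n => ?_
  rw [hf, if_neg (by omega), sub_zero, th]
  simp

/-! ### Weighted partial theta series and their functional equation. -/

/-- The weight `x^2 - 4 θφ/φ`. -/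
noncomputable def wt4 (x : ℤ) : ℚ⟦X⟧ := ((x ^ 2 : ℤ) : ℚ⟦X⟧) - 4 * dlogPhi

theorem wt4_neg (x : ℤ) : wt4 (-x) = wt4 x := by simp [wt4]

/-- The partial theta series `∑_{n ≥ 1} (-1)^n q^(n^2 + n m) ((m + 2n)^2 - 4 θφ/φ)`. -/
noncomputable def ptw (m : ℕ) : ℚ⟦X⟧ := wt4 m * pt m + 4 * euler (pt m)

/-- As n² + nm = ((m + 2n)² - m²)/4, the operator m² + 4θ multiplies each term by (m + 2n)². This
weight is unchanged by (m, n) ↦ (m + 2, n - 1), so the recurrence of `pt` carries over. -/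
theorem ptw_eq (m : ℕ) : ptw m = - (X ^ (m + 1) * (wt4 (m + 2) + ptw (m + 2))) := by
  have h := pt_eq m
  have e := congrArg euler h
  rw [map_neg, Derivation.leibniz, smul_eq_mul, smul_eq_mul, euler_X_pow, map_add,
    Derivation.map_one_eq_zero, zero_add] at e
  simp only [ptw, wt4]
  push_cast at e ⊢
  linear_combination 4 * e + ((m : ℚ⟦X⟧) ^ 2 - 4 * dlogPhi) * h

theorem ptw_zero : ptw 0 = 2 * dlogPhi := by
  have h := phi_eq
  have e := congrArg euler h
  have e2 : euler (2 * pt 0) = 2 * euler (pt 0) := by simpa using euler_intCast_mul 2 (pt 0)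
  rw [map_add, Derivation.map_one_eq_zero, e2, euler_phi] at e
  rw [ptw, wt4]
  push_cast
  linear_combination -2 * e + 2 * dlogPhi * h

theorem X_pow_dvd_euler {n : ℕ} {f : ℚ⟦X⟧} (h : X ^ n ∣ f) : X ^ n ∣ euler f := by
  rw [X_pow_dvd_iff] at h ⊢
  intro m hm
  rw [coeff_euler, h m hm, mul_zero]

theorem X_pow_dvd_ptw (m : ℕ) : X ^ (m + 1) ∣ ptw m := by
  rw [ptw_eq]; exact (dvd_neg.2 (dvd_mul_right _ _))

/-- The odd extension of `ptw`. -/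
noncomputable def od (m : ℤ) : ℚ⟦X⟧ := (m.sign : ℚ⟦X⟧) * ptw m.natAbs

theorem od_neg (m : ℤ) : od (-m) = - od m := by simp [od]

theorem od_zero : od 0 = 0 := by simp [od]

theorem od_natCast {m : ℕ} (hm : m ≠ 0) : od m = ptw m := by
  rw [od, Int.sign_eq_one_of_pos (by omega)]; simp

theorem decay_od : Decay od := decay_of_natAbs fun k =>
  (((pow_dvd_pow X (Nat.le_succ _)).trans (X_pow_dvd_ptw k.natAbs))).mul_left _

/-- The sum `od m + (1 + sgn m) / 2 * wt4 m`. -/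
noncomputable def pp (m : ℤ) : ℚ⟦X⟧ :=
  od m + if 0 < m then wt4 m else if m = 0 then -2 * dlogPhi else 0

theorem two_mul_pp (m : ℤ) : 2 * pp m = 2 * od m + (1 + (m.sign : ℚ⟦X⟧)) * wt4 m := by
  rw [pp]
  rcases lt_trichotomy m 0 with h | rfl | h
  · rw [if_neg (by omega), if_neg (by omega), Int.sign_eq_neg_one_of_neg h]; push_cast; ring
  · simp [wt4]; ring
  · rw [if_pos h, Int.sign_eq_one_of_pos h]; push_cast; ring

/-- The relation q^(m+1) pp(m + 2) = wt4(m) - pp(m) for every integer m, with q^(m+1) written as a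
quotient of nonnegative powers. The half-sign term in `pp` is what carries `ptw_eq` across zero.
Only m = -2, -1, 0 see a change of sign, and `ptw_zero` supplies the value needed at m = -2 and m =
0. -/
theorem xpow_mul_pp {m A B : ℤ} (hA : 0 ≤ A) (hB : 0 ≤ B) (h : A = B + m + 1) :
    xpow A * pp (m + 2) = xpow B * (wt4 m - pp m) := by
  have key (j : ℕ) : X ^ (j + 1) * (wt4 (j + 2) + od (j + 2)) = - ptw j := by
    rw [ptw_eq j]
    have := od_natCast (m := j + 2) (by omega)
    push_cast at this
    rw [this]; ring
  rcases lt_or_ge m (-2) with h1 | h1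
  · obtain ⟨j, rfl⟩ : ∃ j : ℕ, m = -(j + 2 : ℤ) := ⟨(m + 2).natAbs, by omega⟩
    have hj : j ≠ 0 := by omega
    have e : xpow B = xpow A * X ^ (j + 1) := by
      rw [← xpow_natCast, xpow_mul_xpow hA (by positivity)]; congr 1; push_cast; omega
    have k := key j
    rw [← od_natCast hj] at k
    rw [pp, pp, if_neg (by omega), if_neg (by omega), if_neg (by omega), if_neg (by omega),
      show -((j : ℤ) + 2) + 2 = -j by ring, od_neg, od_neg, wt4_neg, e]
    linear_combination - xpow A * k
  obtain rfl | rfl | rfl | h2 : m = -2 ∨ m = -1 ∨ m = 0 ∨ 0 < m := by omega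
  · have e : xpow B = xpow A * X ^ 1 := by
      rw [← xpow_natCast, xpow_mul_xpow hA (by positivity)]; congr 1; push_cast; omega
    have k := key 0
    simp only [Nat.cast_zero, zero_add, ptw_zero] at k
    rw [pp, pp, e, od_neg, wt4_neg]
    norm_num [od_zero]
    linear_combination - xpow A * k
  · obtain rfl : A = B := by omega
    rw [pp, pp, od_neg, wt4_neg]
    norm_num
    ring_nf; tauto
  · have e : xpow A = xpow B * X ^ 1 := by
      rw [← xpow_natCast, xpow_mul_xpow hB (by positivity)]; congr 1; push_cast; omega
    have k := key 0
    simp only [Nat.cast_zero, zero_add, ptw_zero] at k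
    rw [pp, pp, e]
    norm_num [od_zero, wt4]
    rw [wt4] at k
    norm_num at k
    linear_combination xpow B * k
  · obtain ⟨j, rfl⟩ : ∃ j : ℕ, m = j := ⟨m.natAbs, by omega⟩
    have hj : j ≠ 0 := by omega
    have e : xpow A = xpow B * X ^ (j + 1) := by
      rw [← xpow_natCast, xpow_mul_xpow hB (by positivity)]; congr 1; push_cast; omega
    have k := key j
    rw [← od_natCast hj] at k
    rw [pp, pp, if_pos (by omega), if_pos h2, e]
    linear_combination xpow B * k

theorem th_mul_pp (k : ℕ) (i : ℤ) : X ^ k * (th i * pp (k - 2 * i)) =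
    - (th (i + 1) * (wt4 (k - 2 * (i + 1)) - pp (k - 2 * (i + 1)))) := by
  have h := xpow_mul_pp (m := k - 2 * (i + 1)) (A := i ^ 2 + k) (B := (i + 1) ^ 2) (by positivity)
    (by positivity) (by ring)
  rw [show (k : ℤ) - 2 * (i + 1) + 2 = k - 2 * i by ring,
    ← xpow_mul_xpow (by positivity) (by positivity), xpow_natCast] at h
  rw [th, th, sg_succ]
  linear_combination sg i * h

/-- The constant -4 θφ/φ in `wt4` is chosen for this: it cancels the contribution 4 ∑ i² th(i) = 4
θφ. -/
theorem tsum_th_mul_wt4 (k : ℤ) : ∑' i, th i * wt4 (k - 2 * i) = (k : ℚ⟦X⟧) ^ 2 * phi := by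
  have e (i : ℤ) : th i * wt4 (k - 2 * i) = ((k : ℚ⟦X⟧) ^ 2 - 4 * dlogPhi) * th i
      - 4 * k * (((i ^ 1 : ℤ) : ℚ⟦X⟧) * th i) + 4 * (((i ^ 2 : ℤ) : ℚ⟦X⟧) * th i) := by
    rw [wt4]; push_cast; ring
  have hs (r : ℕ) := (decay_th.mul_left fun i : ℤ => ((i ^ r : ℤ) : ℚ⟦X⟧)).summable
  have m1 := moment_th_odd odd_one
  have m2 := moment_th_two
  rw [moment] at m1 m2
  rw [tsum_congr e, Summable.tsum_add, Summable.tsum_sub, decay_th.summable.tsum_mul_left,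
    (hs 1).tsum_mul_left, (hs 2).tsum_mul_left, m1, m2, ← phi, euler_phi]
  · ring
  · exact decay_th.summable.mul_left _
  · exact (hs 1).mul_left _
  · exact (decay_th.summable.mul_left _).sub ((hs 1).mul_left _)
  · exact (hs 2).mul_left _

/-- Summing `th_mul_pp` over `i` and shifting the index gives q^k V = V - k² φ for the sum V on the
left. -/
theorem one_sub_mul_tsum_th_mul_pp (k : ℕ) :
    (1 - X ^ k) * ∑' i, th i * pp (k - 2 * i) = (k : ℚ⟦X⟧) ^ 2 * phi := by
  have h1 := (decay_th.mul_right fun i => pp (k - 2 * i)).summable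
  have h2 := (decay_th.mul_right fun i => wt4 (k - 2 * i)).summable
  have e : X ^ k * ∑' i, th i * pp (k - 2 * i) =
      - ∑' i, th i * (wt4 (k - 2 * i) - pp (k - 2 * i)) := by
    rw [← h1.tsum_mul_left, tsum_congr (th_mul_pp k), tsum_neg]
    congr 1
    exact (Equiv.addRight (1 : ℤ)).tsum_eq fun i => th i * (wt4 (k - 2 * i) - pp (k - 2 * i))
  simp only [mul_sub] at e
  rw [h2.tsum_sub h1, tsum_th_mul_wt4] at e
  push_cast at e
  linear_combination -e

/-- Replacing `pp` by `od` costs half-sign terms. They are measured against sgn k, so that for each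
fixed `i` the correction is nonzero for only finitely many `k`. -/
theorem two_mul_tsum_th_mul_od_natCast (k : ℕ) (hk : k ≠ 0) : 2 * ∑' i, th i * od (k - 2 * i) =
    2 * (k : ℚ⟦X⟧) ^ 2 * phi * lam k +
      ∑' i, th i * (((Int.sign k - Int.sign (k - 2 * i) : ℤ) : ℚ⟦X⟧) * wt4 (k - 2 * i)) := by
  have hV := one_sub_mul_tsum_th_mul_pp k
  have hl := one_sub_mul_lam hk
  have s1 := (decay_th.mul_right fun i => od (k - 2 * i)).summable
  have s2 := (decay_th.mul_right fun i => wt4 (k - 2 * i)).summable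
  have s3 := (decay_th.mul_right fun i =>
    ((Int.sign k - Int.sign (k - 2 * i) : ℤ) : ℚ⟦X⟧) * wt4 (k - 2 * i)).summable
  have s4 := (decay_th.mul_right fun i => pp (k - 2 * i)).summable
  have e : 2 * ∑' i, th i * pp (k - 2 * i) = 2 * ∑' i, th i * od (k - 2 * i)
      + 2 * ∑' i, th i * wt4 (k - 2 * i) - ∑' i, th i *
        (((Int.sign k - Int.sign (k - 2 * i) : ℤ) : ℚ⟦X⟧) * wt4 (k - 2 * i)) := by
    rw [← s4.tsum_mul_left, ← s1.tsum_mul_left, ← s2.tsum_mul_left,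
      ← (s1.mul_left _).tsum_add (s2.mul_left _),
      ← ((s1.mul_left _).add (s2.mul_left _)).tsum_sub s3]
    refine tsum_congr fun i => ?_
    rw [Int.sign_eq_one_of_pos (show (0 : ℤ) < k by omega)]
    push_cast
    linear_combination th i * two_mul_pp (k - 2 * i)
  rw [tsum_th_mul_wt4] at e
  push_cast at e
  -- For k > 0, lam k + 1 = 1/(1 - q^k). The summand 1 is cancelled by the full `wt4` sum.
  have e2 : 2 * ∑' i, th i * pp (k - 2 * i) = 2 * (k : ℚ⟦X⟧) ^ 2 * phi * (lam k + 1) := by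
    refine mul_left_cancel₀ (one_sub_X_pow_ne_zero hk) ?_
    linear_combination 2 * hV - 2 * (k : ℚ⟦X⟧) ^ 2 * phi * hl
  push_cast at e2 ⊢
  linear_combination e2 - e

theorem two_mul_tsum_th_mul_od (k : ℤ) : 2 * ∑' i, th i * od (k - 2 * i) =
    2 * (k : ℚ⟦X⟧) ^ 2 * phi * lam k +
      ∑' i, th i * (((Int.sign k - Int.sign (k - 2 * i) : ℤ) : ℚ⟦X⟧) * wt4 (k - 2 * i)) := by
  have r1 (k : ℤ) : ∑' i, th i * od (-k - 2 * i) = - ∑' i, th i * od (k - 2 * i) := by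
    rw [← (Equiv.neg ℤ).tsum_eq, ← tsum_neg]
    refine tsum_congr fun i => ?_
    rw [Equiv.neg_apply, th_neg, show -k - 2 * -i = -(k - 2 * i) by ring, od_neg, mul_neg]
  have r2 (k : ℤ) : ∑' i, th i * (((Int.sign (-k) - Int.sign (-k - 2 * i) : ℤ) : ℚ⟦X⟧) *
      wt4 (-k - 2 * i)) =
      - ∑' i, th i * (((Int.sign k - Int.sign (k - 2 * i) : ℤ) : ℚ⟦X⟧) * wt4 (k - 2 * i)) := by
    rw [← (Equiv.neg ℤ).tsum_eq, ← tsum_neg]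
    refine tsum_congr fun i => ?_
    rw [Equiv.neg_apply, th_neg, show -k - 2 * -i = -(k - 2 * i) by ring, wt4_neg, Int.sign_neg,
      Int.sign_neg]
    push_cast; ring
  rcases eq_or_ne k 0 with rfl | hk
  · have a1 := r1 0
    have a2 := r2 0
    rw [neg_zero] at a1 a2
    rw [self_eq_neg.1 a1, self_eq_neg.1 a2]; simp
  rcases k.eq_nat_or_neg with ⟨j, rfl | rfl⟩
  · simpa using two_mul_tsum_th_mul_od_natCast j (by omega)
  · have := two_mul_tsum_th_mul_od_natCast j (by omega)
    rw [r1, r2, lam_neg]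
    push_cast at this ⊢
    linear_combination -this

/-! ### The rank-crank identity -/

theorem twelve_mul_sum_range (M : ℚ⟦X⟧) (N : ℕ) :
    12 * ∑ k ∈ Finset.range N, (k : ℚ⟦X⟧) * (M - k) ^ 2 =
      6 * M ^ 2 * (N * (N - 1)) - 4 * M * (N * (N - 1) * (2 * N - 1)) + 3 * (N * (N - 1)) ^ 2 := by
  induction N with
  | zero => simp
  | succ N ih => rw [Finset.sum_range_succ, mul_add, ih]; push_cast; ring

theorem two_mul_sum_range (N : ℕ) :
    2 * ∑ k ∈ Finset.range N, (k : ℚ⟦X⟧) = N * (N - 1) := by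
  induction N with
  | zero => simp
  | succ N ih => rw [Finset.sum_range_succ, mul_add, ih]; push_cast; ring

/-- The kernel `k (sgn k - sgn (k - N)) f (k - N)`. -/
noncomputable def signKernel (f : ℤ → ℚ⟦X⟧) (N k : ℤ) : ℚ⟦X⟧ :=
  ((k * (k.sign - (k - N).sign) : ℤ) : ℚ⟦X⟧) * f (k - N)

theorem signKernel_eq_zero (f : ℤ → ℚ⟦X⟧) {N k : ℤ} (h : |N| < |k|) : signKernel f N k = 0 := by
  have : k.sign = (k - N).sign := by
    rcases abs_lt.1 h with ⟨h1, h2⟩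
    rcases lt_or_ge k 0 with hk | hk
    · rw [abs_of_neg hk] at h1 h2
      rw [Int.sign_eq_neg_one_of_neg hk, Int.sign_eq_neg_one_of_neg (by omega)]
    · rw [abs_of_nonneg hk] at h1 h2
      rw [Int.sign_eq_one_of_pos (by omega), Int.sign_eq_one_of_pos (by omega)]
  rw [signKernel, this]; simp

theorem tsum_signKernel_natCast (f : ℤ → ℚ⟦X⟧) (hf : ∀ x, f (-x) = f x) (N : ℕ) :
    ∑' k, signKernel f N k = 2 * (∑ k ∈ Finset.range N, (k : ℚ⟦X⟧) * f (N - k)) + N * f 0 := by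
  rw [tsum_eq_sum (s := (Finset.range (N + 1)).map Nat.castEmbedding), Finset.sum_map,
    Finset.sum_range_succ, Finset.mul_sum]
  · congr 1
    · refine Finset.sum_congr rfl fun k hk => ?_
      rw [Finset.mem_range] at hk
      rw [Nat.castEmbedding_apply, signKernel, Int.sign_eq_neg_one_of_neg (a := (k : ℤ) - N)
        (by omega), ← hf, neg_sub]
      rcases Nat.eq_zero_or_pos k with rfl | h
      · simp
      · rw [Int.sign_eq_one_of_pos (by omega)]; push_cast; ring
    · rw [Nat.castEmbedding_apply, signKernel, sub_self]
      rcases Nat.eq_zero_or_pos N with rfl | h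
      · simp
      · rw [Int.sign_eq_one_of_pos (by omega)]; simp
  · intro k hk
    rcases lt_or_ge k 0 with h | h
    · rw [signKernel, Int.sign_eq_neg_one_of_neg h, Int.sign_eq_neg_one_of_neg (by omega)]; simp
    · refine signKernel_eq_zero f ?_
      by_contra h'
      refine hk (Finset.mem_map.2 ⟨k.toNat, ?_, ?_⟩)
      · rw [abs_of_nonneg h, Nat.abs_cast] at h'
        rw [Finset.mem_range]; omega
      · simp [h]

theorem tsum_signKernel_neg (f : ℤ → ℚ⟦X⟧) (hf : ∀ x, f (-x) = f x) (N : ℤ) :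
    ∑' k, signKernel f (-N) k = ∑' k, signKernel f N k := by
  rw [← (Equiv.neg ℤ).tsum_eq]
  refine tsum_congr fun k => ?_
  rw [Equiv.neg_apply, signKernel, signKernel, show -k - -N = -(k - N) by ring, hf, Int.sign_neg,
    Int.sign_neg]
  push_cast; ring

theorem tsum_signKernel_wt4 (s : ℕ) (N : ℤ) : 6 * ∑' k, signKernel (fun x => wt4 (s * x)) N k =
    (s : ℚ⟦X⟧) ^ 2 * ((N : ℚ⟦X⟧) ^ 4 - (N : ℚ⟦X⟧) ^ 2) - 24 * dlogPhi * (N : ℚ⟦X⟧) ^ 2 := by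
  have hf (x : ℤ) : wt4 (s * -x) = wt4 (s * x) := by rw [mul_neg, wt4_neg]
  have key (N : ℕ) : 6 * ∑' k, signKernel (fun x => wt4 (s * x)) N k =
      (s : ℚ⟦X⟧) ^ 2 * ((N : ℚ⟦X⟧) ^ 4 - (N : ℚ⟦X⟧) ^ 2) - 24 * dlogPhi * (N : ℚ⟦X⟧) ^ 2 := by
    rw [tsum_signKernel_natCast _ hf]
    have e : ∑ k ∈ Finset.range N, (k : ℚ⟦X⟧) * wt4 (s * (N - k)) =
        (s : ℚ⟦X⟧) ^ 2 * (∑ k ∈ Finset.range N, (k : ℚ⟦X⟧) * (N - k) ^ 2)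
          - 4 * dlogPhi * ∑ k ∈ Finset.range N, (k : ℚ⟦X⟧) := by
      rw [Finset.mul_sum, Finset.mul_sum, ← Finset.sum_sub_distrib]
      refine Finset.sum_congr rfl fun k _ => ?_
      rw [wt4]; push_cast; ring
    rw [e, wt4]
    push_cast
    linear_combination (s : ℚ⟦X⟧) ^ 2 * twelve_mul_sum_range N N - 24 * dlogPhi * two_mul_sum_range N
  rcases N.eq_nat_or_neg with ⟨j, rfl | rfl⟩
  · simpa using key j
  · rw [tsum_signKernel_neg _ hf, key]; push_cast; ring

theorem decay_mul_injective (s : ℕ) (hs : s ≠ 0) {c : ℤ → ℚ⟦X⟧} (hc : Decay c) :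
    Decay fun k : ℤ => c (s * k) :=
  hc.comp (e := fun k => s * k) fun _ _ h => by simpa [hs] using h

/-- The shear `(k, i) ↦ (k - t i, i)`. -/
def shearMul (t : ℤ) : ℤ × ℤ ≃ ℤ × ℤ where
  toFun x := (x.1 - t * x.2, x.2)
  invFun x := (x.1 + t * x.2, x.2)
  left_inv x := by simp
  right_inv x := by simp

/-- For fixed first index the kernel has finite support in the second, so the decay of `th` suffices
even though the kernel itself need not decay. -/
theorem decay_th_mul_signKernel (s t : ℕ) : Decay fun x : ℤ × ℤ =>
    th x.1 * signKernel (fun y => wt4 (s * y)) (t * x.1) x.2 := fun d => by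
  refine (((decay_th d).biUnion (t := fun i => {x : ℤ × ℤ | x.1 = i ∧ |x.2| ≤ |t * i|})
    fun i _ => ?_)).subset fun x hx => ?_
  · refine ((Set.finite_singleton i).prod (Set.finite_Icc (-|t * i|) |t * i|)).subset fun x hx => ?_
    exact ⟨hx.1, abs_le.1 hx.2⟩
  · simp only [Set.mem_iUnion, Set.mem_ofPred_eq, exists_prop]
    refine ⟨x.1, fun h => hx (h.mul_right _), rfl, ?_⟩
    by_contra h
    exact hx (by simp only [signKernel_eq_zero _ (not_le.1 h), mul_zero, dvd_zero])

theorem decay_th_mul_od_shear {s : ℕ} (hs : s ≠ 0) (t : ℕ) :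
    Decay fun x : ℤ × ℤ => th x.2 * od (s * (x.1 - t * x.2)) := by
  refine (((decay_mul_injective s hs decay_od).prod decay_th).comp (shearMul t).injective).mono
    fun x => ?_
  rw [mul_comm (th _)]; rfl

/-- The substitution k ↦ k + t i separates the double sum. The extra term t i carries the vanishing
first moment of `th`. -/
theorem tsum_mul_tsum_th_mul_od {s : ℕ} (hs : s ≠ 0) (t : ℕ) :
    ∑' k : ℤ, (k : ℚ⟦X⟧) * (2 * ∑' i, th i * od (s * (k - t * i))) =
      2 * (phi * moment (fun k => k) fun k => od (s * k)) := by
  have dod := decay_mul_injective s hs decay_od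
  have q1 (k : ℤ) : (k : ℚ⟦X⟧) * (2 * ∑' i, th i * od (s * (k - t * i))) =
      ∑' i, (2 * (k : ℚ⟦X⟧)) * (th i * od (s * (k - t * i))) := by
    rw [(decay_th.mul_right _).summable.tsum_mul_left]; ring
  rw [tsum_congr q1,
    ← ((decay_th_mul_od_shear hs t).mul_left fun x => 2 * (x.1 : ℚ⟦X⟧)).tsum_prod,
    ← (shearMul t).symm.tsum_eq]
  have q2 (x : ℤ × ℤ) : 2 * ((((shearMul t).symm x).1 : ℤ) : ℚ⟦X⟧) *
      (th ((shearMul t).symm x).2 *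
        od (s * (((shearMul t).symm x).1 - t * ((shearMul t).symm x).2))) =
      2 * ((x.1 : ℚ⟦X⟧) * od (s * x.1) * th x.2)
      + 2 * t * (od (s * x.1) * (((x.2 ^ 1 : ℤ) : ℚ⟦X⟧) * th x.2)) := by
    simp only [shearMul, Equiv.coe_fn_symm_mk, add_sub_cancel_right]
    push_cast; ring
  have d4 := (dod.mul_left fun k => (k : ℚ⟦X⟧))
  have d5 := (decay_th.mul_left fun k => ((k ^ 1 : ℤ) : ℚ⟦X⟧))
  have hz := moment_th_odd odd_one
  rw [moment] at hz
  rw [tsum_congr q2, ((d4.prod decay_th).summable.mul_left _).tsum_add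
    ((dod.prod d5).summable.mul_left _), (d4.prod decay_th).summable.tsum_mul_left,
    (dod.prod d5).summable.tsum_mul_left, ← d4.tsum_mul_tsum decay_th, ← dod.tsum_mul_tsum d5,
    hz, phi, moment]
  ring

theorem decay_th_mul_signKernel_swap (s t : ℕ) : Decay fun x : ℤ × ℤ =>
    th x.2 * signKernel (fun y => wt4 (s * y)) (t * x.2) x.1 :=
  (decay_th_mul_signKernel s t).comp (e := fun x : ℤ × ℤ => (x.2, x.1)) fun _ _ h =>
    Prod.ext (Prod.ext_iff.1 h).2 (Prod.ext_iff.1 h).1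

/-- With the order of summation exchanged, the sum over `k` is a polynomial in `i`, and the
remaining moments of `th` are θφ and θ²φ. -/
theorem tsum_th_mul_signKernel (s t : ℕ) (hst : s * t = 2) :
    6 * ∑' k : ℤ, ∑' i, th i * signKernel (fun x => wt4 (s * x)) (t * i) k =
      4 * (t : ℚ⟦X⟧) ^ 2 * euler (euler phi) - 4 * euler phi
        - 24 * (t : ℚ⟦X⟧) ^ 2 * dlogPhi * euler phi := by
  have hstq : (s : ℚ⟦X⟧) * t = 2 := by exact_mod_cast hst
  have d2 := decay_th_mul_signKernel s t
  have hcomm : ∑' k : ℤ, ∑' i, th i * signKernel (fun x => wt4 (s * x)) (t * i) k =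
      ∑' i, ∑' k : ℤ, th i * signKernel (fun x => wt4 (s * x)) (t * i) k :=
    (decay_th_mul_signKernel_swap s t).tsum_comm
  rw [hcomm]
  have q (i : ℤ) : 6 * ∑' k, th i * signKernel (fun y => wt4 (s * y)) (t * i) k =
      4 * (t : ℚ⟦X⟧) ^ 2 * (((i ^ 4 : ℤ) : ℚ⟦X⟧) * th i) -
      (4 + 24 * (t : ℚ⟦X⟧) ^ 2 * dlogPhi) * (((i ^ 2 : ℤ) : ℚ⟦X⟧) * th i) := by
    have hsk : Summable fun k => signKernel (fun y => wt4 (s * y)) (t * i) k := by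
      refine summable_of_hasFiniteSupport (finite_of_abs_le |t * i| fun k hk => ?_)
      by_contra h
      exact hk (signKernel_eq_zero _ (not_le.1 h))
    rw [hsk.tsum_mul_left]
    have := tsum_signKernel_wt4 s (t * i)
    push_cast at this ⊢
    linear_combination th i * this + th i * ((i : ℚ⟦X⟧) ^ 4 * t ^ 2 - i ^ 2)
      * (s * t + 2) * hstq
  have d6 (r : ℕ) : Summable fun i : ℤ => ((i ^ r : ℤ) : ℚ⟦X⟧) * th i :=
    (decay_th.mul_left fun i : ℤ => ((i ^ r : ℤ) : ℚ⟦X⟧)).summable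
  have m2 := moment_th_two
  have m4 := moment_th_four
  rw [moment] at m2 m4
  rw [← d2.tsum_fst.summable.tsum_mul_left, tsum_congr q,
    ((d6 4).mul_left _).tsum_sub ((d6 2).mul_left _), (d6 4).tsum_mul_left,
    (d6 2).tsum_mul_left, m2, m4]
  ring

/-- This is `two_mul_tsum_th_mul_od` at the multiples sk, times k. The condition st = 2 makes s a
common factor of sk - 2i, which does not affect its sign. -/
theorem mul_tsum_th_mul_od (s t : ℕ) (hst : s * t = 2) (k : ℤ) :
    (k : ℚ⟦X⟧) * (2 * ∑' i, th i * od (s * (k - t * i))) =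
      2 * (s : ℚ⟦X⟧) ^ 2 * phi * (((k ^ 3 : ℤ) : ℚ⟦X⟧) * lam (s * k)) +
      ∑' i, th i * signKernel (fun x => wt4 (s * x)) (t * i) k := by
  have hs : s ≠ 0 := by rintro rfl; omega
  have hst' : (s : ℤ) * t = 2 := by exact_mod_cast hst
  have h := two_mul_tsum_th_mul_od (s * k)
  have hk (i : ℤ) : (s : ℤ) * k - 2 * i = s * (k - t * i) := by rw [← hst']; ring
  have hsg (x : ℤ) : Int.sign (s * x) = Int.sign x := by
    rw [Int.sign_mul, Int.sign_eq_one_of_pos (by omega), one_mul]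
  simp only [hk, hsg] at h
  rw [h, mul_add, ← (decay_th.mul_right _).summable.tsum_mul_left]
  congr 1
  · push_cast; ring
  · refine tsum_congr fun i => ?_
    rw [signKernel]; push_cast; ring

/-- The sum over all `k` of `mul_tsum_th_mul_od`. The case (s, t) = (1, 2) serves the rank and (2,
1) the M2-rank. -/
theorem phi_mul_moment_od (s t : ℕ) (hst : s * t = 2) :
    12 * (phi * moment (fun k => k) fun k => od (s * k)) =
      12 * (s : ℚ⟦X⟧) ^ 2 * (phi * moment (fun k => k ^ 3) fun k => lam (s * k))
      + 4 * (t : ℚ⟦X⟧) ^ 2 * euler (euler phi) - 4 * euler phi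
      - 24 * (t : ℚ⟦X⟧) ^ 2 * dlogPhi * euler phi := by
  have hs : s ≠ 0 := by rintro rfl; omega
  have hL := tsum_mul_tsum_th_mul_od hs t
  have hR := tsum_th_mul_signKernel s t hst
  have d7 : Summable fun k : ℤ => ((k ^ 3 : ℤ) : ℚ⟦X⟧) * lam (s * k) :=
    ((decay_mul_injective s hs decay_lam).mul_left fun k => ((k ^ 3 : ℤ) : ℚ⟦X⟧)).summable
  have d8 := (decay_th_mul_signKernel_swap s t).tsum_fst.summable
  rw [tsum_congr (mul_tsum_th_mul_od s t hst), (d7.mul_left _).tsum_add d8, d7.tsum_mul_left] at hL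
  rw [moment] at hL ⊢
  rw [moment]
  linear_combination -6 * hL + hR

/-- The weighted sums `∑_{k ≥ 1} k^r ∑_{n ≥ 1} (-1)^n q^(n^2 + s n k)`. -/
noncomputable def ptMoment (s r : ℕ) : ℚ⟦X⟧ :=
  ∑' k : ℕ, ((k + 1 : ℕ) : ℚ⟦X⟧) ^ r * pt (s * (k + 1))

theorem decay_pt_mul {s : ℕ} (hs : s ≠ 0) : Decay fun k : ℕ => pt (s * (k + 1)) :=
  Decay.of_dvd (fun k => k) (fun d => Set.finite_Iio d) fun k =>
    (pow_dvd_pow X (by nlinarith [Nat.pos_of_ne_zero hs])).trans (X_pow_dvd_pt _)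

theorem moment_od {s : ℕ} (hs : s ≠ 0) : moment (fun k => k) (fun k => od (s * k)) =
    2 * ((s : ℚ⟦X⟧) ^ 2 * ptMoment s 3 + 4 * euler (ptMoment s 1)
      - 4 * dlogPhi * ptMoment s 1) := by
  have dod := decay_mul_injective s hs decay_od
  have dp := decay_pt_mul hs
  have d3 := (dp.mul_left fun k => ((k + 1 : ℕ) : ℚ⟦X⟧) ^ 3).summable
  have d1' := (dp.mul_left fun k => ((k + 1 : ℕ) : ℚ⟦X⟧) ^ 1)
  have d1 := d1'.summable
  have de : Summable fun k : ℕ => ((k + 1 : ℕ) : ℚ⟦X⟧) ^ 1 * euler (pt (s * (k + 1))) :=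
    (Decay.mul_left (f := fun k : ℕ => euler (pt (s * (k + 1)))) (fun d => (dp d).subset
      fun k hk h => hk (X_pow_dvd_euler h)) _).summable
  have he : euler (ptMoment s 1) = ∑' k : ℕ, ((k + 1 : ℕ) : ℚ⟦X⟧) ^ 1 * euler (pt (s * (k + 1))) := by
    rw [ptMoment, d1'.euler_tsum]
    refine tsum_congr fun k => ?_
    rw [pow_one]
    exact_mod_cast euler_intCast_mul (k + 1 : ℕ) (pt (s * (k + 1)))
  rw [moment, tsum_int_even (dod.mul_left _) _ (by simp)]
  · congr 1
    rw [he, ptMoment, ptMoment, ← d3.tsum_mul_left, ← de.tsum_mul_left, ← d1.tsum_mul_left,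
      ← (d3.mul_left _).tsum_add (de.mul_left _),
      ← ((d3.mul_left _).add (de.mul_left _)).tsum_sub (d1.mul_left _)]
    refine tsum_congr fun k => ?_
    have := od_natCast (m := s * (k + 1)) (by positivity)
    push_cast at this
    rw [this, ptw, wt4]
    push_cast; ring
  · intro k
    rw [mul_neg, od_neg]; push_cast; ring

theorem lam_two_mul (k : ℤ) : lam (2 * k) = expand 2 two_ne_zero (lam k) := by
  have key {k : ℕ} (hk : k ≠ 0) : lam (2 * k) = expand 2 two_ne_zero (lam k) := by
    refine mul_left_cancel₀ (one_sub_X_pow_ne_zero (k := 2 * k) (by omega)) ?_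
    rw [one_sub_mul_expand_lam hk]
    have := one_sub_mul_lam (k := 2 * k) (by omega)
    push_cast at this
    exact this
  rcases eq_or_ne k 0 with rfl | hk
  · simp [lam_zero]
  rcases k.eq_nat_or_neg with ⟨j, rfl | rfl⟩
  · exact key (by omega)
  · rw [mul_neg, lam_neg, lam_neg, key (by omega), map_neg]

/-- The previous identity divided by φ, using θ²φ/φ = θ(dlogPhi) + dlogPhi². After multiplication by
P it is a differential equation connecting the fourth and second rank moments. -/
theorem ptMoment_one_identity :
    6 * (ptMoment 1 3 + 4 * euler (ptMoment 1 1) - 4 * dlogPhi * ptMoment 1 1) =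
      6 * lambert 3 + 4 * (euler dlogPhi + dlogPhi ^ 2) - dlogPhi - 24 * dlogPhi ^ 2 := by
  have h3 : Odd 3 := by decide
  have h := phi_mul_moment_od 1 2 rfl
  have e := congrArg euler euler_phi
  rw [Derivation.leibniz, smul_eq_mul, smul_eq_mul] at e
  rw [moment_od one_ne_zero] at h
  simp only [Nat.cast_one, one_mul, moment_lam h3] at h
  rw [e, euler_phi] at h
  refine mul_left_cancel₀ phi_ne_zero (mul_left_cancel₀ (a := (4 : ℚ⟦X⟧)) (by norm_num) ?_)
  push_cast at h
  linear_combination h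

theorem ptMoment_two_identity :
    6 * (4 * ptMoment 2 3 + 4 * euler (ptMoment 2 1) - 4 * dlogPhi * ptMoment 2 1) =
      24 * lambert2 3 + (euler dlogPhi + dlogPhi ^ 2) - dlogPhi - 6 * dlogPhi ^ 2 := by
  have h3 : Odd 3 := by decide
  have h := phi_mul_moment_od 2 1 rfl
  have e := congrArg euler euler_phi
  rw [Derivation.leibniz, smul_eq_mul, smul_eq_mul] at e
  rw [moment_od two_ne_zero] at h
  push_cast at h
  simp only [lam_two_mul, moment_expand decay_lam, moment_lam h3] at h
  rw [e, euler_phi] at h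
  rw [lambert2]
  simp only [map_mul, map_ofNat] at h
  refine mul_left_cancel₀ phi_ne_zero (mul_left_cancel₀ (a := (4 : ℚ⟦X⟧)) (by norm_num) ?_)
  linear_combination h

/-! ### Recurrences for rank generating functions -/

/-- The coefficient of a power series over `ℚ⟦X⟧` at an integer, zero at negative integers. -/
noncomputable def zc (f : ℚ⟦X⟧⟦X⟧) (k : ℤ) : ℚ⟦X⟧ := if 0 ≤ k then coeff k.toNat f else 0

theorem zc_of_neg (f : ℚ⟦X⟧⟦X⟧) {k : ℤ} (h : k < 0) : zc f k = 0 := if_neg (not_le.2 h)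

theorem zc_natCast (f : ℚ⟦X⟧⟦X⟧) (k : ℕ) : zc f k = coeff k f := by simp [zc]

theorem zc_add (f g : ℚ⟦X⟧⟦X⟧) (k : ℤ) : zc (f + g) k = zc f k + zc g k := by
  rw [zc, zc, zc]; split_ifs <;> simp

theorem zc_sub (f g : ℚ⟦X⟧⟦X⟧) (k : ℤ) : zc (f - g) k = zc f k - zc g k := by
  rw [zc, zc, zc]; split_ifs <;> simp

theorem zc_C_mul (a : ℚ⟦X⟧) (f : ℚ⟦X⟧⟦X⟧) (k : ℤ) : zc (C a * f) k = a * zc f k := by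
  rw [zc, zc]; split_ifs <;> simp

theorem zc_X_mul (f : ℚ⟦X⟧⟦X⟧) (k : ℤ) : zc (X * f) k = zc f (k - 1) := by
  rcases lt_trichotomy k 0 with h | rfl | h
  · rw [zc_of_neg _ h, zc_of_neg _ (by omega)]
  · rw [zc_of_neg _ (k := 0 - 1) (by omega), zc]; simp
  · obtain ⟨j, rfl⟩ : ∃ j : ℕ, k = (j + 1 : ℕ) := ⟨(k - 1).toNat, by omega⟩
    rw [zc_natCast, coeff_succ_X_mul, Nat.cast_succ, add_sub_cancel_right, zc_natCast]

theorem zc_rescale (a : ℚ⟦X⟧) (f : ℚ⟦X⟧⟦X⟧) (k : ℤ) :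
    zc (rescale a f) k = a ^ k.toNat * zc f k := by
  rw [zc, zc]; split_ifs <;> simp

theorem zc_C (a : ℚ⟦X⟧) (k : ℤ) : zc (C a) k = if k = 0 then a else 0 := by
  rcases lt_or_ge k 0 with h | h
  · rw [zc_of_neg _ h, if_neg h.ne]
  · obtain ⟨j, rfl⟩ : ∃ j : ℕ, k = j := ⟨k.toNat, by omega⟩
    rw [zc_natCast, coeff_C]; simp

/-- The diagonal sums `∑ κ, Q^κ [w^(κ - m)] f κ`. -/
noncomputable def diag (Q : ℚ⟦X⟧) (f : ℕ → ℚ⟦X⟧⟦X⟧) (m : ℤ) : ℚ⟦X⟧ :=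
  ∑' κ : ℕ, Q ^ κ * zc (f κ) (κ - m)

theorem decay_pow {Q : ℚ⟦X⟧} (hQ : X ∣ Q) : Decay fun κ : ℕ => Q ^ κ :=
  Decay.of_dvd (fun κ => κ) (fun d => Set.finite_Iio d) fun κ => pow_dvd_pow_of_dvd hQ κ

theorem decay_diag {Q : ℚ⟦X⟧} (hQ : X ∣ Q) (f : ℕ → ℚ⟦X⟧) : Decay fun κ : ℕ => Q ^ κ * f κ :=
  (decay_pow hQ).mul_right _

theorem pow_dvd_diag {Q : ℚ⟦X⟧} (hQ : X ∣ Q) (f : ℕ → ℚ⟦X⟧⟦X⟧) (m : ℕ) : X ^ m ∣ diag Q f m := by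
  refine (decay_diag hQ _).tsum_dvd fun κ => ?_
  rcases lt_or_ge κ m with h | h
  · rw [zc_of_neg _ (by omega)]; simp
  · exact ((pow_dvd_pow X h).trans (pow_dvd_pow_of_dvd hQ κ)).mul_right _

theorem diag_eq_zero_add {Q : ℚ⟦X⟧} (hQ : X ∣ Q) (f : ℕ → ℚ⟦X⟧⟦X⟧) (m : ℤ) :
    diag Q f m = zc (f 0) (-m) + ∑' κ : ℕ, Q ^ (κ + 1) * zc (f (κ + 1)) (κ + 1 - m) := by
  rw [diag, (decay_diag hQ _).summable.tsum_eq_zero_add]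
  simp



/-- The recurrence satisfied by the generating functions `ψ κ`, in the variable counting the
weight, of the overpartitions of level at most `κ`, up to the factor `1 - s Q^(κ+1)`. -/
structure RankSystem (Q s : ℚ⟦X⟧) (ψ : ℕ → ℚ⟦X⟧⟦X⟧) : Prop where
  dvd : X ∣ Q
  zero : ∃ a, ψ 0 = C a
  succ : ∀ κ, (1 - C (Q ^ (κ + 1)) * X) * C (1 - s * Q ^ (κ + 2)) * ψ (κ + 1) =
    (1 + C (s * Q ^ κ) * X) * (1 + C (Q ^ (κ + 1)) * X) * ψ κ

/-- The generating function, in the variable counting the weight, of level at most `κ`. -/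
noncomputable def levelGf (Q s : ℚ⟦X⟧) (ψ : ℕ → ℚ⟦X⟧⟦X⟧) (κ : ℕ) : ℚ⟦X⟧⟦X⟧ :=
  C (1 - s * Q ^ (κ + 1)) * ψ κ

/-- The product of `ψ κ` with `(1 + w) / (1 - w)`. -/
noncomputable def cumul (ψ : ℕ → ℚ⟦X⟧⟦X⟧) (κ : ℕ) : ℚ⟦X⟧⟦X⟧ := ψ κ * (1 + X) * mk 1

/-- The generating function of the overpartitions with level at most the weight plus `m`. -/
noncomputable def rankLe (Q s : ℚ⟦X⟧) (ψ : ℕ → ℚ⟦X⟧⟦X⟧) (m : ℤ) : ℚ⟦X⟧ :=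
  ∑' κ : ℕ, zc (levelGf Q s ψ κ) (κ - m)

theorem one_sub_X_mul_cumul (ψ : ℕ → ℚ⟦X⟧⟦X⟧) (κ : ℕ) :
    (1 - X) * cumul ψ κ = (1 + X) * ψ κ := by
  have h := mk_one_mul_one_sub_eq_one ℚ⟦X⟧
  rw [cumul]
  linear_combination (1 + X) * ψ κ * h

theorem zc_cumul (ψ : ℕ → ℚ⟦X⟧⟦X⟧) (κ : ℕ) (k : ℤ) :
    zc (cumul ψ κ) k - zc (cumul ψ κ) (k - 1) = zc (ψ κ) k + zc (ψ κ) (k - 1) := by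
  have h := congrArg (fun f => zc f k) (one_sub_X_mul_cumul ψ κ)
  simpa only [sub_mul, add_mul, one_mul, zc_sub, zc_add, zc_X_mul] using h

theorem one_add_X_mul_ne_zero {R : Type*} [CommRing R] [Nontrivial R] {f g : R⟦X⟧}
    (h : f = 1 + X * g) : f ≠ 0 := by
  intro h0
  have := congrArg (coeff 0) (h.symm.trans h0)
  simp at this

theorem rescale_C {R : Type*} [CommSemiring R] (a b : R) : rescale a (C b) = C b := by
  ext n
  rw [coeff_rescale, coeff_C]
  split_ifs with h <;> simp [h]

theorem diag_cumul {Q : ℚ⟦X⟧} (hQ : X ∣ Q) (ψ : ℕ → ℚ⟦X⟧⟦X⟧) (m : ℤ) :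
    diag Q (cumul ψ) m - diag Q (cumul ψ) (m + 1) = diag Q ψ m + diag Q ψ (m + 1) := by
  simp only [diag]
  rw [← (decay_diag hQ _).summable.tsum_sub (decay_diag hQ _).summable,
    ← (decay_diag hQ _).summable.tsum_add (decay_diag hQ _).summable]
  refine tsum_congr fun κ => ?_
  have := zc_cumul ψ κ (κ - m)
  rw [← sub_sub]
  linear_combination Q ^ κ * this

/-! ### Linear relations between the truncated rank counts and diagonal sums. -/

namespace RankSystem

variable {Q s : ℚ⟦X⟧} {ψ : ℕ → ℚ⟦X⟧⟦X⟧}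

theorem one_sub_ne_zero (h : RankSystem Q s ψ) (κ : ℕ) : 1 - s * Q ^ (κ + 1) ≠ 0 := by
  obtain ⟨g, rfl⟩ := h.dvd
  exact one_add_X_mul_ne_zero (g := -(s * g * (X * g) ^ κ)) (by ring)

/-- Replacing w by Qw shifts every factor of the product for ψ by one, so the passage from level κ
to κ + 1 can be made at the bottom of the product instead of the top. -/
theorem one_sub_mul_levelGf_succ (h : RankSystem Q s ψ) (κ : ℕ) :
    (1 - C Q * X) * levelGf Q s ψ (κ + 1) =
      (1 + C s * X) * (1 + C Q * X) * rescale Q (ψ κ) := by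
  induction κ with
  | zero =>
    obtain ⟨a, ha⟩ := h.zero
    have := h.succ 0
    rw [ha] at this ⊢
    rw [rescale_C, levelGf]
    simpa [mul_assoc] using this
  | succ κ ih =>
    have h1 := h.succ (κ + 1)
    have h2 := congrArg (rescale Q) (h.succ κ)
    simp only [map_mul, map_sub, map_add, map_one, rescale_C, rescale_X, map_pow] at h2
    simp only [levelGf, map_mul, map_sub, map_one, map_pow] at h1 ih ⊢
    have e1 : (1 - C Q ^ (κ + 2) * X : ℚ⟦X⟧⟦X⟧) ≠ 0 :=
      one_add_X_mul_ne_zero (g := - C Q ^ (κ + 2)) (by ring)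
    have e2 : (1 - C s * C Q ^ (κ + 2) : ℚ⟦X⟧⟦X⟧) ≠ 0 := by
      rw [← map_pow, ← map_mul, ← map_one (C (R := ℚ⟦X⟧)), ← map_sub]
      exact (map_ne_zero_iff _ C_injective).2 (h.one_sub_ne_zero (κ + 1))
    apply mul_left_cancel₀ e1
    apply mul_left_cancel₀ e2
    linear_combination (1 - C s * C Q ^ (κ + 2)) * (1 - C Q * X) * h1 +
      (1 + C s * C Q ^ (κ + 1) * X) * (1 + C Q ^ (κ + 2) * X) * ih -
      (1 + C s * X) * (1 + C Q * X) * h2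

theorem levelGf_succ (h : RankSystem Q s ψ) (κ : ℕ) :
    levelGf Q s ψ (κ + 1) = (1 + C s * X) * rescale Q (cumul ψ κ) := by
  have h1 := congrArg (rescale Q) (one_sub_X_mul_cumul ψ κ)
  simp only [map_mul, map_sub, map_add, map_one, rescale_X] at h1
  have e1 : (1 - C Q * X : ℚ⟦X⟧⟦X⟧) ≠ 0 := one_add_X_mul_ne_zero (g := - C Q) (by ring)
  apply mul_left_cancel₀ e1
  linear_combination h.one_sub_mul_levelGf_succ κ - (1 + C s * X) * h1

theorem zc_levelGf_succ (h : RankSystem Q s ψ) (κ : ℕ) (k : ℤ) :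
    zc (levelGf Q s ψ (κ + 1)) k = Q ^ k.toNat * zc (cumul ψ κ) k +
      s * (Q ^ (k - 1).toNat * zc (cumul ψ κ) (k - 1)) := by
  rw [h.levelGf_succ, add_mul, one_mul, mul_assoc, zc_add, zc_C_mul, zc_X_mul, zc_rescale,
    zc_rescale]

theorem decay_succ (h : RankSystem Q s ψ) (m : ℤ) :
    Decay fun κ : ℕ => zc (levelGf Q s ψ (κ + 1)) (κ - m) := by
  refine Decay.of_dvd (fun κ : ℕ => (κ - m - 1).toNat)
    (fun d => (Set.finite_Iio (d + m + 1).toNat).subset fun κ hκ => ?_) fun κ => ?_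
  · simp only [Set.mem_ofPred_eq] at hκ
    simp only [Set.mem_Iio]
    omega
  · rw [h.zc_levelGf_succ]
    refine dvd_add (Dvd.dvd.mul_right ?_ _) (Dvd.dvd.mul_left (Dvd.dvd.mul_right ?_ _) _)
    · exact (pow_dvd_pow X (by omega)).trans (pow_dvd_pow_of_dvd h.dvd _)
    · exact pow_dvd_pow_of_dvd h.dvd _

theorem decay_levelGf (h : RankSystem Q s ψ) (m : ℤ) :
    Decay fun κ : ℕ => zc (levelGf Q s ψ κ) (κ - m) := fun d => by
  refine (((h.decay_succ (m - 1)) d).image Nat.succ).union (Set.finite_singleton 0) |>.subset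
    fun κ hκ => ?_
  cases κ with
  | zero => exact Or.inr rfl
  | succ κ =>
    refine Or.inl ⟨κ, ?_, rfl⟩
    have e : (κ : ℤ) - (m - 1) = (κ + 1 : ℕ) - m := by push_cast; ring
    simpa only [Set.mem_ofPred_eq, e] using hκ

theorem rankLe_succ (h : RankSystem Q s ψ) (m : ℤ) :
    rankLe Q s ψ (m + 1) = zc (levelGf Q s ψ 0) (-m - 1) +
      ∑' κ : ℕ, zc (levelGf Q s ψ (κ + 1)) (κ - m) := by
  rw [rankLe, (h.decay_levelGf _).summable.tsum_eq_zero_add]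
  congr 1
  · congr 1; push_cast; ring
  · refine tsum_congr fun κ => ?_
    congr 1; push_cast; ring

/-- By `levelGf_succ`, the coefficient of w^(κ-m) at level κ + 1 is read off from `cumul` at Qw.
This contributes Q^(κ-m), so up to the factor Q^(-m) the sum over κ is a diagonal sum. The integer m
is written as a - b to stay with nonnegative powers. -/
theorem pow_mul_rankLe (h : RankSystem Q s ψ) {m : ℤ} {a b : ℕ} (hab : (a : ℤ) = b + m) :
    Q ^ (a + 1) * (rankLe Q s ψ (m + 1) - zc (levelGf Q s ψ 0) (-m - 1)) =
      Q ^ b * (Q * diag Q (cumul ψ) m + s * diag Q (cumul ψ) (m + 1)) := by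
  rw [h.rankLe_succ, add_sub_cancel_left]
  simp only [diag]
  rw [← (decay_diag h.dvd _).summable.tsum_mul_left, ← (decay_diag h.dvd _).summable.tsum_mul_left,
    ← ((decay_diag h.dvd _).mul_left _).summable.tsum_add
      ((decay_diag h.dvd _).mul_left _).summable,
    ← (((decay_diag h.dvd _).mul_left _).add ((decay_diag h.dvd _).mul_left _)).summable.tsum_mul_left,
    ← (h.decay_succ m).summable.tsum_mul_left]
  refine tsum_congr fun κ => ?_
  rw [h.zc_levelGf_succ, ← sub_sub]
  have key : ∀ (j : ℤ) (c d : ℕ), (c : ℤ) + j = d →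
      Q ^ c * (Q ^ j.toNat * zc (cumul ψ κ) j) = Q ^ d * zc (cumul ψ κ) j := by
    intro j c d hj
    rcases lt_or_ge j 0 with h0 | h0
    · rw [zc_of_neg _ h0]; simp
    · rw [← mul_assoc, ← pow_add]; congr 2; omega
  have e1 := key (κ - m) (a + 1) (b + κ + 1) (by push_cast; omega)
  have e2 := key (κ - m - 1) (a + 1) (b + κ) (by push_cast; omega)
  rw [pow_add _ _ 1, pow_add] at e1
  rw [pow_add _ b] at e2
  linear_combination e1 + s * e2

theorem levelGf_sub (h : RankSystem Q s ψ) (κ : ℕ) :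
    levelGf Q s ψ (κ + 1) - levelGf Q s ψ κ =
      C (s * Q) * (C (Q ^ κ) * ψ κ) + C (s + Q) * (X * (C (Q ^ κ) * ψ κ)) +
      C (s * Q) * (X * (X * (C ((Q ^ 2) ^ κ) * ψ κ))) +
      (X * (C (Q ^ (κ + 1)) * ψ (κ + 1))) -
      C (s * Q) * (X * (C ((Q ^ 2) ^ (κ + 1)) * ψ (κ + 1))) := by
  have h1 := h.succ κ
  simp only [levelGf, map_mul, map_sub, map_add, map_one, map_pow] at h1 ⊢
  linear_combination h1

/-- A second relation, from comparing levels κ + 1 and κ through the recurrence at the top of the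
product. The sums weighted by (Q²)^κ cancel except for the term κ = 0. -/
theorem rankLe_sub (h : RankSystem Q s ψ) (m : ℤ) :
    rankLe Q s ψ m - rankLe Q s ψ (m - 1) =
      diag Q ψ (m + 1) + (s + Q) * diag Q ψ m + s * Q * diag Q ψ (m - 1) +
      zc (levelGf Q s ψ 0) (-m) - zc (levelGf Q s ψ 0) (-m - 1) := by
  have hQ2 : X ∣ Q ^ 2 := h.dvd.trans (dvd_pow_self Q two_ne_zero)
  have h0 := h.rankLe_succ (m - 1)
  have hd := h.decay_succ (m - 1)
  have key : ∑' κ : ℕ, zc (levelGf Q s ψ (κ + 1)) (κ - (m - 1)) - rankLe Q s ψ (m - 1) =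
      s * Q * diag Q ψ (m - 1) + (s + Q) * diag Q ψ m + s * Q * diag (Q ^ 2) ψ (m + 1) +
      ∑' κ : ℕ, Q ^ (κ + 1) * zc (ψ (κ + 1)) (κ + 1 - (m + 1)) -
      s * Q * ∑' κ : ℕ, (Q ^ 2) ^ (κ + 1) * zc (ψ (κ + 1)) (κ + 1 - (m + 1)) := by
    have d1 := (decay_diag h.dvd fun κ : ℕ => zc (ψ κ) (κ - (m - 1))).mul_left fun _ => s * Q
    have d2 := (decay_diag h.dvd fun κ : ℕ => zc (ψ κ) (κ - m)).mul_left fun _ => s + Q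
    have d3 := (decay_diag hQ2 fun κ : ℕ => zc (ψ κ) (κ - (m + 1))).mul_left fun _ => s * Q
    have d4 : Decay fun κ : ℕ => Q ^ (κ + 1) * zc (ψ (κ + 1)) (κ + 1 - (m + 1)) :=
      ((decay_pow h.dvd).comp (e := fun κ => κ + 1) (add_left_injective 1)).mul_right _
    have d5' : Decay fun κ : ℕ => (Q ^ 2) ^ (κ + 1) * zc (ψ (κ + 1)) (κ + 1 - (m + 1)) :=
      ((decay_pow hQ2).comp (e := fun κ => κ + 1) (add_left_injective 1)).mul_right _
    have d5 := d5'.mul_left fun _ => s * Q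
    rw [rankLe, ← hd.summable.tsum_sub (h.decay_levelGf _).summable]
    simp only [diag]
    rw [← (decay_diag h.dvd _).summable.tsum_mul_left, ← (decay_diag h.dvd _).summable.tsum_mul_left,
      ← (decay_diag hQ2 _).summable.tsum_mul_left, ← d5'.summable.tsum_mul_left,
      ← d1.summable.tsum_add d2.summable, ← (d1.add d2).summable.tsum_add d3.summable,
      ← ((d1.add d2).add d3).summable.tsum_add d4.summable,
      ← (((d1.add d2).add d3).add d4).summable.tsum_sub d5.summable]
    refine tsum_congr fun κ => ?_
    rw [← zc_sub, h.levelGf_sub]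
    simp only [zc_sub, zc_add, zc_C_mul, zc_X_mul]
    have e1 : (κ - (m - 1) - 1 : ℤ) = κ - m := by ring
    have e2 : (κ - m - 1 : ℤ) = κ - (m + 1) := by ring
    have e3 : (κ + 1 - (m + 1) : ℤ) = κ - m := by ring
    rw [e1, e2, e3]
  have k1 := diag_eq_zero_add h.dvd ψ (m + 1)
  have k2 := diag_eq_zero_add hQ2 ψ (m + 1)
  have k3 : zc (levelGf Q s ψ 0) (-m - 1) = (1 - s * Q) * zc (ψ 0) (-(m + 1)) := by
    rw [levelGf, zc_C_mul, neg_add']; simp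
  rw [sub_add_cancel, show -(m - 1) - 1 = -m by ring] at h0
  linear_combination h0 + key - k1 + s * Q * k2 + k3

theorem zc_levelGf_zero (h : RankSystem Q s ψ) {k : ℤ} (hk : k ≠ 0) :
    zc (levelGf Q s ψ 0) k = 0 := by
  obtain ⟨a, ha⟩ := h.zero
  rw [levelGf, ha, zc_C_mul, zc_C, if_neg hk, mul_zero]

/-- The closed form of `2P - Lo m - Lo (m - 1)`. -/
noncomputable def tailSum (Q s : ℚ⟦X⟧) (ψ : ℕ → ℚ⟦X⟧⟦X⟧) (m : ℤ) : ℚ⟦X⟧ :=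
  diag Q (cumul ψ) (m + 1) + (s + Q) * diag Q (cumul ψ) m + s * Q * diag Q (cumul ψ) (m - 1)

/-- `diag_cumul` turns two consecutive diagonal sums of ψ into a difference of diagonal sums of
`cumul`. Hence the bracketed expression does not depend on m, apart from jumps caused by level 0 at
m = 0 and m = -2. -/
theorem rankLe_add_tailSum (h : RankSystem Q s ψ) (m : ℤ) :
    (rankLe Q s ψ (m + 1) + rankLe Q s ψ m + tailSum Q s ψ (m + 1)) -
      (rankLe Q s ψ m + rankLe Q s ψ (m - 1) + tailSum Q s ψ m) =
      zc (levelGf Q s ψ 0) (-m) - zc (levelGf Q s ψ 0) (-m - 2) := by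
  have h1 := h.rankLe_sub m
  have h2 := h.rankLe_sub (m + 1)
  have b0 := diag_cumul h.dvd ψ (m - 1)
  have b1 := diag_cumul h.dvd ψ m
  have b2 := diag_cumul h.dvd ψ (m + 1)
  rw [add_sub_cancel_right, neg_add', sub_sub] at h2
  norm_num at h2
  rw [sub_add_cancel] at b0
  rw [tailSum, tailSum, add_sub_cancel_right]
  linear_combination h1 + h2 - b2 - (s + Q) * b1 - s * Q * b0

theorem tailSum_dvd (h : RankSystem Q s ψ) (m : ℕ) : X ^ m ∣ tailSum Q s ψ (m + 1) := by
  have h0 := pow_dvd_diag h.dvd (cumul ψ) m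
  have h1 := pow_dvd_diag h.dvd (cumul ψ) (m + 1)
  have h2 := pow_dvd_diag h.dvd (cumul ψ) (m + 2)
  rw [tailSum, add_sub_cancel_right]
  push_cast at h1 h2
  refine dvd_add (dvd_add ?_ ?_) (h0.mul_left _)
  · rw [add_assoc]; exact (pow_dvd_pow X (by omega)).trans h2
  · exact ((pow_dvd_pow X (by omega)).trans h1).mul_left _

theorem eq_of_forall_X_pow_dvd {f g : ℚ⟦X⟧} (h : ∀ d : ℕ, X ^ d ∣ f - g) : f = g := by
  ext n
  have := X_pow_dvd_iff.1 (h (n + 1)) n (Nat.lt_succ_self n)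
  rwa [map_sub, sub_eq_zero] at this

variable {P : ℚ⟦X⟧}

/-- The expression is constant for m ≥ 0, and its limit as m → ∞ is 2P because the tail tends to
zero. -/
theorem two_mul_eq (h : RankSystem Q s ψ)
    (hP : ∀ d : ℕ, ∃ M : ℕ, ∀ m : ℕ, M ≤ m → X ^ d ∣ P - rankLe Q s ψ m) (m : ℕ) :
    rankLe Q s ψ (m + 1) + rankLe Q s ψ m + tailSum Q s ψ (m + 1) = 2 * P := by
  have hc : ∀ j : ℕ, rankLe Q s ψ (m + j + 1) + rankLe Q s ψ (m + j) +
      tailSum Q s ψ (m + j + 1) =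
      rankLe Q s ψ (m + 1) + rankLe Q s ψ m + tailSum Q s ψ (m + 1) := by
    intro j
    induction j with
    | zero => simp
    | succ j ih =>
      have := h.rankLe_add_tailSum (m + j + 1)
      rw [h.zc_levelGf_zero (by omega), h.zc_levelGf_zero (by omega), add_sub_cancel_right,
        sub_zero, sub_eq_zero] at this
      rw [← ih, ← this]
      push_cast
      simp only [add_assoc]
  refine eq_of_forall_X_pow_dvd fun d => ?_
  obtain ⟨M, hM⟩ := hP d
  rw [← hc (M + d)]
  have h1 := hM (m + (M + d) + 1) (by omega)
  have h2 := hM (m + (M + d)) (by omega)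
  have h3 := (pow_dvd_pow X (by omega)).trans (h.tailSum_dvd (m + (M + d))) (a := X ^ d)
  push_cast at h1 h2 h3 ⊢
  obtain ⟨a, ha⟩ := h1
  obtain ⟨b, hb⟩ := h2
  obtain ⟨e, he⟩ := h3
  exact ⟨e - a - b, by linear_combination he - ha - hb⟩

theorem two_mul_eq_zero (h : RankSystem Q s ψ)
    (hP : ∀ d : ℕ, ∃ M : ℕ, ∀ m : ℕ, M ≤ m → X ^ d ∣ P - rankLe Q s ψ m) :
    rankLe Q s ψ 0 + rankLe Q s ψ (-1) + tailSum Q s ψ 0 + zc (levelGf Q s ψ 0) 0 = 2 * P := by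
  have h1 := h.two_mul_eq hP 0
  have h2 := h.rankLe_add_tailSum 0
  rw [h.zc_levelGf_zero (k := -0 - 2) (by omega)] at h2
  norm_num at h1 h2
  linear_combination h1 - h2

/-- The jumps at m = 0 and m = -2 are opposite, so beyond both the constant is 2P again. -/
theorem two_mul_eq_neg (h : RankSystem Q s ψ)
    (hP : ∀ d : ℕ, ∃ M : ℕ, ∀ m : ℕ, M ≤ m → X ^ d ∣ P - rankLe Q s ψ m) (m : ℕ) :
    rankLe Q s ψ (-m - 2) + rankLe Q s ψ (-m - 3) + tailSum Q s ψ (-m - 2) = 2 * P := by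
  induction m with
  | zero =>
    have h1 := h.two_mul_eq_zero hP
    have h2 := h.rankLe_add_tailSum (-1)
    have h3 := h.rankLe_add_tailSum (-2)
    rw [h.zc_levelGf_zero (by omega), h.zc_levelGf_zero (by omega)] at h2
    rw [h.zc_levelGf_zero (k := - -2) (by omega)] at h3
    norm_num at h1 h2 h3 ⊢
    linear_combination h1 - h2 - h3
  | succ m ih =>
    have h2 := h.rankLe_add_tailSum (-m - 3)
    rw [h.zc_levelGf_zero (by omega), h.zc_levelGf_zero (by omega)] at h2
    rw [show (-m - 3 + 1 : ℤ) = -m - 2 by ring, show (-m - 3 - 1 : ℤ) = -m - 4 by ring] at h2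
    rw [show (-(m + 1 : ℕ) - 2 : ℤ) = -m - 3 by push_cast; ring,
      show (-(m + 1 : ℕ) - 3 : ℤ) = -m - 4 by push_cast; ring]
    linear_combination ih - h2

end RankSystem

/-- Each use of the recurrence gains at least one power of q, so two solutions agree to every order.
-/
theorem eq_of_shift_recurrence {P : ℚ⟦X⟧} {e : ℕ → ℕ} {r : ℕ} {f g : ℕ → ℚ⟦X⟧}
    (hf : ∀ m, f m = X ^ (e m + 1) * (P - f (m + r)))
    (hg : ∀ m, g m = X ^ (e m + 1) * (P - g (m + r))) (m : ℕ) : f m = g m := by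
  refine RankSystem.eq_of_forall_X_pow_dvd fun d => ?_
  induction d generalizing m with
  | zero => simp
  | succ d ih =>
    obtain ⟨a, ha⟩ := ih (m + r)
    exact ⟨-(X ^ e m * a), by rw [hf, hg]; linear_combination -X ^ (e m + 1) * ha⟩

/-! ### Solution of the recurrences by partial theta series. -/

namespace RankSystem

variable {P : ℚ⟦X⟧} {ψ : ℕ → ℚ⟦X⟧⟦X⟧}

/-- By `two_mul_eq` the left side f(m) is a combination of two diagonal sums, and `pow_mul_rankLe`
converts each into a count with larger index. The result f(m) = q^(m+2) (2P - f(m + 2)) is the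
recurrence `pt_eq` for -2P pt(m + 1). -/
theorem rank_pos (h : RankSystem X 0 ψ)
    (hP : ∀ d : ℕ, ∃ M : ℕ, ∀ m : ℕ, M ≤ m → X ^ d ∣ P - rankLe X 0 ψ m) (m : ℕ) :
    2 * P - (rankLe X 0 ψ (m + 1) + rankLe X 0 ψ m) = -(2 * P * pt (m + 1)) := by
  refine eq_of_shift_recurrence (P := 2 * P) (e := fun m => m + 1) (r := 2)
    (f := fun m => 2 * P - (rankLe X 0 ψ (m + 1) + rankLe X 0 ψ m))
    (g := fun m => -(2 * P * pt (m + 1))) (fun m => ?_) (fun m => ?_) m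
  · have h1 := h.two_mul_eq hP m
    have h2 := h.pow_mul_rankLe (m := m + 1) (a := m + 1) (b := 0) (by push_cast; ring)
    have h3 := h.pow_mul_rankLe (m := m + 2) (a := m + 2) (b := 0) (by push_cast; ring)
    rw [h.zc_levelGf_zero (by omega)] at h2 h3
    rw [tailSum] at h1
    push_cast
    simp only [add_assoc] at h1 h2 h3 ⊢
    norm_num at h1 h2 h3 ⊢
    apply mul_left_cancel₀ (X_ne_zero (R := ℚ))
    linear_combination -X * h1 - h3 - X * h2
  · have := pt_eq (m + 1)
    rw [this, show m + 1 + 2 = m + 2 + 1 by ring]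
    ring

theorem rank_neg (h : RankSystem X 0 ψ)
    (hP : ∀ d : ℕ, ∃ M : ℕ, ∀ m : ℕ, M ≤ m → X ^ d ∣ P - rankLe X 0 ψ m) (m : ℕ) :
    rankLe X 0 ψ (-m - 1) + rankLe X 0 ψ (-m - 2) = -(2 * P * pt (m + 1)) := by
  refine eq_of_shift_recurrence (P := 2 * P) (e := fun m => m + 1) (r := 2)
    (f := fun m => rankLe X 0 ψ (-m - 1) + rankLe X 0 ψ (-m - 2))
    (g := fun m => -(2 * P * pt (m + 1))) (fun m => ?_) (fun m => ?_) m
  · have h1 := h.two_mul_eq_neg hP (m + 1)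
    have h2 := h.pow_mul_rankLe (m := -m - 2) (a := 0) (b := m + 2) (by push_cast; ring)
    have h3 := h.pow_mul_rankLe (m := -m - 3) (a := 0) (b := m + 3) (by push_cast; ring)
    rw [h.zc_levelGf_zero (by omega)] at h2 h3
    rw [tailSum] at h1
    apply mul_left_cancel₀ (X_ne_zero (R := ℚ))
    push_cast at h1 ⊢
    rw [show (-m - 2 + 1 : ℤ) = -m - 1 by ring] at h2
    rw [show (-m - 3 + 1 : ℤ) = -m - 2 by ring] at h3
    rw [show (-(m + 1 : ℤ) - 2 + 1 : ℤ) = -m - 2 by ring,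
      show (-(m + 1 : ℤ) - 2 : ℤ) = -m - 3 by ring,
      show (-(m + 1 : ℤ) - 3 : ℤ) = -m - 4 by ring] at h1
    rw [show (-(m + 2 : ℤ) - 1 : ℤ) = -m - 3 by ring,
      show (-(m + 2 : ℤ) - 2 : ℤ) = -m - 4 by ring]
    linear_combination h2 + h3 + X ^ (m + 3) * h1
  · have := pt_eq (m + 1)
    rw [this, show m + 1 + 2 = m + 2 + 1 by ring]
    ring

/-- Here the three diagonal sums in `tailSum` regroup into the two counts of index m + 1 and m + 2,
so the recurrence has shift 1: f(m) = q^(2m+3) (2P - f(m + 1)). -/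
theorem m2Rank_pos (h : RankSystem (X ^ 2) X ψ)
    (hP : ∀ d : ℕ, ∃ M : ℕ, ∀ m : ℕ, M ≤ m → X ^ d ∣ P - rankLe (X ^ 2) X ψ m) (m : ℕ) :
    2 * P - (rankLe (X ^ 2) X ψ (m + 1) + rankLe (X ^ 2) X ψ m) =
      -(2 * P * pt (2 * (m + 1))) := by
  refine eq_of_shift_recurrence (P := 2 * P) (e := fun m => 2 * (m + 1)) (r := 1)
    (f := fun m => 2 * P - (rankLe (X ^ 2) X ψ (m + 1) + rankLe (X ^ 2) X ψ m))
    (g := fun m => -(2 * P * pt (2 * (m + 1)))) (fun m => ?_) (fun m => ?_) m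
  · have h1 := h.two_mul_eq hP m
    have h2 := h.pow_mul_rankLe (m := m) (a := m) (b := 0) (by push_cast; ring)
    have h3 := h.pow_mul_rankLe (m := m + 1) (a := m + 1) (b := 0) (by push_cast; ring)
    rw [h.zc_levelGf_zero (by omega)] at h2 h3
    rw [tailSum] at h1
    push_cast
    simp only [add_assoc] at h1 h2 h3 ⊢
    norm_num at h1 h2 h3 ⊢
    apply mul_left_cancel₀ (X_ne_zero (R := ℚ))
    rw [← pow_mul] at h2 h3
    linear_combination -X * h1 - h3 - X ^ 2 * h2
  · have := pt_eq (2 * (m + 1))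
    rw [this, show 2 * (m + 1) + 2 = 2 * (m + 1 + 1) by ring]
    ring

theorem m2Rank_neg (h : RankSystem (X ^ 2) X ψ)
    (hP : ∀ d : ℕ, ∃ M : ℕ, ∀ m : ℕ, M ≤ m → X ^ d ∣ P - rankLe (X ^ 2) X ψ m) (m : ℕ) :
    rankLe (X ^ 2) X ψ (-m - 1) + rankLe (X ^ 2) X ψ (-m - 2) =
      -(2 * P * pt (2 * (m + 1))) := by
  refine eq_of_shift_recurrence (P := 2 * P) (e := fun m => 2 * (m + 1)) (r := 1)
    (f := fun m => rankLe (X ^ 2) X ψ (-m - 1) + rankLe (X ^ 2) X ψ (-m - 2))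
    (g := fun m => -(2 * P * pt (2 * (m + 1)))) (fun m => ?_) (fun m => ?_) m
  · have h1 := h.two_mul_eq_neg hP m
    have h2 := h.pow_mul_rankLe (m := -m - 2) (a := 0) (b := m + 2) (by push_cast; ring)
    have h3 := h.pow_mul_rankLe (m := -m - 3) (a := 0) (b := m + 3) (by push_cast; ring)
    rw [h.zc_levelGf_zero (by omega)] at h2 h3
    rw [tailSum] at h1
    apply mul_left_cancel₀ (pow_ne_zero 2 (X_ne_zero (R := ℚ)))
    push_cast at h1 ⊢
    rw [show (-m - 2 + 1 : ℤ) = -m - 1 by ring, ← pow_mul] at h2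
    rw [show (-m - 3 + 1 : ℤ) = -m - 2 by ring, ← pow_mul] at h3
    rw [show (-m - 2 + 1 : ℤ) = -m - 1 by ring,
      show (-m - 2 - 1 : ℤ) = -m - 3 by ring] at h1
    rw [show (-(m + 1 : ℤ) - 1 : ℤ) = -m - 2 by ring,
      show (-(m + 1 : ℤ) - 2 : ℤ) = -m - 3 by ring]
    linear_combination h2 + h3 + X ^ (2 * m + 5) * h1
  · have := pt_eq (2 * (m + 1))
    rw [this, show 2 * (m + 1) + 2 = 2 * (m + 1 + 1) by ring]
    ring

/-- By `rank_pos` and `rank_neg`, P - L(m) - L(-m-1) changes sign when m grows by one, where L is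
`rankLe`. It also tends to zero, so it vanishes at m = 0. Substituting into `two_mul_eq_zero`, whose
level 0 term is 1, gives P (1 + 2 pt 0) = 1. No infinite product for φ is involved. -/
theorem mul_phi (h : RankSystem X 0 ψ) (h0 : ψ 0 = 1)
    (hP : ∀ d : ℕ, ∃ M : ℕ, ∀ m : ℕ, M ≤ m → X ^ d ∣ P - rankLe X 0 ψ m)
    (hN : ∀ d : ℕ, ∃ M : ℕ, ∀ m : ℕ, M ≤ m → X ^ d ∣ rankLe X 0 ψ (-m - 1)) :
    P * phi = 1 := by
  have hs : ∀ m : ℕ, P - rankLe X 0 ψ 0 - rankLe X 0 ψ (-1) =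
      (-1) ^ m * (P - rankLe X 0 ψ m - rankLe X 0 ψ (-m - 1)) := by
    intro m
    induction m with
    | zero => simp
    | succ m ih =>
      have h1 := h.rank_pos hP m
      have h2 := h.rank_neg hP m
      rw [ih]
      rw [show (-(m + 1 : ℕ) - 1 : ℤ) = -m - 2 by push_cast; ring]
      push_cast
      linear_combination (-1) ^ m * h1 - (-1) ^ m * h2
  have hz : P - rankLe X 0 ψ 0 - rankLe X 0 ψ (-1) = 0 := by
    refine eq_of_forall_X_pow_dvd fun d => ?_
    obtain ⟨M, hM⟩ := hP d
    obtain ⟨M', hM'⟩ := hN d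
    rw [hs (M + M'), sub_zero]
    exact (dvd_sub (hM _ (by omega)) (hM' _ (by omega))).mul_left _
  have h1 := h.two_mul_eq_zero hP
  have h2 := h.pow_mul_rankLe (m := 0) (a := 0) (b := 0) (by norm_num)
  have h3 := h.pow_mul_rankLe (m := 1) (a := 1) (b := 0) (by norm_num)
  rw [h.zc_levelGf_zero (by omega)] at h2 h3
  have h4 := h.rank_pos hP 1
  have h5 : zc (levelGf X 0 ψ 0) 0 = 1 := by
    rw [levelGf, h0, mul_one, zc_C]; simp
  have h6 := pt_eq 0
  have h7 := phi_eq
  rw [tailSum, h5] at h1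
  norm_num at h1 h2 h3 h4 h6
  rw [h7]
  apply mul_left_cancel₀ (X_ne_zero (R := ℚ))
  linear_combination 2 * P * X * h6 - X ^ 2 * h4 - h3 - X ^ 2 * h2 - X * h1 - X * hz

end RankSystem

/-! ### Products of generating functions of overpartitions -/

/-- Exchange of the two variables of an iterated power series. -/
noncomputable def swapVars : ℚ⟦X⟧⟦X⟧ →+* ℚ⟦X⟧⟦X⟧ where
  toFun f := mk fun k => mk fun n => coeff k (coeff n f)
  map_one' := by
    ext k n
    simp only [coeff_mk, coeff_one]
    split_ifs with h1 h2 h2 <;> simp [h1, h2, coeff_one]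
  map_zero' := by ext k n; simp
  map_add' f g := by ext k n; simp
  map_mul' f g := by
    ext k n
    simp only [coeff_mk, coeff_mul, map_sum]
    exact Finset.sum_comm

theorem coeff_swapVars (f : ℚ⟦X⟧⟦X⟧) (k n : ℕ) :
    coeff n (coeff k (swapVars f)) = coeff k (coeff n f) := by
  simp [swapVars]

theorem swapVars_X : swapVars X = C X := by
  ext k n
  rw [coeff_swapVars, coeff_X, coeff_C]
  split_ifs with h1 h2 h2 <;> simp [h1, h2, coeff_X, coeff_one]

theorem swapVars_C_X : swapVars (C X) = X := by
  ext k n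
  rw [coeff_swapVars, coeff_X, coeff_C]
  split_ifs with h1 h2 h2 <;> simp [h1, h2, coeff_X, coeff_one]

section genFun

variable {R : Type*} [CommRing R] [TopologicalSpace R] [T2Space R] [IsTopologicalRing R]

/-- The factor of a single part size: a geometric series of ratio a x with weight b on every nonzero
multiplicity sums to (1 + (b - 1) a x)/(1 - a x). -/
theorem one_sub_mul_geom (a b : R) (i : ℕ) :
    (1 - C a * X ^ (i + 1)) * (1 + ∑' j : ℕ, (b * a ^ (j + 1)) • (X : R⟦X⟧) ^ ((i + 1) * (j + 1))) =
      1 + (C b - 1) * (C a * X ^ (i + 1)) := by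
  have h0 : constantCoeff (C a * X ^ (i + 1) : R⟦X⟧) = 0 := by simp
  have h1 : ∀ j : ℕ, (b * a ^ (j + 1)) • (X : R⟦X⟧) ^ ((i + 1) * (j + 1)) =
      C b * (C a * X ^ (i + 1)) * (C a * X ^ (i + 1)) ^ j := fun j => by
    rw [smul_eq_C_mul, map_mul, map_pow, mul_pow, ← pow_mul]; ring
  simp only [h1]
  rw [(WithPiTopology.summable_pow_of_constantCoeff_eq_zero h0).tsum_mul_left]
  linear_combination (C b * (C a * X ^ (i + 1))) *
    WithPiTopology.one_sub_mul_tsum_pow_of_constantCoeff_eq_zero h0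

theorem genFun_mul_prod (a b : ℕ → R) (N : ℕ) (hb : ∀ i, N ≤ i → b (i + 1) = 0) :
    Nat.Partition.genFun (fun i c => b i * a i ^ c) *
      ∏ i ∈ Finset.range N, (1 - C (a (i + 1)) * X ^ (i + 1)) =
      ∏ i ∈ Finset.range N, (1 + (C (b (i + 1)) - 1) * (C (a (i + 1)) * X ^ (i + 1))) := by
  have h := Nat.Partition.hasProd_genFun fun i c => b i * a i ^ c
  have h' := hasProd_prod_of_ne_finset_one (L := .unconditional _) (s := Finset.range N)
    (f := fun i ↦ (1 : R⟦X⟧) + ∑' j, (b (i + 1) * a (i + 1) ^ (j + 1)) • X ^ ((i + 1) * (j + 1)))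
    fun i hi => by simp [hb i (by simpa using hi)]
  rw [h.unique h', ← Finset.prod_mul_distrib]
  refine Finset.prod_congr rfl fun i _ => ?_
  rw [mul_comm, one_sub_mul_geom]

end genFun

namespace Overpartition

variable {n : ℕ}

theorem sum_prod_eq {R : Type*} [CommRing R] (n : ℕ) (g h : ℕ → ℕ → R) :
    ∑ l : Overpartition n, (∏ i ∈ l.overlined, g i (l.parts.count i)) *
      ∏ i ∈ l.parts.toFinset \ l.overlined, h i (l.parts.count i) =
      ∑ p : n.Partition, p.parts.toFinsupp.prod fun i c => g i c + h i c := by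
  refine (Fintype.sum_equiv (equivSigma n) _ (fun x => (∏ i ∈ x.2.1, g i (x.1.parts.count i)) *
      ∏ i ∈ x.1.parts.toFinset \ x.2.1, h i (x.1.parts.count i)) fun l => rfl).trans ?_
  rw [Fintype.sum_sigma]
  refine Finset.sum_congr rfl fun p _ => ?_
  rw [Finsupp.prod, Multiset.toFinsupp_support]
  simp only [Multiset.toFinsupp_apply]
  rw [Finset.prod_add]
  exact Finset.sum_coe_sort p.parts.toFinset.powerset (fun s => (∏ i ∈ s, g i (p.parts.count i)) *
      ∏ i ∈ p.parts.toFinset \ s, h i (p.parts.count i))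

theorem coeff_genFun_eq {R : Type*} [CommRing R] (n : ℕ) (g h : ℕ → ℕ → R) :
    coeff n (Nat.Partition.genFun fun i c => g i c + h i c) =
      ∑ l : Overpartition n, (∏ i ∈ l.overlined, g i (l.parts.count i)) *
      ∏ i ∈ l.parts.toFinset \ l.overlined, h i (l.parts.count i) := by
  rw [sum_prod_eq, Nat.Partition.coeff_genFun]

theorem prod_ite_pow {ι R : Type*} [CommRing R] (s : Finset ι) (p : ι → Prop) [DecidablePred p]
    (e : ι → ℕ) (w : R) : ∏ i ∈ s, (if p i then w ^ e i else 0) =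
      if ∀ i ∈ s, p i then w ^ ∑ i ∈ s, e i else 0 := by
  split_ifs with h
  · rw [← Finset.prod_pow_eq_pow_sum]
    exact Finset.prod_congr rfl fun i hi => if_pos (h i hi)
  · push Not at h
    obtain ⟨i, hi, hp⟩ := h
    exact Finset.prod_eq_zero hi (if_neg hp)

/-- The product over the parts of powers of a variable, restricted to parts with `po` for the
overlined sizes and `pn` for the other ones. -/
theorem coeff_coeff_genFun_ite (k n : ℕ) (po pn : ℕ → Prop) [DecidablePred po] [DecidablePred pn]
    (eo en : ℕ → ℕ → ℕ) :
    coeff k (coeff n (Nat.Partition.genFun fun i c =>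
      (if po i then (X : ℚ⟦X⟧) ^ eo i c else 0) + (if pn i then X ^ en i c else 0))) =
    ((Finset.univ.filter fun l : Overpartition n =>
      ((∀ i ∈ l.overlined, po i) ∧ ∀ i ∈ l.parts.toFinset \ l.overlined, pn i) ∧
      ∑ i ∈ l.overlined, eo i (l.parts.count i) +
        ∑ i ∈ l.parts.toFinset \ l.overlined, en i (l.parts.count i) = k).card : ℚ) := by
  rw [coeff_genFun_eq, map_sum, Finset.card_filter, Nat.cast_sum]
  refine Finset.sum_congr rfl fun l _ => ?_
  rw [prod_ite_pow l.overlined po fun i => eo i (l.parts.count i),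
    prod_ite_pow _ pn fun i => en i (l.parts.count i)]
  by_cases h1 : ∀ i ∈ l.overlined, po i
  · by_cases h2 : ∀ i ∈ l.parts.toFinset \ l.overlined, pn i
    · rw [if_pos h1, if_pos h2, ← pow_add, coeff_X_pow]
      simp only [eq_comm (a := k)]
      by_cases h3 : ∑ i ∈ l.overlined, eo i (l.parts.count i) +
        ∑ i ∈ l.parts.toFinset \ l.overlined, en i (l.parts.count i) = k
      · rw [if_pos h3, if_pos ⟨⟨h1, h2⟩, h3⟩, Nat.cast_one]
      · rw [if_neg h3, if_neg fun h => h3 h.2, Nat.cast_zero]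
    · rw [if_neg h2, mul_zero, map_zero, if_neg fun h => h2 h.1.2, Nat.cast_zero]
  · rw [if_neg h1, zero_mul, map_zero, if_neg fun h => h1 h.1.1, Nat.cast_zero]

end Overpartition

/-! ### Product formulas for the two rank generating functions. -/

/-- The generating function of overpartitions with parts at most `κ`, by number of parts. -/
noncomputable def rankGf (κ : ℕ) : ℚ⟦X⟧⟦X⟧ :=
  Nat.Partition.genFun fun i c => (if i ≤ κ then 2 else 0) * (X : ℚ⟦X⟧) ^ c

theorem rankGf_mul_prod (κ : ℕ) :
    rankGf κ * ∏ i ∈ Finset.range κ, (1 - C X * X ^ (i + 1)) =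
      ∏ i ∈ Finset.range κ, (1 + C X * X ^ (i + 1)) := by
  rw [rankGf, genFun_mul_prod (fun _ => X) (fun i => if i ≤ κ then 2 else 0) κ
    fun i hi => if_neg (by omega)]
  refine Finset.prod_congr rfl fun i hi => ?_
  rw [if_pos (Nat.succ_le_of_lt (Finset.mem_range.1 hi)), map_ofNat]
  ring

theorem one_sub_C_mul_X_pow_ne_zero {R : Type*} [CommRing R] [Nontrivial R] (a : R) (i : ℕ) :
    (1 - C a * X ^ (i + 1) : R⟦X⟧) ≠ 0 :=
  one_add_X_mul_ne_zero (g := -(C a * X ^ i)) (by ring)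

theorem rankGf_succ (κ : ℕ) : (1 - C X * X ^ (κ + 1)) * rankGf (κ + 1) =
    (1 + C X * X ^ (κ + 1)) * rankGf κ := by
  have h1 := rankGf_mul_prod κ
  have h2 := rankGf_mul_prod (κ + 1)
  rw [Finset.prod_range_succ, Finset.prod_range_succ, ← h1] at h2
  have h3 : ∏ i ∈ Finset.range κ, (1 - C X * X ^ (i + 1) : ℚ⟦X⟧⟦X⟧) ≠ 0 :=
    Finset.prod_ne_zero_iff.2 fun i _ => one_sub_C_mul_X_pow_ne_zero _ _
  apply mul_left_cancel₀ h3
  linear_combination h2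

theorem rankGf_zero : rankGf 0 = 1 := by simpa using rankGf_mul_prod 0

/-- `genFun` is a series in the size with coefficients in the weight variable. `RankSystem` is
stated with these roles exchanged, hence `swapVars`. -/
theorem rankSystem_rank : RankSystem X 0 fun κ => swapVars (rankGf κ) where
  dvd := dvd_rfl
  zero := ⟨1, by simp [rankGf_zero]⟩
  succ κ := by
    have h := congrArg swapVars (rankGf_succ κ)
    simp only [map_mul, map_sub, map_add, map_one, map_pow, swapVars_X, swapVars_C_X] at h
    simp only [zero_mul, sub_zero, map_one, map_zero, map_pow]
    linear_combination h

/-- The generating function of overpartitions of `M2`-level at most `κ`, by `M2`-weight. -/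
noncomputable def m2Gf (κ : ℕ) : ℚ⟦X⟧⟦X⟧ :=
  Nat.Partition.genFun fun i c => (if i ≤ 2 * κ then (if Even i then 2 else 1 + X) else
    if i = 2 * κ + 1 then 1 else 0) * (if Even i then X else 1 : ℚ⟦X⟧) ^ c

theorem prod_range_two_mul {M : Type*} [CommMonoid M] (f : ℕ → M) (N : ℕ) :
    ∏ i ∈ Finset.range (2 * N), f i = ∏ i ∈ Finset.range N, f (2 * i) * f (2 * i + 1) := by
  induction N with
  | zero => simp
  | succ N ih => rw [mul_add, mul_one, Finset.prod_range_succ, Finset.prod_range_succ, ih,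
      Finset.prod_range_succ, mul_assoc]

/-- In the weight variable x, an even size i ≤ 2κ gives (1 + x q^i)/(1 - x q^i). An odd size below
2κ gives (1 + x q^i)/(1 - q^i), since non-overlined odd parts have no weight. The size 2κ + 1 may
occur only non-overlined and gives 1/(1 - q^(2κ+1)). -/
theorem m2Gf_mul_prod (κ : ℕ) :
    m2Gf κ * (∏ i ∈ Finset.range κ, (1 - X ^ (2 * i + 1)) * (1 - C X * X ^ (2 * i + 2))) *
      (1 - X ^ (2 * κ + 1)) =
      ∏ i ∈ Finset.range κ, (1 + C X * X ^ (2 * i + 1)) * (1 + C X * X ^ (2 * i + 2)) := by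
  obtain ⟨a, ha⟩ : ∃ a : ℕ → ℚ⟦X⟧, ∀ i, a i = if Even i then (X : ℚ⟦X⟧) else 1 := ⟨_, fun _ => rfl⟩
  obtain ⟨b, hb⟩ : ∃ b : ℕ → ℚ⟦X⟧, ∀ i, b i = if i ≤ 2 * κ then (if Even i then 2 else 1 + X) else
      if i = 2 * κ + 1 then 1 else 0 := ⟨_, fun _ => rfl⟩
  have h := genFun_mul_prod a b (2 * κ + 1)
    fun i hi => by rw [hb, if_neg (by omega), if_neg (by omega)]
  have hm : m2Gf κ = Nat.Partition.genFun fun i c => b i * a i ^ c := by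
    simp only [m2Gf, ha, hb]
  have ho : ∀ i, ¬ Even (2 * i + 1) := fun i => by simp
  have he : ∀ i, Even (2 * i + 1 + 1) := fun i => by simp [parity_simps]
  have a1 : ∀ i, a (2 * i + 1) = 1 := fun i => by rw [ha, if_neg (ho i)]
  have a2 : ∀ i, a (2 * i + 1 + 1) = X := fun i => by rw [ha, if_pos (he i)]
  have b0 : b (2 * κ + 1) = 1 := by rw [hb, if_neg (by omega), if_pos rfl]
  have b1 : ∀ i ∈ Finset.range κ, b (2 * i + 1) = 1 + X := fun i hi => by
    have := Finset.mem_range.1 hi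
    rw [hb, if_pos (by omega), if_neg (ho i)]
  have b2 : ∀ i ∈ Finset.range κ, b (2 * i + 1 + 1) = 2 := fun i hi => by
    have := Finset.mem_range.1 hi
    rw [hb, if_pos (by omega), if_pos (he i)]
  rw [← hm, Finset.prod_range_succ, Finset.prod_range_succ, prod_range_two_mul, prod_range_two_mul, ← mul_assoc, a1, b0,
    map_one, one_mul, sub_self, zero_mul, add_zero, mul_one] at h
  have hN : ∏ i ∈ Finset.range κ, (1 + (C (b (2 * i + 1)) - 1) * (C (a (2 * i + 1)) *
      X ^ (2 * i + 1))) * (1 + (C (b (2 * i + 1 + 1)) - 1) * (C (a (2 * i + 1 + 1)) *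
      X ^ (2 * i + 1 + 1))) =
      ∏ i ∈ Finset.range κ, (1 + C X * X ^ (2 * i + 1)) * (1 + C X * X ^ (2 * i + 2)) := by
    refine Finset.prod_congr rfl fun i hi => ?_
    rw [a1, a2, b1 i hi, b2 i hi, map_add, map_one, map_ofNat]
    ring
  have hD : ∏ i ∈ Finset.range κ, (1 - C (a (2 * i + 1)) * X ^ (2 * i + 1)) *
      (1 - C (a (2 * i + 1 + 1)) * X ^ (2 * i + 1 + 1)) =
      ∏ i ∈ Finset.range κ, (1 - X ^ (2 * i + 1)) * (1 - C X * X ^ (2 * i + 2)) := by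
    refine Finset.prod_congr rfl fun i _ => ?_
    rw [a1, a2, map_one, one_mul]
  rw [hN, hD] at h
  exact h

theorem m2Gf_succ (κ : ℕ) :
    (1 - C X * X ^ (2 * κ + 2)) * (1 - X ^ (2 * κ + 3)) * m2Gf (κ + 1) =
      (1 + C X * X ^ (2 * κ + 1)) * (1 + C X * X ^ (2 * κ + 2)) * m2Gf κ := by
  have h1 := m2Gf_mul_prod κ
  have h2 := m2Gf_mul_prod (κ + 1)
  rw [Finset.prod_range_succ, Finset.prod_range_succ, ← h1] at h2
  have h4 : ∀ i : ℕ, (1 - X ^ (i + 1) : ℚ⟦X⟧⟦X⟧) ≠ 0 := fun i => by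
    simpa using one_sub_C_mul_X_pow_ne_zero (1 : ℚ⟦X⟧) i
  have h3 : ∏ i ∈ Finset.range κ, ((1 - X ^ (2 * i + 1)) * (1 - C X * X ^ (2 * i + 2)) : ℚ⟦X⟧⟦X⟧)
      ≠ 0 :=
    Finset.prod_ne_zero_iff.2 fun i _ => mul_ne_zero (h4 _) (one_sub_C_mul_X_pow_ne_zero _ _)
  apply mul_left_cancel₀ h3
  apply mul_left_cancel₀ (h4 (2 * κ))
  rw [show 2 * (κ + 1) + 1 = 2 * κ + 3 by ring] at h2
  linear_combination h2

theorem m2Gf_zero : m2Gf 0 * (1 - X) = 1 := by simpa using m2Gf_mul_prod 0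

/-- `m2Gf` with the variables exchanged and normalized to satisfy `RankSystem`. -/
noncomputable def m2System (κ : ℕ) : ℚ⟦X⟧⟦X⟧ :=
  C ((1 - X * (X ^ 2) ^ (κ + 1))⁻¹) * swapVars (m2Gf κ)

theorem levelGf_m2System (κ : ℕ) : levelGf (X ^ 2) X m2System κ = swapVars (m2Gf κ) := by
  rw [levelGf, m2System, ← mul_assoc, ← map_mul, PowerSeries.mul_inv_cancel _ (by simp), map_one,
    one_mul]

theorem rankSystem_m2 : RankSystem (X ^ 2) X m2System where
  dvd := dvd_pow_self X two_ne_zero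
  zero := by
    refine ⟨(1 - X * (X ^ 2) ^ 1)⁻¹ * (1 - X)⁻¹, ?_⟩
    have h := congrArg swapVars m2Gf_zero
    simp only [map_mul, map_sub, map_one, swapVars_X] at h
    have h2 : (1 - X : ℚ⟦X⟧) * (1 - X)⁻¹ = 1 := PowerSeries.mul_inv_cancel _ (by simp)
    have h3 := congrArg (C (R := ℚ⟦X⟧)) h2
    simp only [map_mul, map_sub, map_one] at h3
    rw [m2System, map_mul]
    linear_combination C ((1 - X * (X ^ 2) ^ 1)⁻¹ : ℚ⟦X⟧) * (C ((1 - X)⁻¹ : ℚ⟦X⟧) * h -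
      swapVars (m2Gf 0) * h3)
  succ κ := by
    have h1 := levelGf_m2System (κ + 1)
    rw [levelGf] at h1
    rw [mul_assoc, h1]
    have h := congrArg swapVars (m2Gf_succ κ)
    simp only [map_mul, map_sub, map_add, map_one, map_pow, swapVars_X, swapVars_C_X] at h
    have h2 := levelGf_m2System κ
    rw [levelGf] at h2
    have h3 : (1 - X * (X ^ 2) ^ (κ + 1) : ℚ⟦X⟧) ≠ 0 :=
      one_add_X_mul_ne_zero (g := -(X ^ 2) ^ (κ + 1)) (by ring)
    have h4 : (C (1 - X * (X ^ 2) ^ (κ + 1)) : ℚ⟦X⟧⟦X⟧) ≠ 0 := (map_ne_zero_iff _ C_injective).2 h3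
    apply mul_left_cancel₀ h4
    simp only [map_mul, map_sub, map_one, map_pow] at h2 ⊢
    simp only [← pow_mul] at h2 ⊢
    linear_combination h - (1 + C X * C X ^ (2 * κ) * X) * (1 + C X ^ (2 * (κ + 1)) * X) * h2

/-! ### Rank and M2-rank as level minus weight. -/

namespace Overpartition

variable {n : ℕ}

theorem le_largestPart (l : Overpartition n) {i : ℕ} (h : i ∈ l.parts) : i ≤ l.largestPart :=
  Multiset.le_sup h

theorem largestPart_le_iff (l : Overpartition n) {κ : ℕ} :
    l.largestPart ≤ κ ↔ ∀ i ∈ l.parts, i ≤ κ := Multiset.sup_le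

theorem overlined_subset_parts (l : Overpartition n) {i : ℕ} (h : i ∈ l.overlined) :
    i ∈ l.parts := Multiset.mem_toFinset.1 (l.overlined_subset h)

theorem largestPart_le (l : Overpartition n) : l.largestPart ≤ n :=
  l.largestPart_le_iff.2 fun _ hi => (Multiset.single_le_sum (fun _ _ => Nat.zero_le _) _ hi).trans
    l.toPartition.parts_sum.le

theorem card_parts_le (l : Overpartition n) : l.parts.card ≤ n := by
  have := Multiset.card_nsmul_le_sum (s := l.parts) (a := 1) fun i hi => l.toPartition.parts_pos hi
  rw [smul_eq_mul, mul_one] at this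
  exact this.trans l.toPartition.parts_sum.le

theorem sum_overlined_add_sum {M : Type*} [AddCommMonoid M] (l : Overpartition n) (f : ℕ → M) :
    ∑ i ∈ l.overlined, f i + ∑ i ∈ l.parts.toFinset \ l.overlined, f i =
      ∑ i ∈ l.parts.toFinset, f i := by
  rw [add_comm]
  exact Finset.sum_sdiff l.overlined_subset

theorem coeff_coeff_rankGf (κ k n : ℕ) : coeff k (coeff n (rankGf κ)) =
    ((Finset.univ.filter fun l : Overpartition n =>
      l.largestPart ≤ κ ∧ l.parts.card = k).card : ℚ) := by
  have h := coeff_coeff_genFun_ite k n (fun i => i ≤ κ) (fun i => i ≤ κ) (fun _ c => c)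
    fun _ c => c
  have e : rankGf κ = Nat.Partition.genFun fun i c =>
      (if i ≤ κ then (X : ℚ⟦X⟧) ^ c else 0) + (if i ≤ κ then X ^ c else 0) := by
    rw [rankGf]
    congr 1
    ext1 i; ext1 c
    split_ifs <;> ring
  rw [e, h]
  congr 2
  ext l
  simp only [Finset.mem_filter, Finset.mem_univ, true_and]
  rw [sum_overlined_add_sum, Multiset.toFinset_sum_count_eq, largestPart_le_iff]
  refine and_congr ⟨fun hl i hi => ?_, fun hl => ⟨fun i hi => hl i (l.overlined_subset_parts hi),
    fun i hi => hl i (Multiset.mem_toFinset.1 (Finset.mem_sdiff.1 hi).1)⟩⟩ Iff.rfl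
  by_cases ho : i ∈ l.overlined
  · exact hl.1 i ho
  · exact hl.2 i (Finset.mem_sdiff.2 ⟨Multiset.mem_toFinset.2 hi, ho⟩)

/-- The level used for the `M2`-rank. -/
def m2Level (l : Overpartition n) : ℕ :=
  (l.largestPart + 1) / 2 - if Odd l.largestPart ∧ l.largestPart ∉ l.overlined then 1 else 0

/-- The weight used for the `M2`-rank. -/
def m2Weight (l : Overpartition n) : ℕ :=
  ∑ i ∈ l.overlined, (if Even i then l.parts.count i else 1) +
    ∑ i ∈ l.parts.toFinset \ l.overlined, if Even i then l.parts.count i else 0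

theorem m2Weight_add (l : Overpartition n) :
    l.m2Weight + (l.nonOverlined.filter fun x => Odd x).card = l.parts.card := by
  have h1 : (l.nonOverlined.filter fun x => Odd x).card =
      ∑ i ∈ l.parts.toFinset, if Odd i then l.nonOverlined.count i else 0 := by
    rw [← Multiset.sum_count_eq_card (s := l.parts.toFinset)]
    · exact Finset.sum_congr rfl fun i _ => Multiset.count_filter
    · intro i hi
      exact Multiset.mem_toFinset.2
        (Multiset.mem_of_le (Multiset.sub_le_self _ _) (Multiset.mem_filter.1 hi).1)
  have hc : ∀ i, l.nonOverlined.count i = l.parts.count i - if i ∈ l.overlined then 1 else 0 := by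
    intro i
    rw [nonOverlined, Multiset.count_sub]
    congr 1
    rw [Multiset.count_eq_of_nodup l.overlined.nodup]
    rfl
  rw [h1, ← Multiset.toFinset_sum_count_eq l.parts, ← sum_overlined_add_sum,
    ← sum_overlined_add_sum, m2Weight, add_add_add_comm, ← Finset.sum_add_distrib,
    ← Finset.sum_add_distrib]
  congr 1
  · refine Finset.sum_congr rfl fun i hi => ?_
    rw [hc, if_pos hi]
    have := Multiset.one_le_count_iff_mem.2 (l.overlined_subset_parts hi)
    by_cases he : Even i
    · rw [if_pos he, if_neg (Nat.not_odd_iff_even.2 he), add_zero]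
    · rw [if_neg he, if_pos (Nat.not_even_iff_odd.1 he)]; omega
  · refine Finset.sum_congr rfl fun i hi => ?_
    rw [hc, if_neg (Finset.mem_sdiff.1 hi).2]
    by_cases he : Even i
    · rw [if_pos he, if_neg (Nat.not_odd_iff_even.2 he), add_zero]
    · rw [if_neg he, if_pos (Nat.not_even_iff_odd.1 he), zero_add, Nat.sub_zero]

/-- The level absorbs ⌈ℓ/2⌉ - χ and the weight absorbs n(λ) - n(λ_o). The truncated subtraction in
`m2Level` loses nothing, because χ = 1 forces ℓ odd, hence positive. -/
theorem m2Rank_eq (l : Overpartition n) : l.m2Rank = (l.m2Level : ℤ) - l.m2Weight := by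
  have h := l.m2Weight_add
  have h2 : (l.m2Level : ℤ) = ((l.largestPart + 1) / 2 : ℕ) - l.chi := by
    rw [m2Level, chi]
    split_ifs with hx
    · obtain ⟨j, hj⟩ := hx.1
      rw [Nat.cast_sub (by omega)]; simp
    · simp
  rw [m2Rank, h2, ← h]
  push_cast
  ring

/-- The correction χ lowers the level exactly when the largest part is odd and non-overlined, so
size 2κ + 1 is admitted at level κ only without an overline. These are the bounds built into `m2Gf`.
-/
theorem m2Level_le_iff (l : Overpartition n) (κ : ℕ) : l.m2Level ≤ κ ↔
    (∀ i ∈ l.overlined, i ≤ 2 * κ) ∧ ∀ i ∈ l.parts.toFinset \ l.overlined, i ≤ 2 * κ + 1 := by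
  constructor
  · intro h
    rw [m2Level] at h
    refine ⟨fun i hi => ?_, fun i hi => ?_⟩
    · have h1 := l.le_largestPart (l.overlined_subset_parts hi)
      split_ifs at h with hx
      · have h2 : i ≠ l.largestPart := fun e => hx.2 (e ▸ hi)
        obtain ⟨j, hj⟩ := hx.1
        omega
      · omega
    · have h1 := l.le_largestPart (Multiset.mem_toFinset.1 (Finset.mem_sdiff.1 hi).1)
      split_ifs at h with hx
      · obtain ⟨j, hj⟩ := hx.1
        omega
      · omega
  · rintro ⟨h1, h2⟩
    have h3 : l.largestPart ≤ 2 * κ + 1 := l.largestPart_le_iff.2 fun i hi => by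
      by_cases ho : i ∈ l.overlined
      · exact (h1 i ho).trans (Nat.le_succ _)
      · exact h2 i (Finset.mem_sdiff.2 ⟨Multiset.mem_toFinset.2 hi, ho⟩)
    rw [m2Level]
    split_ifs with hx
    · omega
    · rcases Nat.lt_or_ge (2 * κ) l.largestPart with h4 | h4
      · refine absurd ⟨⟨κ, by omega⟩, fun ho => ?_⟩ hx
        have := h1 _ ho
        omega
      · omega

theorem m2Level_le (l : Overpartition n) : l.m2Level ≤ n := by
  have := l.largestPart_le
  rw [m2Level]
  omega

theorem m2Weight_le (l : Overpartition n) : l.m2Weight ≤ n := by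
  have := l.m2Weight_add
  have := l.card_parts_le
  omega

theorem coeff_coeff_m2Gf (κ k n : ℕ) : coeff k (coeff n (m2Gf κ)) =
    ((Finset.univ.filter fun l : Overpartition n =>
      l.m2Level ≤ κ ∧ l.m2Weight = k).card : ℚ) := by
  have h := coeff_coeff_genFun_ite k n (fun i => i ≤ 2 * κ) (fun i => i ≤ 2 * κ + 1)
    (fun i c => if Even i then c else 1) fun i c => if Even i then c else 0
  have e : m2Gf κ = Nat.Partition.genFun fun i c =>
      (if i ≤ 2 * κ then (X : ℚ⟦X⟧) ^ (if Even i then c else 1) else 0) +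
      (if i ≤ 2 * κ + 1 then X ^ (if Even i then c else 0) else 0) := by
    rw [m2Gf]
    congr 1
    ext1 i; ext1 c
    by_cases h1 : i ≤ 2 * κ
    · rw [if_pos h1, if_pos h1, if_pos (show i ≤ 2 * κ + 1 by omega)]
      split_ifs <;> ring
    · rw [if_neg h1, if_neg h1]
      by_cases h2 : i = 2 * κ + 1
      · have h3 : ¬ Even i := by rw [h2]; simp
        rw [if_pos h2, if_pos (show i ≤ 2 * κ + 1 by omega), if_neg h3, if_neg h3]
        simp
      · rw [if_neg h2, if_neg (show ¬ i ≤ 2 * κ + 1 by omega)]; simp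
  rw [e, h]
  congr 2
  ext l
  simp only [Finset.mem_filter, Finset.mem_univ, true_and, m2Level_le_iff]
  rfl

end Overpartition

/-! ### Rank moments -/

/-- The generating function of overpartitions. -/
noncomputable def overGf : ℚ⟦X⟧ := mk fun n => (Fintype.card (Overpartition n) : ℚ)

/-- The generating function of the power sums of a statistic on overpartitions. -/
noncomputable def statMoment (r : ∀ n, Overpartition n → ℤ) (e : ℕ) : ℚ⟦X⟧ :=
  mk fun n => ∑ l : Overpartition n, (r n l : ℚ) ^ e

/-- An overpartition can contribute only at κ = weight + m, and it does so precisely when its level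
is at most this κ. -/
theorem RankSystem.coeff_rankLe {Q s : ℚ⟦X⟧} {ψ : ℕ → ℚ⟦X⟧⟦X⟧} (h : RankSystem Q s ψ)
    (lev wt : ∀ n, Overpartition n → ℕ)
    (hc : ∀ κ k n, coeff n (coeff k (levelGf Q s ψ κ)) =
      ((Finset.univ.filter fun l : Overpartition n => lev n l ≤ κ ∧ wt n l = k).card : ℚ))
    (m : ℤ) (n : ℕ) : coeff n (rankLe Q s ψ m) =
      ∑ l : Overpartition n, if (lev n l : ℤ) - wt n l ≤ m then (1 : ℚ) else 0 := by
  have h1 : ∀ κ : ℕ, coeff n (zc (levelGf Q s ψ κ) (κ - m)) =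
      ∑ l : Overpartition n, if lev n l ≤ κ ∧ (wt n l : ℤ) = κ - m then (1 : ℚ) else 0 := by
    intro κ
    rcases lt_or_ge ((κ : ℤ) - m) 0 with h0 | h0
    · rw [zc_of_neg _ h0, map_zero, eq_comm]
      exact Finset.sum_eq_zero fun l _ => if_neg fun hl => by omega
    · obtain ⟨j, hj⟩ := Int.eq_ofNat_of_zero_le h0
      rw [hj, zc_natCast, hc, Finset.card_filter, Nat.cast_sum]
      refine Finset.sum_congr rfl fun l _ => ?_
      simp
  rw [rankLe, (h.decay_levelGf m).coeff_tsum]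
  simp only [h1]
  rw [finsum_sum_comm]
  · refine Finset.sum_congr rfl fun l _ => ?_
    rw [finsum_eq_single _ ((wt n l : ℤ) + m).toNat fun κ hκ => if_neg fun hl => hκ (by omega)]
    refine if_congr ?_ rfl rfl
    omega
  · intro l _
    refine (Set.finite_singleton ((wt n l : ℤ) + m).toNat).subset fun κ hκ => ?_
    by_contra h'
    exact hκ (if_neg fun hl => h' (by simp only [Set.mem_singleton_iff]; omega))

/-- The family of truncated counts of a statistic bounded by the size. -/
structure StatCounts (r : ∀ n, Overpartition n → ℤ) (L : ℤ → ℚ⟦X⟧) : Prop where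
  coeff_eq : ∀ m n, coeff n (L m) = ∑ l : Overpartition n, if r n l ≤ m then (1 : ℚ) else 0
  le : ∀ n (l : Overpartition n), r n l ≤ n
  neg_le : ∀ n (l : Overpartition n), -(n : ℤ) ≤ r n l

/-! ### Power moments from tail counts. -/

namespace StatCounts

variable {r : ∀ n, Overpartition n → ℤ} {L : ℤ → ℚ⟦X⟧}

theorem dvd_sub (h : StatCounts r L) (d : ℕ) :
    ∃ M : ℕ, ∀ m : ℕ, M ≤ m → X ^ d ∣ overGf - L m := by
  refine ⟨d, fun m hm => X_pow_dvd_iff.2 fun n hn => ?_⟩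
  rw [map_sub, h.coeff_eq, overGf, coeff_mk, sub_eq_zero, Finset.sum_congr rfl fun l _ =>
    if_pos (show r n l ≤ m by have := h.le n l; omega)]
  simp

theorem dvd_neg (h : StatCounts r L) (d : ℕ) :
    ∃ M : ℕ, ∀ m : ℕ, M ≤ m → X ^ d ∣ L (-m - 1) := by
  refine ⟨d, fun m hm => X_pow_dvd_iff.2 fun n hn => ?_⟩
  rw [h.coeff_eq]
  exact Finset.sum_eq_zero fun l _ => if_neg (by have := h.neg_le n l; omega)

/-- Summation by parts. For given k, the two bounded counts combine into the numbers of
overpartitions with |r| > k + 1 and with |r| > k. The weights `w` are chosen so that accumulating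
these indicators over k produces |r|^e. -/
theorem statMoment_eq (h : StatCounts r L) {s : ℕ} (hs : s ≠ 0)
    (hpos : ∀ m : ℕ, 2 * overGf - (L (m + 1) + L m) = -(2 * overGf * pt (s * (m + 1))))
    (hneg : ∀ m : ℕ, L (-m - 1) + L (-m - 2) = -(2 * overGf * pt (s * (m + 1))))
    (e : ℕ) (w : ℕ → ℚ) (hw : ∀ N a : ℕ, a ≤ N → ∑ k ∈ Finset.range N, w k *
      ((if k + 1 < a then 1 else 0) + if k < a then 1 else 0) = (a : ℚ) ^ e)
    (he : Even e) :
    statMoment r e = -(4 * overGf * ∑' k : ℕ, C (w k) * pt (s * (k + 1))) := by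
  have hd : Decay fun k : ℕ => C (w k) * pt (s * (k + 1)) := (decay_pt_mul hs).mul_left _
  rw [neg_mul_eq_neg_mul, ← hd.summable.tsum_mul_left]
  have h1 : ∀ k : ℕ, -(4 * overGf) * (C (w k) * pt (s * (k + 1))) =
      C (w k) * (2 * overGf - (L (k + 1) + L k) + (L (-k - 1) + L (-k - 2))) := fun k => by
    rw [hpos, hneg]; ring
  have hd' : Decay fun k : ℕ => C (w k) * (2 * overGf - (L (k + 1) + L k) +
      (L (-k - 1) + L (-k - 2))) := by
    simpa only [h1] using hd.mul_left fun _ => -(4 * overGf)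
  simp only [h1]
  ext n
  rw [hd'.coeff_tsum, statMoment, coeff_mk]
  have h2 : ∀ k : ℕ, coeff n (C (w k) * (2 * overGf - (L (k + 1) + L k) +
      (L (-k - 1) + L (-k - 2)))) = ∑ l : Overpartition n, w k *
      ((if k + 1 < (r n l).natAbs then 1 else 0) + if k < (r n l).natAbs then 1 else 0) := by
    intro k
    have h3 : coeff n (2 * overGf) = ∑ l : Overpartition n, (2 : ℚ) := by
      rw [← map_ofNat C, coeff_C_mul, overGf, coeff_mk]; simp [mul_comm]
    rw [coeff_C_mul, map_add, map_sub, map_add, map_add, h3, h.coeff_eq, h.coeff_eq, h.coeff_eq,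
      h.coeff_eq, ← Finset.sum_add_distrib, ← Finset.sum_add_distrib, ← Finset.sum_sub_distrib,
      ← Finset.sum_add_distrib, Finset.mul_sum]
    refine Finset.sum_congr rfl fun l _ => ?_
    congr 1
    split_ifs <;> first | (exfalso; omega) | norm_num
  simp only [h2]
  rw [finsum_eq_sum_of_support_subset (s := Finset.range n), Finset.sum_comm]
  · refine Finset.sum_congr rfl fun l _ => ?_
    have h4 := h.le n l
    have h5 := h.neg_le n l
    rw [hw n _ (by omega), ← he.pow_abs (r n l : ℚ), ← Int.cast_abs, Int.abs_eq_natAbs,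
      Int.cast_natCast]
  · intro k hk
    by_contra h'
    refine hk (Finset.sum_eq_zero fun l _ => ?_)
    have h4 := h.le n l
    have h5 := h.neg_le n l
    have h6 : n ≤ k := by simpa using h'
    rw [if_neg (by omega), if_neg (by omega)]
    simp

theorem sum_range_sq (N a : ℕ) (h : a ≤ N) : ∑ k ∈ Finset.range N, ((k + 1 : ℕ) : ℚ) *
      ((if k + 1 < a then 1 else 0) + if k < a then 1 else 0) = (a : ℚ) ^ 2 := by
  -- The value for N < a, where all indicators in range are 1, is needed to carry the induction: it
  -- is twice the sum of the first N weights, minus the boundary effect that appears at N = a.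
  have key : ∀ N : ℕ, ∑ k ∈ Finset.range N, ((k + 1 : ℕ) : ℚ) *
      ((if k + 1 < a then 1 else 0) + if k < a then 1 else 0) =
      if a ≤ N then (a : ℚ) ^ 2 else N ^ 2 + N := by
    intro N
    induction N with
    | zero =>
      rcases Nat.eq_zero_or_pos a with rfl | ha
      · simp
      · rw [if_neg (by omega)]; simp
    | succ N ih =>
      rw [Finset.sum_range_succ, ih]
      rcases lt_trichotomy a (N + 1) with h1 | h1 | h1
      · rw [if_pos (by omega), if_neg (by omega), if_neg (by omega), if_pos (by omega)]; simp
      · rw [if_neg (by omega), if_neg (by omega), if_pos (by omega), if_pos (by omega), h1]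
        push_cast; ring
      · rw [if_neg (by omega), if_pos (by omega), if_pos (by omega), if_neg (by omega)]
        push_cast; ring
  rw [key, if_pos h]

/-- With T(a) the sum of 2j³ - j over 1 ≤ j ≤ a, one has T(a) + T(a - 1) = a⁴, which determines the
weight. -/
theorem sum_range_fourth (N a : ℕ) (h : a ≤ N) : ∑ k ∈ Finset.range N,
      (2 * ((k + 1 : ℕ) : ℚ) ^ 3 - ((k + 1 : ℕ) : ℚ)) *
      ((if k + 1 < a then 1 else 0) + if k < a then 1 else 0) = (a : ℚ) ^ 4 := by
  have key : ∀ N : ℕ, ∑ k ∈ Finset.range N, (2 * ((k + 1 : ℕ) : ℚ) ^ 3 - ((k + 1 : ℕ) : ℚ)) *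
      ((if k + 1 < a then 1 else 0) + if k < a then 1 else 0) =
      if a ≤ N then (a : ℚ) ^ 4 else N ^ 4 + 2 * N ^ 3 - N := by
    intro N
    induction N with
    | zero =>
      rcases Nat.eq_zero_or_pos a with rfl | ha
      · simp
      · rw [if_neg (by omega)]; simp
    | succ N ih =>
      rw [Finset.sum_range_succ, ih]
      rcases lt_trichotomy a (N + 1) with h1 | h1 | h1
      · rw [if_pos (by omega), if_neg (by omega), if_neg (by omega), if_pos (by omega)]; simp
      · rw [if_neg (by omega), if_neg (by omega), if_pos (by omega), if_pos (by omega), h1]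
        push_cast; ring
      · rw [if_neg (by omega), if_pos (by omega), if_pos (by omega), if_neg (by omega)]
        push_cast; ring
  rw [key, if_pos h]

theorem statMoment_two (h : StatCounts r L) {s : ℕ} (hs : s ≠ 0)
    (hpos : ∀ m : ℕ, 2 * overGf - (L (m + 1) + L m) = -(2 * overGf * pt (s * (m + 1))))
    (hneg : ∀ m : ℕ, L (-m - 1) + L (-m - 2) = -(2 * overGf * pt (s * (m + 1)))) :
    statMoment r 2 = -(4 * overGf * ptMoment s 1) := by
  rw [h.statMoment_eq hs hpos hneg 2 _ sum_range_sq even_two, ptMoment]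
  simp

theorem statMoment_four (h : StatCounts r L) {s : ℕ} (hs : s ≠ 0)
    (hpos : ∀ m : ℕ, 2 * overGf - (L (m + 1) + L m) = -(2 * overGf * pt (s * (m + 1))))
    (hneg : ∀ m : ℕ, L (-m - 1) + L (-m - 2) = -(2 * overGf * pt (s * (m + 1)))) :
    statMoment r 4 = -(4 * overGf * (2 * ptMoment s 3 - ptMoment s 1)) := by
  have d1 := (decay_pt_mul hs).mul_left fun k => ((k + 1 : ℕ) : ℚ⟦X⟧) ^ 1
  have d3 := (decay_pt_mul hs).mul_left fun k => ((k + 1 : ℕ) : ℚ⟦X⟧) ^ 3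
  have e : 2 * ptMoment s 3 - ptMoment s 1 = ∑' k : ℕ,
      C (2 * ((k + 1 : ℕ) : ℚ) ^ 3 - ((k + 1 : ℕ) : ℚ)) * pt (s * (k + 1)) := by
    rw [ptMoment, ptMoment, ← d3.summable.tsum_mul_left,
      ← (d3.mul_left fun _ => 2).summable.tsum_sub d1.summable]
    refine tsum_congr fun k => ?_
    simp only [map_sub, map_mul, map_pow, map_natCast, map_ofNat]
    ring
  rw [h.statMoment_eq hs hpos hneg 4 _ sum_range_fourth (by decide), e]

end StatCounts

theorem statCounts_rank :
    StatCounts (fun _ l => l.rank) (rankLe X 0 fun κ => swapVars (rankGf κ)) where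
  coeff_eq m n := rankSystem_rank.coeff_rankLe (fun _ l => l.largestPart) (fun _ l => l.parts.card)
    (fun κ k n => by
      rw [levelGf, zero_mul, sub_zero, map_one, one_mul, coeff_swapVars,
        Overpartition.coeff_coeff_rankGf]) m n
  le n l := by have := l.largestPart_le; rw [Overpartition.rank]; omega
  neg_le n l := by have := l.card_parts_le; rw [Overpartition.rank]; omega

theorem statCounts_m2Rank :
    StatCounts (fun _ l => l.m2Rank) (rankLe (X ^ 2) X m2System) where
  coeff_eq m n := by
    simp only [Overpartition.m2Rank_eq]
    exact rankSystem_m2.coeff_rankLe (fun _ l => l.m2Level) (fun _ l => l.m2Weight)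
      (fun κ k n => by rw [levelGf_m2System, coeff_swapVars, Overpartition.coeff_coeff_m2Gf]) m n
  le n l := by have := l.m2Level_le; rw [Overpartition.m2Rank_eq]; omega
  neg_le n l := by have := l.m2Weight_le; rw [Overpartition.m2Rank_eq]; omega

theorem overGf_mul_phi : overGf * phi = 1 :=
  rankSystem_rank.mul_phi (by rw [rankGf_zero, map_one]) statCounts_rank.dvd_sub
    statCounts_rank.dvd_neg

theorem statMoment_rank_two :
    statMoment (fun _ l => l.rank) 2 = -(4 * overGf * ptMoment 1 1) :=
  statCounts_rank.statMoment_two one_ne_zero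
    (by simpa only [one_mul] using rankSystem_rank.rank_pos statCounts_rank.dvd_sub)
    (by simpa only [one_mul] using rankSystem_rank.rank_neg statCounts_rank.dvd_sub)

theorem statMoment_rank_four :
    statMoment (fun _ l => l.rank) 4 = -(4 * overGf * (2 * ptMoment 1 3 - ptMoment 1 1)) :=
  statCounts_rank.statMoment_four one_ne_zero
    (by simpa only [one_mul] using rankSystem_rank.rank_pos statCounts_rank.dvd_sub)
    (by simpa only [one_mul] using rankSystem_rank.rank_neg statCounts_rank.dvd_sub)

theorem statMoment_m2Rank_two :
    statMoment (fun _ l => l.m2Rank) 2 = -(4 * overGf * ptMoment 2 1) :=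
  statCounts_m2Rank.statMoment_two two_ne_zero
    (rankSystem_m2.m2Rank_pos statCounts_m2Rank.dvd_sub)
    (rankSystem_m2.m2Rank_neg statCounts_m2Rank.dvd_sub)

theorem statMoment_m2Rank_four :
    statMoment (fun _ l => l.m2Rank) 4 = -(4 * overGf * (2 * ptMoment 2 3 - ptMoment 2 1)) :=
  statCounts_m2Rank.statMoment_four two_ne_zero
    (rankSystem_m2.m2Rank_pos statCounts_m2Rank.dvd_sub)
    (rankSystem_m2.m2Rank_neg statCounts_m2Rank.dvd_sub)

/-! ### Crank moments: the algebraic part -/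

/-- The reciprocal of `(1 - q) ⋯ (1 - q^k)`. -/
noncomputable def invPoch (k : ℕ) : ℚ⟦X⟧ := ∏ i ∈ Finset.range k, (1 - X ^ (i + 1))⁻¹

theorem invPoch_zero : invPoch 0 = 1 := by simp [invPoch]

theorem one_sub_mul_invPoch_succ (k : ℕ) : (1 - X ^ (k + 1)) * invPoch (k + 1) = invPoch k := by
  rw [invPoch, Finset.prod_range_succ, ← invPoch]
  have := PowerSeries.mul_inv_cancel (1 - X ^ (k + 1) : ℚ⟦X⟧) (by simp)
  linear_combination invPoch k * this

/-- Durfee-type sums. -/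
noncomputable def durfee (r m : ℕ) : ℚ⟦X⟧ :=
  ∑' j : ℕ, X ^ (j * (j + m + r)) * (invPoch j * invPoch (j + m))

theorem decay_durfee (r m : ℕ) (f : ℕ → ℚ⟦X⟧) : Decay fun j : ℕ => X ^ (j * (j + m + r)) * f j :=
  Decay.mul_right (Decay.of_dvd (fun j => j) (fun d => Set.finite_Iio d) fun j =>
    pow_dvd_pow X (by
      rcases Nat.eq_zero_or_pos j with rfl | h
      · exact Nat.zero_le _
      · exact Nat.le_mul_of_pos_right j (by omega))) f

/-- The difference of the two terms contains 1 - q^j, which cancels the last factor of 1/(q)_j; then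
j is shifted by one. -/
theorem durfee_sub (r m : ℕ) :
    durfee r m - durfee (r + 1) m = X ^ (m + r + 1) * durfee (r + 1) (m + 1) := by
  rw [durfee, durfee, durfee, ← (decay_durfee r m _).summable.tsum_sub
    (decay_durfee (r + 1) m _).summable, ← (decay_durfee _ _ _).summable.tsum_mul_left,
    ((decay_durfee r m _).sub (decay_durfee (r + 1) m _)).summable.tsum_eq_zero_add]
  simp only [zero_mul, pow_zero, sub_self, zero_add]
  refine tsum_congr fun j => ?_
  have h := one_sub_mul_invPoch_succ j
  rw [show j + 1 + m = j + (m + 1) by ring, ← h]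
  ring

theorem durfee_succ (r m : ℕ) :
    durfee (r + 1) m = durfee r (m + 1) - X ^ (m + 1) * durfee (r + 1) (m + 1) := by
  rw [durfee, durfee, durfee, ← (decay_durfee _ _ _).summable.tsum_mul_left,
    ← (decay_durfee r (m + 1) _).summable.tsum_sub
    ((decay_durfee (r + 1) (m + 1) _).mul_left _).summable]
  refine tsum_congr fun j => ?_
  have h := one_sub_mul_invPoch_succ (j + m)
  rw [← h, show j + (m + 1) = j + m + 1 by ring]
  ring

/-- Durfee rectangles of different excess count the same partitions. Algebraically, `durfee_sub` and
`durfee_succ` add up to the independence of m; the common value never has to be evaluated. -/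
theorem durfee_zero (m : ℕ) : durfee 0 m = durfee 0 0 := by
  induction m with
  | zero => rfl
  | succ m ih => rw [← ih]; linear_combination -durfee_sub 0 m - durfee_succ 0 m

theorem one_sub_mul_durfee_two (m : ℕ) :
    (1 - X) * durfee 2 m = durfee 1 m - X * durfee 1 (m + 1) := by
  linear_combination -durfee_sub 1 m - X * durfee_succ 1 m

/-- The generating function of the partitions with crank at least `m`. -/
noncomputable def crankTail (m : ℤ) : ℚ⟦X⟧ :=
  if 0 ≤ m then X ^ m.toNat * durfee 1 m.toNat
  else durfee 0 0 - X ^ (1 - m).toNat * durfee 1 (1 - m).toNat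

theorem crankTail_natCast (m : ℕ) : crankTail m = X ^ m * durfee 1 m := by simp [crankTail]

theorem crankTail_eq (m : ℕ) : crankTail m = X ^ m * (durfee 0 0 - crankTail (m + 1)) := by
  rw [← Nat.cast_add_one, crankTail_natCast, crankTail_natCast]
  have h := durfee_sub 0 m
  rw [durfee_zero] at h
  linear_combination -X ^ m * h

/-- The symmetry of the crank in tail form: crank at least -m is complementary to crank at least m +
1 after reflection. -/
theorem crankTail_neg (m : ℕ) : crankTail (-m) = durfee 0 0 - crankTail (m + 1) := by
  cases m with
  | zero => simpa using crankTail_eq 0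
  | succ m =>
    rw [crankTail, if_neg (by omega), ← Nat.cast_add_one, crankTail_natCast,
      show (1 - (-(m + 1 : ℕ)) : ℤ).toNat = m + 1 + 1 by omega]

/-- The modified number of partitions with given crank. -/
noncomputable def crankGf (m : ℤ) : ℚ⟦X⟧ := (1 - X) * (X ^ m.natAbs * durfee 2 m.natAbs)

theorem crankGf_neg (m : ℤ) : crankGf (-m) = crankGf m := by simp [crankGf]

theorem decay_crankGf : Decay crankGf :=
  decay_of_natAbs fun _ => (dvd_mul_right _ _).mul_left _

theorem crankGf_natCast (m : ℕ) : crankGf m = crankTail m - crankTail (m + 1) := by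
  rw [← Nat.cast_add_one, crankTail_natCast, crankTail_natCast, crankGf, Int.natAbs_natCast]
  linear_combination X ^ m * one_sub_mul_durfee_two m

theorem crankGf_eq (m : ℤ) : crankGf m = crankTail m - crankTail (m + 1) := by
  rcases lt_or_ge m 0 with h | h
  · obtain ⟨k, rfl⟩ : ∃ k : ℕ, m = -(k + 1 : ℕ) := ⟨(-m - 1).toNat, by omega⟩
    have h1 := crankTail_neg (k + 1)
    have h2 := crankTail_neg k
    rw [crankGf_neg, crankGf_natCast, h1, show (-(k + 1 : ℕ) + 1 : ℤ) = -k by push_cast; ring, h2]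
    push_cast
    ring
  · obtain ⟨k, rfl⟩ := Int.eq_ofNat_of_zero_le h
    exact crankGf_natCast k

/-- Combines T(j) = q^j (D - T(j + 1)), where T is `crankTail` and D is `durfee 0 0`, with the
quasi-periodicity of `ct`. The powers q^a and q^b encode q^(m-1). -/
theorem pow_mul_ct_mul_crankTail {m : ℤ} {a b : ℕ} (h : (a : ℤ) = b + m - 1) (j : ℤ) :
    X ^ b * (ct (m - j) * crankTail j) =
      -(X ^ a * (durfee 0 0 * ct (m - 1 - j) - ct (m - (j + 1)) * crankTail (j + 1))) := by
  rw [show m - (j + 1) = m - 1 - j by ring]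
  rcases lt_or_ge j 0 with hj | hj
  · obtain ⟨k, rfl⟩ : ∃ k : ℕ, j = -(k + 1 : ℕ) := ⟨(-j - 1).toNat, by omega⟩
    have h1 := crankTail_neg (k + 1)
    have h2 := crankTail_neg k
    have h3 := crankTail_eq (k + 1)
    have h4 := xpow_mul_ct (n := (a + (k + 1) : ℕ)) (k := b) (m := m - 1 - -(k + 1 : ℕ)) (by omega)
      (by omega) (by push_cast; omega)
    rw [xpow_natCast, xpow_natCast, show m - 1 - -(k + 1 : ℕ) + 1 = m - -(k + 1 : ℕ) by ring] at h4
    rw [show (-(k + 1 : ℕ) + 1 : ℤ) = -k by push_cast; ring, h2, h1]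
    push_cast at h3 h4 ⊢
    rw [h3]
    linear_combination (durfee 0 0 - crankTail (k + 1 + 1)) * h4
  · obtain ⟨k, rfl⟩ := Int.eq_ofNat_of_zero_le hj
    have h3 := crankTail_eq k
    have h4 := xpow_mul_ct (n := a) (k := (b + k : ℕ)) (m := m - 1 - k) (by omega)
      (by omega) (by push_cast; omega)
    rw [xpow_natCast, xpow_natCast, show m - 1 - k + 1 = m - k by ring] at h4
    rw [h3]
    linear_combination (durfee 0 0 - crankTail (k + 1)) * h4

theorem decay_ct_mul (m : ℤ) (f : ℤ → ℚ⟦X⟧) : Decay fun j => ct (m - j) * f j :=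
  summable_conv decay_ct m

theorem tsum_ct_sub (m : ℤ) : ∑' j, ct (m - j) = 0 :=
  ((Equiv.subLeft m).tsum_eq ct).trans tsum_ct

theorem conv_ct_succ (m : ℤ) (f : ℤ → ℚ⟦X⟧) :
    ∑' j, ct (m - (j + 1)) * f (j + 1) = conv ct f m :=
  (Equiv.addRight (1 : ℤ)).tsum_eq fun j => ct (m - j) * f j

theorem decay_ct_mul_succ (m : ℤ) (f : ℤ → ℚ⟦X⟧) :
    Decay fun j => ct (m - (j + 1)) * f (j + 1) :=
  (decay_ct_mul m f).comp (e := fun j => j + 1) (add_left_injective 1)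

/-- Summing the termwise relation, with ∑ ct = 0, shows that the convolution at m equals q^(m-1)
times itself. It therefore vanishes unless m = 1. -/
theorem conv_ct_crankTail {m : ℤ} (hm : m ≠ 1) : conv ct crankTail m = 0 := by
  obtain ⟨a, b, hab⟩ : ∃ a b : ℕ, (a : ℤ) = b + m - 1 :=
    ⟨(m - 1).toNat, (1 - m).toNat, by omega⟩
  have h1 : X ^ b * conv ct crankTail m = X ^ a * conv ct crankTail m := by
    have d1 : Decay fun j => durfee 0 0 * ct (m - 1 - j) :=
      (decay_ct.comp (e := fun j => m - 1 - j) fun _ _ h => by simpa using h).mul_left _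
    have d2 := decay_ct_mul_succ m crankTail
    calc X ^ b * conv ct crankTail m = ∑' j, X ^ b * (ct (m - j) * crankTail j) :=
          ((decay_ct_mul m crankTail).summable.tsum_mul_left _).symm
      _ = ∑' j, -(X ^ a * (durfee 0 0 * ct (m - 1 - j) - ct (m - (j + 1)) * crankTail (j + 1))) :=
          tsum_congr fun j => pow_mul_ct_mul_crankTail hab j
      _ = -(X ^ a * (durfee 0 0 * ∑' j, ct (m - 1 - j) - conv ct crankTail m)) := by
          rw [tsum_neg, (d1.sub d2).summable.tsum_mul_left, d1.summable.tsum_sub d2.summable,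
            conv_ct_succ, (decay_ct.comp (e := fun j => m - 1 - j)
            fun _ _ h => by simpa using h).summable.tsum_mul_left]
      _ = _ := by rw [tsum_ct_sub]; ring
  by_contra h0
  have h2 := mul_right_cancel₀ h0 h1
  have h3 := congrArg (coeff a) h2
  rw [coeff_X_pow, coeff_X_pow, if_pos rfl, if_neg (by omega)] at h3
  exact zero_ne_one h3

/-- This is the product formula for the crank generating function in disguise: times the theta
series, it is a constant multiple of 1 - z. -/
theorem conv_ct_crankGf (m : ℤ) : conv ct crankGf m =
    (if m = 1 then conv ct crankTail 1 else 0) - if m = 0 then conv ct crankTail 1 else 0 := by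
  have h : conv ct crankGf m = conv ct crankTail m - conv ct crankTail (m + 1) := by
    rw [← conv_ct_succ (m + 1), conv, conv, ← (decay_ct_mul m _).summable.tsum_sub
      (decay_ct_mul_succ (m + 1) _).summable]
    refine tsum_congr fun j => ?_
    rw [crankGf_eq, show m + 1 - (j + 1) = m - j by ring]
    ring
  rw [h]
  by_cases h1 : m = 1
  · rw [if_pos h1, if_neg (by omega), conv_ct_crankTail (m := m + 1) (by omega), h1]
  · rw [if_neg h1, conv_ct_crankTail h1]
    by_cases h0 : m = 0
    · rw [if_pos h0, h0, zero_add]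
    · rw [if_neg h0, conv_ct_crankTail (by omega)]

/-- The crank moments of partitions. -/
noncomputable def crankGfMoment (r : ℕ) : ℚ⟦X⟧ := moment (fun n => n ^ r) crankGf

theorem crankGfMoment_odd {r : ℕ} (hr : Odd r) : crankGfMoment r = 0 :=
  moment_eq_zero_of_odd 0 fun n => by
    rw [zero_sub, crankGf_neg, hr.neg_pow]; push_cast; ring

theorem moment_two_mul_crankGf (r : ℕ) :
    moment (fun n => (2 * n) ^ r) crankGf = 2 ^ r * crankGfMoment r := by
  rw [moment_congr fun n => mul_pow 2 n r, moment_weight_const_mul decay_crankGf, crankGfMoment]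
  push_cast; rfl

/-- The support {0, 1} has 2n - 1 = ∓1, so all odd moments coincide. Comparing them eliminates the
unknown constant. -/
theorem moment_conv_ct_crankGf {r : ℕ} (hr : Odd r) :
    moment (fun n => (2 * n - 1) ^ r) (conv ct crankGf) = 2 * conv ct crankTail 1 := by
  rw [moment, tsum_eq_sum (s := {0, 1}) fun n hn => ?_, Finset.sum_pair zero_ne_one,
    conv_ct_crankGf, conv_ct_crankGf]
  · simp [hr.neg_one_pow]; ring
  · simp only [Finset.mem_insert, Finset.mem_singleton, not_or] at hn
    rw [conv_ct_crankGf, if_neg hn.1, if_neg hn.2, sub_zero, mul_zero]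

theorem sum_ctMoment_mul {r : ℕ} (hr : Odd r) :
    ∑ i ∈ Finset.range (r + 1), (r.choose i : ℚ⟦X⟧) *
      (ctMoment i * (2 ^ (r - i) * crankGfMoment (r - i))) = 2 * conv ct crankTail 1 := by
  rw [← moment_conv_ct_crankGf hr, moment_conv decay_ct decay_crankGf r (u := fun n => 2 * n - 1)
    (v := fun n => 2 * n) fun m j => by ring]
  simp only [moment_two_mul_crankGf, ctMoment]

/-- Equate the first and third moments of `conv_ct_crankGf` and insert `ctMoment_three`. -/
theorem crankGfMoment_two : crankGfMoment 2 = 2 * lambert 1 * crankGfMoment 0 := by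
  have h1 := sum_ctMoment_mul odd_one
  have h3 := sum_ctMoment_mul (r := 3) (by decide)
  simp only [Finset.sum_range_succ, Finset.sum_range_zero, Nat.choose, Nat.reduceSub,
    Nat.reduceAdd, crankGfMoment_odd odd_one, crankGfMoment_odd (r := 3) (by decide), mul_zero]
    at h1 h3
  push_cast at h1 h3
  refine mul_left_cancel₀ ctMoment_one_ne_zero (mul_left_cancel₀ (a := (12 : ℚ⟦X⟧)) (by norm_num) ?_)
  linear_combination h3 - h1 - crankGfMoment 0 * ctMoment_three

theorem crankGfMoment_four :
    crankGfMoment 4 = (2 * lambert 3 + 12 * lambert 1 ^ 2) * crankGfMoment 0 := by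
  have h1 := sum_ctMoment_mul odd_one
  have h5 := sum_ctMoment_mul (r := 5) (by decide)
  have h2 := crankGfMoment_two
  simp only [Finset.sum_range_succ, Finset.sum_range_zero, Nat.choose, Nat.reduceSub,
    Nat.reduceAdd, crankGfMoment_odd odd_one, crankGfMoment_odd (r := 3) (by decide),
    crankGfMoment_odd (r := 5) (by decide), mul_zero] at h1 h5
  push_cast at h1 h5
  refine mul_left_cancel₀ ctMoment_one_ne_zero (mul_left_cancel₀ (a := (80 : ℚ⟦X⟧)) (by norm_num) ?_)
  linear_combination h5 - h1 - crankGfMoment 0 * ctMoment_five - 40 * ctMoment 3 * h2 -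
    (40 * lambert 1) * crankGfMoment 0 * ctMoment_three

/-! ### Sums over multisets of parts -/

theorem Decay.fiber {ι κ : Type*} [DecidableEq κ] {f : ι → ℚ⟦X⟧} (hf : Decay f) (t : ι → κ) :
    Decay (Function.uncurry fun i k => if t i = k then f i else 0) := fun d =>
  ((hf d).image fun i => (i, t i)).subset fun x hx => by
    by_cases h : t x.1 = x.2
    · refine ⟨x.1, fun h' => hx ?_, Prod.ext rfl h⟩
      change X ^ d ∣ if t x.1 = x.2 then f x.1 else 0
      rwa [if_pos h]
    · refine absurd ?_ hx
      change X ^ d ∣ if t x.1 = x.2 then f x.1 else 0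
      rw [if_neg h]
      exact dvd_zero _

theorem Decay.tsum_fiber {ι κ : Type*} [DecidableEq κ] {f : ι → ℚ⟦X⟧} (hf : Decay f) (t : ι → κ) :
    ∑' i, f i = ∑' k, ∑' i, if t i = k then f i else 0 := by
  rw [← (hf.fiber t).tsum_comm]
  refine tsum_congr fun i => ?_
  rw [tsum_eq_single (t i) fun k hk => if_neg hk.symm, if_pos rfl]

theorem Decay.ite {ι : Type*} {f : ι → ℚ⟦X⟧} (hf : Decay f) (p : ι → Prop) [DecidablePred p] :
    Decay fun i => if p i then f i else 0 :=
  hf.mono fun i => by split_ifs <;> simp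

/-- The part 0 is allowed here, so the sum alone does not bound the multiset. With the cardinality
bounded too, both the entries and their multiplicities are bounded. -/
theorem finite_card_le_sum_lt (k d : ℕ) :
    {μ : Multiset ℕ | μ.card ≤ k ∧ μ.sum < d}.Finite := by
  refine (Set.finite_Iic (k • Multiset.range d)).subset fun μ hμ => ?_
  rw [Set.mem_Iic, Multiset.le_iff_count]
  intro a
  rw [Multiset.count_nsmul]
  by_cases ha : a ∈ μ
  · have h1 : a ≤ μ.sum := Multiset.single_le_sum (fun _ _ => Nat.zero_le _) _ ha
    rw [Multiset.count_eq_one_of_mem (Multiset.nodup_range d)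
      (Multiset.mem_range.2 (h1.trans_lt hμ.2)), mul_one]
    exact (Multiset.count_le_card _ _).trans hμ.1
  · rw [Multiset.count_eq_zero_of_notMem ha]
    exact Nat.zero_le _

/-- The multisets of parts satisfying `p`. -/
abbrev Parts (p : ℕ → Prop) := {μ : Multiset ℕ // ∀ x ∈ μ, p x}

theorem decay_parts {p : ℕ → Prop} (hp : ¬ p 0) : Decay fun μ : Parts p => (X : ℚ⟦X⟧) ^ μ.1.sum := by
  refine Decay.of_dvd (fun μ => μ.1.sum) (fun d => ?_) fun μ => dvd_rfl
  refine ((finite_card_le_sum_lt d d).preimage (f := fun μ : Parts p => μ.1)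
    Subtype.val_injective.injOn).subset fun μ hμ => ?_
  refine ⟨le_trans ?_ (le_of_lt hμ), hμ⟩
  have := Multiset.card_nsmul_le_sum (s := μ.1) (a := 1) fun x hx =>
    Nat.one_le_iff_ne_zero.2 fun h0 => hp (h0 ▸ μ.2 x hx)
  rwa [smul_eq_mul, mul_one] at this

theorem filter_add_left {p q : ℕ → Prop} [DecidablePred p] (h : ∀ x, p x → ¬ q x)
    {μ ν : Multiset ℕ} (hμ : ∀ x ∈ μ, p x) (hν : ∀ x ∈ ν, q x) : (μ + ν).filter p = μ := by
  rw [Multiset.filter_add, Multiset.filter_eq_self.2 hμ,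
    Multiset.filter_eq_nil.2 fun x hx hpx => h x hpx (hν x hx), add_zero]

open Classical in
/-- Multisets with parts of two disjoint kinds are pairs of multisets. -/
noncomputable def partsOrEquiv {p q s : ℕ → Prop} (h : ∀ x, p x → ¬ q x)
    (hs : ∀ x, s x ↔ p x ∨ q x) : Parts p × Parts q ≃ Parts s where
  toFun x := ⟨x.1.1 + x.2.1, fun y hy => (hs y).2 <| (Multiset.mem_add.1 hy).imp (x.1.2 y) (x.2.2 y)⟩
  invFun μ := ⟨⟨μ.1.filter p, fun _ hx => (Multiset.mem_filter.1 hx).2⟩,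
    ⟨μ.1.filter q, fun _ hx => (Multiset.mem_filter.1 hx).2⟩⟩
  left_inv x := by
    refine Prod.ext (Subtype.ext (filter_add_left h x.1.2 x.2.2)) (Subtype.ext ?_)
    change (x.1.1 + x.2.1).filter q = x.2.1
    rw [add_comm]
    exact filter_add_left (fun y hq hp => h y hp hq) x.2.2 x.1.2
  right_inv μ := by
    refine Subtype.ext ?_
    change μ.1.filter p + μ.1.filter q = μ.1
    rw [Multiset.filter_congr (q := fun x => ¬ p x) fun x hx =>
      ⟨fun hq hp => h x hp hq, fun hp => ((hs x).1 (μ.2 x hx)).resolve_left hp⟩]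
    exact Multiset.filter_add_not _ _

/-- The multisets whose only part is `i`. -/
def partsEqEquiv (i : ℕ) : ℕ ≃ Parts (fun x => x = i) where
  toFun c := ⟨Multiset.replicate c i, fun _ hx => Multiset.eq_of_mem_replicate hx⟩
  invFun μ := μ.1.card
  left_inv c := Multiset.card_replicate c i
  right_inv μ := Subtype.ext (Multiset.eq_replicate_card.2 μ.2).symm

theorem tsum_parts_or {p q s : ℕ → Prop} (h : ∀ x, p x → ¬ q x) (hs : ∀ x, s x ↔ p x ∨ q x)
    (f : Multiset ℕ → ℚ⟦X⟧) :
    ∑' μ : Parts s, f μ.1 = ∑' x : Parts p × Parts q, f (x.1.1 + x.2.1) :=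
  ((partsOrEquiv h hs).tsum_eq fun μ => f μ.1).symm

/-- The generating function of the multisets of parts satisfying `p`. -/
noncomputable def partsGf (p : ℕ → Prop) : ℚ⟦X⟧ := ∑' μ : Parts p, X ^ μ.1.sum

theorem tsum_parts_or_mul {p q s : ℕ → Prop} (hp : ¬ p 0) (hq : ¬ q 0) (h : ∀ x, p x → ¬ q x)
    (hs : ∀ x, s x ↔ p x ∨ q x) (f g g' : Multiset ℕ → ℚ⟦X⟧)
    (hf : ∀ μ ν : Multiset ℕ, (∀ x ∈ μ, p x) → (∀ x ∈ ν, q x) → f (μ + ν) = g μ * g' ν) :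
    ∑' μ : Parts s, f μ.1 * X ^ μ.1.sum =
      (∑' μ : Parts p, g μ.1 * X ^ μ.1.sum) * ∑' μ : Parts q, g' μ.1 * X ^ μ.1.sum := by
  rw [tsum_parts_or h hs fun μ => f μ * X ^ μ.sum,
    ((decay_parts hp).mul_left fun μ => g μ.1).tsum_mul_tsum
      ((decay_parts hq).mul_left fun μ => g' μ.1)]
  refine tsum_congr fun x => ?_
  rw [hf _ _ x.1.2 x.2.2, Multiset.sum_add, pow_add]
  ring

theorem partsGf_or {p q s : ℕ → Prop} (hp : ¬ p 0) (hq : ¬ q 0) (h : ∀ x, p x → ¬ q x)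
    (hs : ∀ x, s x ↔ p x ∨ q x) : partsGf s = partsGf p * partsGf q := by
  simpa [partsGf] using tsum_parts_or_mul hp hq h hs (fun _ => 1) (fun _ => 1) (fun _ => 1)
    fun _ _ _ _ => (one_mul 1).symm

theorem one_sub_mul_partsGf_eq (i : ℕ) : (1 - X ^ (i + 1)) * partsGf (fun x => x = i + 1) = 1 := by
  have h0 : constantCoeff (X ^ (i + 1) : ℚ⟦X⟧) = 0 := by simp
  have e : partsGf (fun x => x = i + 1) = ∑' c : ℕ, ((X : ℚ⟦X⟧) ^ (i + 1)) ^ c := by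
    rw [partsGf, ← (partsEqEquiv (i + 1)).tsum_eq]
    refine tsum_congr fun c => ?_
    rw [← pow_mul, mul_comm]
    simp [partsEqEquiv]
  rw [e]
  exact WithPiTopology.one_sub_mul_tsum_pow_of_constantCoeff_eq_zero h0

theorem partsGf_of_forall_not {p : ℕ → Prop} (h : ∀ x, ¬ p x) : partsGf p = 1 := by
  have : Unique (Parts p) := ⟨⟨⟨0, by simp⟩⟩, fun μ => Subtype.ext
    (Multiset.eq_zero_of_forall_notMem fun x hx => h x (μ.2 x hx))⟩
  rw [partsGf, tsum_congr fun μ : Parts p => show (X : ℚ⟦X⟧) ^ μ.1.sum = 1 by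
    rw [show μ = ⟨0, by simp⟩ from Subsingleton.elim _ _]; simp]
  simp

theorem partsGf_two_le (j : ℕ) :
    partsGf (fun x => 2 ≤ x ∧ x ≤ j + 1) = (1 - X) * invPoch (j + 1) := by
  induction j with
  | zero =>
    rw [partsGf_of_forall_not fun x => by omega]
    have := one_sub_mul_invPoch_succ 0
    rw [invPoch_zero] at this
    simpa using this.symm
  | succ j ih =>
    rw [partsGf_or (p := fun x => 2 ≤ x ∧ x ≤ j + 1) (q := fun x => x = j + 1 + 1) (by omega)
      (by omega) (fun x hx => by omega) (fun x => by omega), ih, ← one_sub_mul_invPoch_succ (j + 1)]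
    linear_combination (1 - X) * invPoch (j + 1 + 1) * one_sub_mul_partsGf_eq (j + 1)

/-- The generating function of the multisets of `k` natural numbers. -/
noncomputable def cardGf (k : ℕ) : ℚ⟦X⟧ :=
  ∑' μ : Multiset ℕ, if μ.card = k then X ^ μ.sum else 0

theorem decay_cardGf (k : ℕ) :
    Decay fun μ : Multiset ℕ => if μ.card = k then (X : ℚ⟦X⟧) ^ μ.sum else 0 := fun d =>
  (finite_card_le_sum_lt k d).subset fun μ hμ => by
    change ¬ X ^ d ∣ if μ.card = k then X ^ μ.sum else 0 at hμ
    split_ifs at hμ with h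
    · refine ⟨h.le, ?_⟩
      by_contra h'
      exact hμ (pow_dvd_pow X (not_lt.1 h'))
    · exact absurd (dvd_zero _) hμ

theorem cardGf_zero : cardGf 0 = 1 := by
  rw [cardGf, tsum_eq_single 0 fun μ hμ => if_neg fun h => hμ (Multiset.card_eq_zero.1 h)]
  simp

theorem sum_map_add (μ : Multiset ℕ) (c : ℕ) : (μ.map (· + c)).sum = μ.sum + μ.card * c := by
  rw [Multiset.sum_map_add]; simp

/-- Either 0 occurs and one copy is removed, or all k + 1 entries are positive and each is lowered
by 1. -/
theorem cardGf_succ (k : ℕ) : cardGf (k + 1) = cardGf k + X ^ (k + 1) * cardGf (k + 1) := by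
  have hd := decay_cardGf (k + 1)
  have e1 : cardGf k = ∑' μ : Multiset ℕ,
      if 0 ∈ μ then (if μ.card = k + 1 then (X : ℚ⟦X⟧) ^ μ.sum else 0) else 0 := by
    rw [← (show Function.Injective fun μ : Multiset ℕ => 0 ::ₘ μ from
      fun _ _ h => (Multiset.cons_inj_right 0).1 h).tsum_eq]
    · rw [cardGf]
      refine tsum_congr fun μ => ?_
      simp
    · intro μ hμ
      by_cases h0 : 0 ∈ μ
      · exact ⟨μ.erase 0, Multiset.cons_erase h0⟩
      · exact absurd (if_neg h0) hμ
  have e2 : X ^ (k + 1) * cardGf (k + 1) = ∑' μ : Multiset ℕ,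
      if ¬ 0 ∈ μ then (if μ.card = k + 1 then (X : ℚ⟦X⟧) ^ μ.sum else 0) else 0 := by
    rw [← (Multiset.map_injective (add_left_injective 1)).tsum_eq]
    · rw [cardGf, ← hd.summable.tsum_mul_left]
      refine tsum_congr fun μ => ?_
      have h0 : ¬ 0 ∈ μ.map (· + 1) := by simp
      rw [if_pos h0, Multiset.card_map, sum_map_add]
      split_ifs with h
      · rw [h, mul_one, ← pow_add, add_comm]
      · rw [mul_zero]
    · intro μ hμ
      by_cases h0 : 0 ∈ μ
      · exact absurd (if_neg (not_not.2 h0)) hμ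
      · refine ⟨μ.map (· - 1), ?_⟩
        rw [Multiset.map_map]
        conv_rhs => rw [← Multiset.map_id μ]
        refine Multiset.map_congr rfl fun x hx => ?_
        have : x ≠ 0 := fun h => h0 (h ▸ hx)
        simp only [Function.comp_apply, id]
        omega
  rw [e2, e1, ← (hd.ite _).summable.tsum_add (hd.ite _).summable, cardGf]
  refine tsum_congr fun μ => ?_
  by_cases h0 : 0 ∈ μ <;> simp [h0]

theorem cardGf_eq (k : ℕ) : cardGf k = invPoch k := by
  induction k with
  | zero => rw [cardGf_zero, invPoch_zero]
  | succ k ih =>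
    refine mul_left_cancel₀ (one_sub_X_pow_ne_zero (Nat.succ_ne_zero k)) ?_
    rw [Nat.succ_eq_add_one, one_sub_mul_invPoch_succ, ← ih]
    linear_combination cardGf_succ k

/-- Shift of the parts by `j + 1`. -/
def shiftEquiv (j : ℕ) : Multiset ℕ ≃ Parts (fun x => j < x) where
  toFun μ := ⟨μ.map (· + (j + 1)), fun x hx => by
    obtain ⟨y, _, rfl⟩ := Multiset.mem_map.1 hx
    omega⟩
  invFun μ := μ.1.map (· - (j + 1))
  left_inv μ := by
    change (μ.map (· + (j + 1))).map (· - (j + 1)) = μ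
    rw [Multiset.map_map]
    conv_rhs => rw [← Multiset.map_id μ]
    refine Multiset.map_congr rfl fun x _ => ?_
    simp
  right_inv μ := by
    refine Subtype.ext ?_
    change (μ.1.map (· - (j + 1))).map (· + (j + 1)) = μ.1
    rw [Multiset.map_map]
    conv_rhs => rw [← Multiset.map_id μ.1]
    refine Multiset.map_congr rfl fun x hx => ?_
    have := μ.2 x hx
    simp only [Function.comp_apply, id]
    omega

theorem tsum_parts_card (j : ℕ) (f : ℕ → ℚ⟦X⟧) :
    ∑' μ : Parts (fun x => j < x), f μ.1.card * X ^ μ.1.sum =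
      ∑' k : ℕ, f k * (X ^ (k * (j + 1)) * invPoch k) := by
  have hd : Decay fun μ : Parts (fun x => j < x) => f μ.1.card * X ^ μ.1.sum :=
    (decay_parts (Nat.not_lt_zero j)).mul_left _
  rw [hd.tsum_fiber fun μ => μ.1.card]
  refine tsum_congr fun k => ?_
  rw [← (shiftEquiv j).tsum_eq, ← cardGf_eq, cardGf, ← (decay_cardGf k).summable.tsum_mul_left,
    ← ((decay_cardGf k).mul_left _).summable.tsum_mul_left]
  refine tsum_congr fun μ => ?_
  change (if (μ.map (· + (j + 1))).card = k then
    f (μ.map (· + (j + 1))).card * X ^ (μ.map (· + (j + 1))).sum else 0) = _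
  rw [Multiset.card_map, sum_map_add]
  split_ifs with h
  · rw [h, pow_add]; ring
  · simp

/-! ### Crank moments: the combinatorial part -/

theorem decay_ite_eq {ι : Type*} [DecidableEq ι] (i : ι) (x : ℚ⟦X⟧) :
    Decay fun k => if k = i then x else 0 := fun d =>
  (Set.finite_singleton i).subset fun k hk => by
    by_contra h
    refine hk ?_
    change X ^ d ∣ if k = i then x else 0
    rw [if_neg (show k ≠ i from h)]
    exact dvd_zero _

/-- The contribution of a partition to the `r`th crank moment. -/
noncomputable def crankWeight (r : ℕ) (μ : Multiset ℕ) : ℤ :=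
  ∑ᶠ m : ℤ, m ^ r * crankContribution μ m

theorem crankWeight_support (r : ℕ) (μ : Multiset ℕ) :
    (Function.support fun m : ℤ => m ^ r * crankContribution μ m).Finite := by
  refine (Set.toFinite {-1, 0, 1, partitionCrank μ}).subset fun m hm => ?_
  by_contra h
  simp only [Set.mem_insert_iff, Set.mem_singleton_iff, not_or] at h
  refine hm ?_
  simp only [crankContribution]
  rw [if_neg h.2.1, if_neg (not_or.2 ⟨h.2.2.1, h.1⟩), if_neg (Ne.symm h.2.2.2)]
  simp

theorem crankWeight_of_ne (r : ℕ) {μ : Multiset ℕ} (h : μ ≠ {1}) :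
    crankWeight r μ = partitionCrank μ ^ r := by
  rw [crankWeight, finsum_eq_single _ (partitionCrank μ) fun m hm => ?_]
  · rw [crankContribution, if_neg h, if_pos rfl, mul_one]
  · rw [crankContribution, if_neg h, if_neg hm.symm, mul_zero]

/-- The weights at m = ±1 give 2 for even r; the weight -1 at m = 0 is seen only when r = 0, where
`0 ^ 0 = 1`. -/
theorem crankWeight_one {r : ℕ} (hr : Even r) : crankWeight r {1} = 2 - 0 ^ r := by
  rw [crankWeight, finsum_eq_sum_of_support_subset (s := {0, 1, -1})]
  · rw [Finset.sum_insert (by decide), Finset.sum_insert (by decide), Finset.sum_singleton]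
    simp [crankContribution, hr.neg_one_pow]
    ring
  · intro m hm
    by_contra h
    simp only [Finset.coe_insert, Finset.coe_singleton, Set.mem_insert_iff,
      Set.mem_singleton_iff, not_or] at h
    refine hm ?_
    change m ^ r * crankContribution {1} m = 0
    rw [crankContribution, if_pos rfl, if_neg h.1, if_neg (not_or.2 h.2), mul_zero]

/-- The generating function of the crank moments. -/
noncomputable def crankSum (r : ℕ) : ℚ⟦X⟧ :=
  ∑' μ : Parts (fun x => x ≠ 0), (crankWeight r μ.1 : ℚ⟦X⟧) * X ^ μ.1.sum

/-- The generating function of the partitions with `j` ones and `k` parts greater than `j`. -/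
noncomputable def onesGf (j k : ℕ) : ℚ⟦X⟧ :=
  (1 - X) * (X ^ (j + k * (j + 1)) * (invPoch j * invPoch k))

theorem decay_onesGf : Decay fun x : ℕ × ℕ => onesGf x.1 x.2 := by
  refine Decay.of_dvd (fun x => x.1 + x.2) (fun d => ?_) fun x => ?_
  · refine ((Set.finite_Iio d).prod (Set.finite_Iio d)).subset fun x hx => ?_
    simp only [Set.mem_ofPred_eq] at hx
    exact ⟨by simp only [Set.mem_Iio]; omega, by simp only [Set.mem_Iio]; omega⟩
  · exact ((pow_dvd_pow X (by nlinarith)).mul_right _).mul_left _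

/-- Pairs of natural numbers are given by their difference and minimum. -/
def diffMinEquiv : ℕ × ℕ ≃ ℤ × ℕ where
  toFun x := (x.2 - x.1, min x.1 x.2)
  invFun y := (y.2 + (-y.1).toNat, y.2 + y.1.toNat)
  left_inv x := by ext <;> simp only <;> omega
  right_inv y := by ext <;> simp only <;> omega

theorem onesGf_diffMinEquiv_symm (m : ℤ) (i : ℕ) :
    onesGf (diffMinEquiv.symm (m, i)).1 (diffMinEquiv.symm (m, i)).2 = (1 - X) *
      (X ^ m.natAbs * (X ^ (i * (i + m.natAbs + 2)) * (invPoch i * invPoch (i + m.natAbs)))) := by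
  change onesGf (i + (-m).toNat) (i + m.toNat) = _
  rw [onesGf]
  rcases le_total 0 m with h | h
  · rw [show (-m).toNat = 0 by omega, show m.toNat = m.natAbs by omega, add_zero]
    ring
  · rw [show m.toNat = 0 by omega, show (-m).toNat = m.natAbs by omega, add_zero]
    ring

/-- The pairs (j, k) are grouped by m = k - j. With i = min(j, k), the exponent j + k(j + 1) equals
|m| + i(i + |m| + 2), the exponent in the Durfee sum defining `crankGf`. -/
theorem tsum_onesGf (r : ℕ) :
    ∑' j : ℕ, ∑' k : ℕ, (((k - j : ℤ) ^ r : ℤ) : ℚ⟦X⟧) * onesGf j k = crankGfMoment r := by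
  have hd := decay_onesGf.mul_left fun x => (((x.2 - x.1 : ℤ) ^ r : ℤ) : ℚ⟦X⟧)
  have hd' := hd.comp (e := diffMinEquiv.symm) diffMinEquiv.symm.injective
  calc _ = ∑' x : ℕ × ℕ, (((x.2 - x.1 : ℤ) ^ r : ℤ) : ℚ⟦X⟧) * onesGf x.1 x.2 := hd.tsum_prod.symm
    _ = _ := (diffMinEquiv.symm.tsum_eq _).symm
    _ = _ := hd'.tsum_prod
    _ = _ := by
      rw [crankGfMoment, moment]
      refine tsum_congr fun m => ?_
      rw [crankGf, durfee, ← (decay_durfee _ _ _).summable.tsum_mul_left,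
        ← ((decay_durfee _ _ _).mul_left _).summable.tsum_mul_left,
        ← (((decay_durfee _ _ _).mul_left _).mul_left _).summable.tsum_mul_left]
      refine tsum_congr fun i => ?_
      rw [onesGf_diffMinEquiv_symm]
      congr 3
      change (((i + m.toNat : ℕ) : ℤ) - ((i + (-m).toNat : ℕ) : ℤ)) = m
      omega

theorem tsum_filter_card (j : ℕ) (f : ℕ → ℚ⟦X⟧) :
    ∑' μ : Parts (fun x => 2 ≤ x), f (μ.1.filter (fun x => j + 1 < x)).card * X ^ μ.1.sum =
      (1 - X) * invPoch (j + 1) * ∑' k : ℕ, f k * (X ^ (k * (j + 1 + 1)) * invPoch k) := by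
  rw [← tsum_parts_card, ← partsGf_two_le]
  have h := tsum_parts_or_mul (s := fun x => 2 ≤ x) (p := fun x => 2 ≤ x ∧ x ≤ j + 1)
    (q := fun x => j + 1 < x) (by omega) (by omega) (fun x hx => by omega) (fun x => by omega)
    (fun μ => f (μ.filter (fun x => j + 1 < x)).card) (fun _ => 1) (fun ν => f ν.card)
    fun μ ν hμ hν => by
      rw [add_comm μ ν, filter_add_left (q := fun x => 2 ≤ x ∧ x ≤ j + 1) (fun x hx => by omega)
        hν hμ, one_mul]
  simpa only [one_mul, partsGf] using h

theorem tsum_parts_sup_le (k : ℕ) :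
    ∑' μ : Parts (fun x => 2 ≤ x), (if μ.1.sup ≤ k then (X : ℚ⟦X⟧) ^ μ.1.sum else 0) =
      partsGf (fun x => 2 ≤ x ∧ x ≤ k) := by
  obtain ⟨e, he⟩ : ∃ e : Parts (fun x => 2 ≤ x ∧ x ≤ k) → Parts (fun x => 2 ≤ x),
      ∀ μ, (e μ).1 = μ.1 := ⟨fun μ => ⟨μ.1, fun x hx => (μ.2 x hx).1⟩, fun _ => rfl⟩
  have hinj : Function.Injective e := fun μ ν h => Subtype.ext (by rw [← he, h, he])
  rw [partsGf, ← hinj.tsum_eq]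
  · refine tsum_congr fun μ => ?_
    rw [he, if_pos (Multiset.sup_le.2 fun x hx => (μ.2 x hx).2)]
  · intro μ hμ
    by_cases h : μ.1.sup ≤ k
    · exact ⟨⟨μ.1, fun x hx => ⟨μ.2 x hx, Multiset.sup_le.1 h x hx⟩⟩, Subtype.ext (he _)⟩
    · exact absurd (if_neg h) hμ

/-- Without ones the crank is the largest part k, and for k ≥ 2 the generating function (1 - q)
q^k/(q)_k is correct. For k = 0 and k = 1 it gives 1 - q and q in place of 1 and 0. -/
theorem tsum_parts_sup_eq (k : ℕ) :
    ∑' μ : Parts (fun x => 2 ≤ x), (if μ.1.sup = k then (X : ℚ⟦X⟧) ^ μ.1.sum else 0) =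
      onesGf 0 k + (if k = 0 then X else 0) - if k = 1 then X else 0 := by
  have h0 : partsGf (fun x => 2 ≤ x ∧ x ≤ 0) = 1 := partsGf_of_forall_not fun x => by omega
  have h1 : partsGf (fun x => 2 ≤ x ∧ x ≤ 1) = 1 := partsGf_of_forall_not fun x => by omega
  have hd : Decay fun μ : Parts (fun x => 2 ≤ x) => (X : ℚ⟦X⟧) ^ μ.1.sum := decay_parts (by omega)
  have e1 := one_sub_mul_invPoch_succ 0
  rw [invPoch_zero] at e1
  cases k with
  | zero =>
    rw [tsum_congr fun μ : Parts (fun x => 2 ≤ x) => if_congr (Nat.le_zero (i := μ.1.sup)).symm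
      rfl rfl, tsum_parts_sup_le, h0, onesGf, invPoch_zero]
    simp
  | succ k =>
    have hs : ∑' μ : Parts (fun x => 2 ≤ x),
        (if μ.1.sup = k + 1 then (X : ℚ⟦X⟧) ^ μ.1.sum else 0) =
        partsGf (fun x => 2 ≤ x ∧ x ≤ k + 1) - partsGf (fun x => 2 ≤ x ∧ x ≤ k) := by
      rw [← tsum_parts_sup_le, ← tsum_parts_sup_le, ← (hd.ite _).summable.tsum_sub
        (hd.ite _).summable]
      refine tsum_congr fun μ => ?_
      rcases lt_trichotomy μ.1.sup (k + 1) with h | h | h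
      · rw [if_neg (by omega), if_pos (by omega), if_pos (by omega), sub_self]
      · rw [if_pos (by omega), if_pos (by omega), if_neg (by omega), sub_zero]
      · rw [if_neg (by omega), if_neg (by omega), if_neg (by omega), sub_zero]
    rw [hs, if_neg (Nat.succ_ne_zero k)]
    cases k with
    | zero =>
      rw [h0, h1, onesGf, invPoch_zero]
      simp only [zero_add, if_true] at e1 ⊢
      linear_combination -X * e1
    | succ k =>
      rw [if_neg (by omega), partsGf_two_le, partsGf_two_le, onesGf, invPoch_zero,
        ← one_sub_mul_invPoch_succ (k + 1)]
      ring

theorem partitionCrank_of_one_notMem {μ : Multiset ℕ} (h : 1 ∉ μ) :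
    partitionCrank μ = μ.sup := if_neg h

theorem partitionCrank_replicate_add {j : ℕ} {μ : Multiset ℕ} (h : ∀ x ∈ μ, 2 ≤ x) :
    partitionCrank (Multiset.replicate (j + 1) 1 + μ) =
      ((μ.filter (fun x => j + 1 < x)).card : ℤ) - (j + 1 : ℕ) := by
  have h1 : 1 ∉ μ := fun h' => by have := h 1 h'; omega
  have hc : (Multiset.replicate (j + 1) 1 + μ).count 1 = j + 1 := by
    rw [Multiset.count_add, Multiset.count_replicate_self, Multiset.count_eq_zero_of_notMem h1]
  rw [partitionCrank, if_pos (by simp), hc, Multiset.filter_add, Multiset.filter_eq_nil.2, zero_add]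
  intro x hx
  rw [Multiset.eq_of_mem_replicate hx]
  omega

/-- The exceptional case is the partition {1}: its actual crank -1 would contribute 1 for even r,
while the convention prescribes 2 - 0^r. -/
theorem crankWeight_replicate_add {r : ℕ} (hr : Even r) {j : ℕ} {μ : Multiset ℕ}
    (h : ∀ x ∈ μ, 2 ≤ x) : crankWeight r (Multiset.replicate (j + 1) 1 + μ) =
      (((μ.filter (fun x => j + 1 < x)).card : ℤ) - (j + 1 : ℕ)) ^ r +
        if μ = 0 then (if j = 0 then 1 - 0 ^ r else 0) else 0 := by
  have h1 : 1 ∉ μ := fun h' => by have := h 1 h'; omega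
  by_cases h2 : μ = 0 ∧ j = 0
  · rw [h2.1, h2.2, if_pos rfl, if_pos rfl]
    simp only [zero_add, Multiset.replicate_one, add_zero, crankWeight_one hr]
    simp [hr.neg_one_pow]
    ring
  · rw [crankWeight_of_ne, partitionCrank_replicate_add h]
    · split_ifs with h3 h4
      · exact absurd ⟨h3, h4⟩ h2
      · rw [add_zero]
      · rw [add_zero]
    · intro h3
      apply h2
      have h4 := congrArg Multiset.card h3
      rw [Multiset.card_add, Multiset.card_replicate, Multiset.card_singleton] at h4
      exact ⟨Multiset.card_eq_zero.1 (by omega), by omega⟩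

theorem tsum_crankWeight_zero (r : ℕ) :
    ∑' μ : Parts (fun x => 2 ≤ x), (crankWeight r μ.1 : ℚ⟦X⟧) * X ^ μ.1.sum =
      ∑' k : ℕ, ((k : ℤ) ^ r : ℤ) * onesGf 0 k - (1 - 0 ^ r) * X := by
  have h1 : ∀ μ : Parts (fun x => 2 ≤ x), (crankWeight r μ.1 : ℚ⟦X⟧) * X ^ μ.1.sum =
      (((μ.1.sup : ℤ) ^ r : ℤ) : ℚ⟦X⟧) * X ^ μ.1.sum := fun μ => by
    have h : 1 ∉ μ.1 := fun h' => by have := μ.2 1 h'; omega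
    rw [crankWeight_of_ne r fun h' => h (by rw [h']; simp), partitionCrank_of_one_notMem h]
  have hd : Decay fun μ : Parts (fun x => 2 ≤ x) => (X : ℚ⟦X⟧) ^ μ.1.sum := decay_parts (by omega)
  have h2 : ∀ k : ℕ, ∑' μ : Parts (fun x => 2 ≤ x), (if μ.1.sup = k then
      (((μ.1.sup : ℤ) ^ r : ℤ) : ℚ⟦X⟧) * X ^ μ.1.sum else 0) = (((k : ℤ) ^ r : ℤ) : ℚ⟦X⟧) *
      onesGf 0 k + ((if k = 0 then 0 ^ r * X else 0) - if k = 1 then X else 0) := fun k => by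
    have h3 : ∀ μ : Parts (fun x => 2 ≤ x), (if μ.1.sup = k then
      (((μ.1.sup : ℤ) ^ r : ℤ) : ℚ⟦X⟧) * X ^ μ.1.sum else 0) = (((k : ℤ) ^ r : ℤ) : ℚ⟦X⟧) *
      (if μ.1.sup = k then X ^ μ.1.sum else 0) := fun μ => by split_ifs with h <;> simp [h]
    rw [tsum_congr h3, (hd.ite _).summable.tsum_mul_left, tsum_parts_sup_eq]
    rcases Nat.lt_trichotomy k 1 with h | h | h
    · obtain rfl : k = 0 := by omega
      simp; ring
    · subst h; simp; ring
    · rw [if_neg (by omega), if_neg (by omega), if_neg (by omega)]; ring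
  have d0 : Decay fun k : ℕ => (((k : ℤ) ^ r : ℤ) : ℚ⟦X⟧) * onesGf 0 k :=
    (decay_onesGf.comp (e := fun k => (0, k)) fun _ _ h => (Prod.ext_iff.1 h).2).mul_left _
  rw [tsum_congr h1, (hd.mul_left _).tsum_fiber fun μ => μ.1.sup, tsum_congr h2,
    d0.summable.tsum_add ((decay_ite_eq _ _).sub (decay_ite_eq _ _)).summable,
    (decay_ite_eq _ _).summable.tsum_sub (decay_ite_eq _ _).summable, tsum_ite_eq, tsum_ite_eq]
  ring

theorem tsum_crankWeight_succ {r : ℕ} (hr : Even r) (j : ℕ) :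
    X ^ (j + 1) * ∑' μ : Parts (fun x => 2 ≤ x),
      (crankWeight r (Multiset.replicate (j + 1) 1 + μ.1) : ℚ⟦X⟧) * X ^ μ.1.sum =
      ∑' k : ℕ, (((k - (j + 1 : ℕ) : ℤ) ^ r : ℤ) : ℚ⟦X⟧) * onesGf (j + 1) k +
        if j = 0 then (1 - 0 ^ r) * X else 0 := by
  have hd : Decay fun μ : Parts (fun x => 2 ≤ x) => (X : ℚ⟦X⟧) ^ μ.1.sum := decay_parts (by omega)
  have h1 : ∀ μ : Parts (fun x => 2 ≤ x),
      (crankWeight r (Multiset.replicate (j + 1) 1 + μ.1) : ℚ⟦X⟧) * X ^ μ.1.sum =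
      (((((μ.1.filter (fun x => j + 1 < x)).card : ℤ) - (j + 1 : ℕ)) ^ r : ℤ) : ℚ⟦X⟧) *
        X ^ μ.1.sum +
        if μ = ⟨0, by simp⟩ then (if j = 0 then 1 - 0 ^ r else 0) else 0 := fun μ => by
    rw [crankWeight_replicate_add hr μ.2]
    by_cases h : μ = ⟨0, by simp⟩
    · rw [if_pos h, h, if_pos rfl]
      split_ifs <;> simp
    · rw [if_neg h, if_neg fun h' => h (Subtype.ext h')]
      simp
  rw [tsum_congr h1, (hd.mul_left _).summable.tsum_add (decay_ite_eq _ _).summable, tsum_ite_eq,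
    tsum_filter_card j fun k => ((((k : ℤ) - (j + 1 : ℕ)) ^ r : ℤ) : ℚ⟦X⟧), mul_add, ← mul_assoc]
  have d2 : Decay fun k : ℕ => X ^ (k * (j + 1 + 1)) * invPoch k :=
    (Decay.of_dvd (fun k => k) (fun d => Set.finite_Iio d) fun k =>
      pow_dvd_pow X (Nat.le_mul_of_pos_right k (by omega))).mul_right _
  rw [← (d2.mul_left _).summable.tsum_mul_left]
  congr 1
  · refine tsum_congr fun k => ?_
    rw [onesGf]
    ring
  · split_ifs with h
    · rw [h]; ring
    · rw [mul_zero]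

/-- The convention for the partition {1} is exactly what compensates the discrepancy of `onesGf 0 k`
at k = 0 and k = 1: the corrections ±(1 - 0^r) q from no ones and from a single one cancel. -/
theorem crankSum_eq {r : ℕ} (hr : Even r) : crankSum r = crankGfMoment r := by
  have h1 : crankSum r = ∑' j : ℕ, X ^ j * ∑' μ : Parts (fun x => 2 ≤ x),
      (crankWeight r (Multiset.replicate j 1 + μ.1) : ℚ⟦X⟧) * X ^ μ.1.sum := by
    obtain ⟨F, hF⟩ : ∃ F : ℕ × Parts (fun x => 2 ≤ x) → ℚ⟦X⟧, ∀ x, F x =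
        (crankWeight r (Multiset.replicate x.1 1 + x.2.1) : ℚ⟦X⟧) * (X ^ x.1 * X ^ x.2.1.sum) :=
      ⟨_, fun _ => rfl⟩
    have d1 : Decay fun j : ℕ => (X : ℚ⟦X⟧) ^ j := decay_pow dvd_rfl
    have d2 : Decay fun μ : Parts (fun x => 2 ≤ x) => (X : ℚ⟦X⟧) ^ μ.1.sum := decay_parts (by omega)
    have dF : Decay F := by
      rw [funext hF]
      exact (d1.prod d2).mul_left _
    have e1 : crankSum r = ∑' x, F x := by
      rw [crankSum, tsum_parts_or (p := fun x => x = 1) (q := fun x => 2 ≤ x)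
        (fun x hx => by omega) (fun x => by omega)
        fun μ => (crankWeight r μ : ℚ⟦X⟧) * X ^ μ.sum,
        ← ((partsEqEquiv 1).prodCongr (Equiv.refl _)).tsum_eq]
      refine tsum_congr fun x => ?_
      rw [hF, ← pow_add]
      simp [partsEqEquiv]
    rw [e1, dF.tsum_prod]
    refine tsum_congr fun j => ?_
    rw [← (d2.mul_left _).summable.tsum_mul_left]
    refine tsum_congr fun μ => ?_
    rw [hF]
    ring
  have d3 : Decay fun j : ℕ => ∑' k : ℕ, (((k - j : ℤ) ^ r : ℤ) : ℚ⟦X⟧) * onesGf j k :=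
    (decay_onesGf.mul_left fun x => (((x.2 - x.1 : ℤ) ^ r : ℤ) : ℚ⟦X⟧)).tsum_fst
  have d4 := (decay_ite_eq 1 ((1 - 0 ^ r) * X)).sub (decay_ite_eq 0 ((1 - 0 ^ r) * X)) (ι := ℕ)
  have h2 : ∀ j : ℕ, X ^ j * ∑' μ : Parts (fun x => 2 ≤ x),
      (crankWeight r (Multiset.replicate j 1 + μ.1) : ℚ⟦X⟧) * X ^ μ.1.sum =
      ∑' k : ℕ, (((k - j : ℤ) ^ r : ℤ) : ℚ⟦X⟧) * onesGf j k +
      ((if j = 1 then (1 - 0 ^ r) * X else 0) - if j = 0 then (1 - 0 ^ r) * X else 0) := by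
    intro j
    cases j with
    | zero =>
      have := tsum_crankWeight_zero r
      simp only [Multiset.replicate_zero, zero_add, pow_zero, one_mul, this]
      simp [sub_eq_add_neg]
    | succ j =>
      rw [tsum_crankWeight_succ hr]
      simp
  rw [h1, tsum_congr h2, d3.summable.tsum_add d4.summable, tsum_onesGf,
    tsum_eq_sum (s := {0, 1}) fun j hj => ?_, Finset.sum_pair zero_ne_one]
  · simp
  · simp only [Finset.mem_insert, Finset.mem_singleton, not_or] at hj
    rw [if_neg hj.1, if_neg hj.2, sub_zero]

/-! ### Residual cranks of overpartitions -/

namespace Overpartition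

variable {n : ℕ}

theorem overlined_val_le (l : Overpartition n) : l.overlined.val ≤ l.parts :=
  (Multiset.le_iff_subset l.overlined.nodup).2 fun _ hx => l.overlined_subset_parts hx

theorem overlined_add_nonOverlined (l : Overpartition n) :
    l.overlined.val + l.nonOverlined = l.parts :=
  add_tsub_cancel_of_le l.overlined_val_le

theorem pos_of_mem_parts (l : Overpartition n) {x : ℕ} (hx : x ∈ l.parts) : x ≠ 0 :=
  (l.toPartition.parts_pos hx).ne'

/-- The overlined and the non-overlined parts. -/
def split (x : Σ n, Overpartition n) : {s : Finset ℕ // 0 ∉ s} × Parts (fun x => x ≠ 0) :=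
  (⟨x.2.overlined, fun h => x.2.pos_of_mem_parts (x.2.overlined_subset_parts h) rfl⟩,
    ⟨x.2.nonOverlined, fun _ hy => x.2.pos_of_mem_parts
      (Multiset.mem_of_le (Multiset.sub_le_self _ _) hy)⟩)

theorem fst_eq (x : Σ n, Overpartition n) :
    x.1 = (split x).1.1.val.sum + (split x).2.1.sum := by
  rw [← Multiset.sum_add]
  exact (congrArg Multiset.sum x.2.overlined_add_nonOverlined).trans x.2.toPartition.parts_sum |>.symm

theorem split_bijective : Function.Bijective split := by
  constructor
  · intro x y h
    have h1 : x.2.overlined = y.2.overlined := congrArg (fun z => z.1.1) h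
    have h2 : x.2.nonOverlined = y.2.nonOverlined := congrArg (fun z => z.2.1) h
    have h3 : x.1 = y.1 := by rw [fst_eq x, fst_eq y, h]
    obtain ⟨n, l⟩ := x
    obtain ⟨n', l'⟩ := y
    obtain rfl : n = n' := h3
    have h4 : l.parts = l'.parts := by
      rw [← l.overlined_add_nonOverlined, ← l'.overlined_add_nonOverlined]
      exact congrArg₂ (fun a b => a.val + b) h1 h2
    exact congrArg (Sigma.mk n) (Overpartition.ext (Nat.Partition.ext h4) h1)
  · rintro ⟨⟨s, hs⟩, ⟨μ, hμ⟩⟩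
    refine ⟨⟨(s.val + μ).sum, ⟨⟨s.val + μ, fun {x} hx => ?_, rfl⟩, s, fun x hx => ?_⟩⟩, ?_⟩
    · rcases Multiset.mem_add.1 hx with h | h
      · exact Nat.pos_of_ne_zero fun h0 => hs (h0 ▸ h)
      · exact Nat.pos_of_ne_zero (hμ x h)
    · exact Multiset.mem_toFinset.2 (Multiset.mem_add.2 (Or.inl hx))
    · exact Prod.ext rfl (Subtype.ext (add_tsub_cancel_left s.val μ))

end Overpartition

/-- The generating function of finite sets of positive integers. -/
noncomputable def distinctGf : ℚ⟦X⟧ := ∑' s : {s : Finset ℕ // 0 ∉ s}, X ^ s.1.val.sum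

theorem decay_distinct : Decay fun s : {s : Finset ℕ // 0 ∉ s} => (X : ℚ⟦X⟧) ^ s.1.val.sum :=
  (decay_parts (p := fun x => x ≠ 0) (by simp)).comp
    (e := fun s : {s : Finset ℕ // 0 ∉ s} => ⟨s.1.val, fun _ hx h0 => s.2 (h0 ▸ hx)⟩)
    fun _ _ h => Subtype.ext (Finset.val_injective (congrArg Subtype.val h))

/-- Sums of a statistic of the non-overlined parts over all overpartitions factor. -/
theorem mk_sum_nonOverlined (f : Multiset ℕ → ℤ) :
    (mk fun n => ∑ l : Overpartition n, (f l.nonOverlined : ℚ)) =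
      distinctGf * ∑' μ : Parts (fun x => x ≠ 0), (f μ.1 : ℚ⟦X⟧) * X ^ μ.1.sum := by
  have d1 := (decay_parts (p := fun x => x ≠ 0) (by simp)).mul_left fun μ => (f μ.1 : ℚ⟦X⟧)
  have d2 := decay_distinct.prod d1
  have h1 := ((Equiv.ofBijective _ Overpartition.split_bijective).tsum_eq
    fun x : {s : Finset ℕ // 0 ∉ s} × Parts (fun x => x ≠ 0) =>
      (X : ℚ⟦X⟧) ^ x.1.1.val.sum * ((f x.2.1 : ℚ⟦X⟧) * X ^ x.2.1.sum))
  have h2 : ∀ x : Σ n, Overpartition n, (X : ℚ⟦X⟧) ^ (Overpartition.split x).1.1.val.sum *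
      ((f (Overpartition.split x).2.1 : ℚ⟦X⟧) * X ^ (Overpartition.split x).2.1.sum) =
      C (f x.2.nonOverlined : ℚ) * X ^ x.1 := fun x => by
    have e : (X : ℚ⟦X⟧) ^ x.1 = X ^ (Overpartition.split x).1.1.val.sum *
        X ^ (Overpartition.split x).2.1.sum := by rw [← pow_add, ← Overpartition.fst_eq]
    rw [map_intCast, e, mul_left_comm]
    rfl
  have d3 : Decay fun x : Σ n, Overpartition n => C (f x.2.nonOverlined : ℚ) * X ^ x.1 := by
    simpa only [h2] using d2.comp (e := Overpartition.split) Overpartition.split_bijective.1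
  rw [distinctGf, decay_distinct.tsum_mul_tsum d1, ← h1]
  simp only [Equiv.ofBijective_apply, h2]
  ext n
  rw [coeff_mk, d3.coeff_tsum, finsum_eq_sum_of_support_subset
    (s := Finset.univ.map (Function.Embedding.sigmaMk n)), Finset.sum_map]
  · refine Finset.sum_congr rfl fun l _ => ?_
    rw [Function.Embedding.sigmaMk_apply, coeff_C_mul, coeff_X_pow, if_pos rfl, mul_one]
  · intro x hx
    obtain ⟨m, l⟩ := x
    by_cases h : n = m
    · subst h
      simp
    · refine absurd ?_ hx
      change coeff n (C (f l.nonOverlined : ℚ) * X ^ m) = 0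
      rw [coeff_C_mul, coeff_X_pow, if_neg h, mul_zero]

theorem crankWeight_zero (μ : Multiset ℕ) : crankWeight 0 μ = 1 := by
  by_cases h : μ = {1}
  · rw [h, crankWeight_one (by decide)]; norm_num
  · rw [crankWeight_of_ne 0 h, pow_zero]

theorem mk_sum_crankWeight (r : ℕ) :
    (mk fun n => ∑ l : Overpartition n, (crankWeight r l.nonOverlined : ℚ)) =
      distinctGf * crankSum r := mk_sum_nonOverlined _

/-- Every partition has zeroth crank weight 1, including {1}, where it is -1 + 1 + 1. Moment
generating functions divided by P are therefore ratios of `crankSum`, and `distinctGf` never has to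
be computed. -/
theorem overGf_eq : overGf = distinctGf * crankSum 0 := by
  rw [← mk_sum_crankWeight, overGf]
  simp [crankWeight_zero]

/-- Doubling of the parts. -/
def doubleEquiv : Parts (fun x => x ≠ 0) ≃ Parts (fun x => Even x ∧ x ≠ 0) where
  toFun μ := ⟨μ.1.map (2 * ·), fun x hx => by
    obtain ⟨y, hy, rfl⟩ := Multiset.mem_map.1 hx
    exact ⟨even_two_mul y, mul_ne_zero two_ne_zero (μ.2 y hy)⟩⟩
  invFun μ := ⟨μ.1.map (· / 2), fun x hx => by
    obtain ⟨y, hy, rfl⟩ := Multiset.mem_map.1 hx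
    obtain ⟨⟨z, hz⟩, h0⟩ := μ.2 y hy
    omega⟩
  left_inv μ := by
    refine Subtype.ext ?_
    change (μ.1.map (2 * ·)).map (· / 2) = μ.1
    rw [Multiset.map_map]
    conv_rhs => rw [← Multiset.map_id μ.1]
    refine Multiset.map_congr rfl fun x _ => ?_
    simp
  right_inv μ := by
    refine Subtype.ext ?_
    change (μ.1.map (· / 2)).map (2 * ·) = μ.1
    rw [Multiset.map_map]
    conv_rhs => rw [← Multiset.map_id μ.1]
    refine Multiset.map_congr rfl fun x hx => ?_
    exact Nat.two_mul_div_two_of_even (μ.2 x hx).1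

theorem tsum_crankWeight_double (r : ℕ) :
    ∑' μ : Parts (fun x => Even x ∧ x ≠ 0), (crankWeight r (μ.1.map (· / 2)) : ℚ⟦X⟧) *
      X ^ μ.1.sum = expand 2 two_ne_zero (crankSum r) := by
  rw [crankSum, ((decay_parts (by simp)).mul_left _).expand_tsum, ← doubleEquiv.tsum_eq]
  refine tsum_congr fun μ => ?_
  have h1 : (doubleEquiv μ).1.map (· / 2) = μ.1 := congrArg Subtype.val (doubleEquiv.left_inv μ)
  have h2 : (doubleEquiv μ).1.sum = 2 * μ.1.sum := by
    change (μ.1.map (2 * ·)).sum = _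
    rw [Multiset.sum_map_mul_left, Multiset.map_id']
  rw [h1, h2, map_mul, map_intCast, map_pow, expand_X, pow_mul]

theorem mk_sum_crankWeight_even (r : ℕ) :
    (mk fun n => ∑ l : Overpartition n,
      (crankWeight r ((l.nonOverlined.filter (fun x => Even x)).map (fun x => x / 2)) : ℚ)) =
      distinctGf * (expand 2 two_ne_zero (crankSum r) * partsGf fun x => Odd x) := by
  rw [mk_sum_nonOverlined fun μ => crankWeight r ((μ.filter (fun x => Even x)).map (fun x => x / 2)),
    ← tsum_crankWeight_double, partsGf]
  -- Non-overlined parts split into even and odd ones; the weight sees only the even ones, so the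
  -- odd ones give a constant factor.
  have h := tsum_parts_or_mul (s := fun x => x ≠ 0) (p := fun x => Even x ∧ x ≠ 0)
    (q := fun x => Odd x) (by simp) (by simp) (fun x hx => Nat.not_odd_iff_even.2 hx.1)
    (fun x => ?_)
    (fun μ => (crankWeight r ((μ.filter (fun x => Even x)).map (fun x => x / 2)) : ℚ⟦X⟧))
    (fun μ => (crankWeight r (μ.map (· / 2)) : ℚ⟦X⟧)) (fun _ => 1) fun μ ν hμ hν => by
      rw [mul_one, filter_add_left (q := fun x => Odd x) (fun x hx => Nat.not_odd_iff_even.2 hx)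
        (fun x hx => (hμ x hx).1) hν]
  · simpa only [one_mul] using congrArg (distinctGf * ·) h
  · constructor
    · intro hx
      rcases Nat.even_or_odd x with h | h
      · exact Or.inl ⟨h, hx⟩
      · exact Or.inr h
    · rintro (h | h)
      · exact h.2
      · exact h.pos.ne'

theorem overGf_eq_even :
    overGf = distinctGf * (expand 2 two_ne_zero (crankSum 0) * partsGf fun x => Odd x) := by
  rw [← mk_sum_crankWeight_even, overGf]
  simp [crankWeight_zero]

/-! ### The moments as coefficients -/

theorem finsum_mul_sum_ite {ι : Type*} [Fintype ι] (f : ι → ℤ) (k : ℕ) :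
    ∑ᶠ m : ℤ, m ^ k * ((Finset.univ.filter fun i => f i = m).card : ℤ) = ∑ i, f i ^ k := by
  have h : ∀ m : ℤ, m ^ k * ((Finset.univ.filter fun i => f i = m).card : ℤ) =
      ∑ i, if f i = m then m ^ k else 0 := fun m => by
    rw [Finset.card_filter, Nat.cast_sum, Finset.mul_sum]
    exact Finset.sum_congr rfl fun i _ => by split_ifs <;> simp
  simp only [h]
  rw [finsum_sum_comm]
  · refine Finset.sum_congr rfl fun i _ => ?_
    rw [finsum_eq_single _ (f i) fun m hm => if_neg hm.symm, if_pos rfl]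
  · intro i _
    refine (Set.finite_singleton (f i)).subset fun m hm => ?_
    by_contra h'
    exact hm (if_neg fun e => h' e.symm)

theorem coeff_statMoment_rank (k n : ℕ) :
    coeff n (statMoment (fun _ l => l.rank) k) = (rankMoment k n : ℚ) := by
  rw [statMoment, coeff_mk, rankMoment]
  simp only [rankCount]
  rw [finsum_mul_sum_ite]
  push_cast
  rfl

theorem coeff_statMoment_m2Rank (k n : ℕ) :
    coeff n (statMoment (fun _ l => l.m2Rank) k) = (m2RankMoment k n : ℚ) := by
  rw [statMoment, coeff_mk, m2RankMoment]
  simp only [m2RankCount]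
  rw [finsum_mul_sum_ite]
  push_cast
  rfl

theorem finsum_crankContribution {ι : Type*} [Fintype ι] (f : ι → Multiset ℕ) (k : ℕ) :
    ∑ᶠ m : ℤ, m ^ k * ∑ i, crankContribution (f i) m = ∑ i, crankWeight k (f i) := by
  simp only [Finset.mul_sum]
  exact finsum_sum_comm _ _ fun i _ => crankWeight_support k (f i)

theorem crankMoment_eq (k n : ℕ) :
    crankMoment k n = ∑ l : Overpartition n, crankWeight k l.nonOverlined :=
  finsum_crankContribution _ k

theorem crank2Moment_eq (k n : ℕ) : crank2Moment k n = ∑ l : Overpartition n,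
    crankWeight k ((l.nonOverlined.filter (fun x => Even x)).map (fun x => x / 2)) :=
  finsum_crankContribution _ k

/-- The generating function of the first residual crank moments. -/
noncomputable def crankMomentGf (k : ℕ) : ℚ⟦X⟧ := mk fun n => (crankMoment k n : ℚ)

/-- The generating function of the second residual crank moments. -/
noncomputable def crank2MomentGf (k : ℕ) : ℚ⟦X⟧ := mk fun n => (crank2Moment k n : ℚ)

theorem crankMomentGf_eq (k : ℕ) : crankMomentGf k = distinctGf * crankSum k := by
  rw [← mk_sum_crankWeight, crankMomentGf]
  simp only [crankMoment_eq, Int.cast_sum]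

theorem crank2MomentGf_eq (k : ℕ) : crank2MomentGf k =
    distinctGf * (expand 2 two_ne_zero (crankSum k) * partsGf fun x => Odd x) := by
  rw [← mk_sum_crankWeight_even, crank2MomentGf]
  simp only [crank2Moment_eq, Int.cast_sum]

theorem crankMomentGf_two : crankMomentGf 2 = 2 * lambert 1 * overGf := by
  rw [crankMomentGf_eq, overGf_eq, crankSum_eq (by decide), crankSum_eq (by decide),
    crankGfMoment_two]
  ring

theorem crankMomentGf_four :
    crankMomentGf 4 = (2 * lambert 3 + 12 * lambert 1 ^ 2) * overGf := by
  rw [crankMomentGf_eq, overGf_eq, crankSum_eq (by decide), crankSum_eq (by decide),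
    crankGfMoment_four]
  ring

theorem crank2MomentGf_two : crank2MomentGf 2 = 2 * lambert2 1 * overGf := by
  rw [crank2MomentGf_eq, overGf_eq_even, crankSum_eq (by decide), crankSum_eq (by decide),
    crankGfMoment_two, map_mul, map_mul, map_ofNat, lambert2]
  ring

theorem crank2MomentGf_four :
    crank2MomentGf 4 = (2 * lambert2 3 + 12 * lambert2 1 ^ 2) * overGf := by
  rw [crank2MomentGf_eq, overGf_eq_even, crankSum_eq (by decide), crankSum_eq (by decide),
    crankGfMoment_four]
  simp only [map_mul, map_add, map_pow, map_ofNat, lambert2]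
  ring

/-! ### The moment identities -/

theorem euler_overGf : euler overGf = -(dlogPhi * overGf) := by
  have h := congrArg euler overGf_mul_phi
  rw [Derivation.leibniz, euler_phi, Derivation.map_one_eq_zero, smul_eq_mul, smul_eq_mul] at h
  refine mul_left_cancel₀ phi_ne_zero ?_
  linear_combination h

theorem euler_ofNat (k : ℕ) [k.AtLeastTwo] : euler (OfNat.ofNat k : ℚ⟦X⟧) = 0 :=
  Derivation.map_natCast euler k

theorem euler_mul (f g : ℚ⟦X⟧) : euler (f * g) = f * euler g + g * euler f :=
  Derivation.leibniz euler f g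

theorem three_mul_euler_lambert2 :
    3 * euler (lambert2 1) = lambert2 1 - 12 * lambert2 1 ^ 2 + 5 * lambert2 3 := by
  have h := congrArg (expand 2 two_ne_zero) six_mul_euler_lambert
  simp only [map_mul, map_add, map_sub, map_pow, map_ofNat] at h
  rw [lambert2, lambert2, euler_expand]
  linear_combination h

theorem euler_dlogPhi : euler dlogPhi = 2 * (euler (lambert2 1) - euler (lambert 1)) := by
  rw [dlogPhi, euler_mul, euler_ofNat, map_sub, mul_zero, add_zero]

theorem rank_identity :
    C 77 * statMoment (fun _ l => l.rank) 4 =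
      -(C 616 * euler (statMoment (fun _ l => l.rank) 2)) -
        C 77 * statMoment (fun _ l => l.rank) 2 - C 216 * crankMomentGf 2 +
        C 24 * euler (crankMomentGf 2) + C 192 * crankMomentGf 4 + C 260 * crank2MomentGf 2 +
        C 184 * euler (crank2MomentGf 2) - C 280 * crank2MomentGf 4 := by
  have h1 := ptMoment_one_identity
  have h2 := dlogPhi_sq
  have h3 := six_mul_euler_lambert
  have h4 := three_mul_euler_lambert2
  have hl : dlogPhi = 2 * (lambert2 1 - lambert 1) := rfl
  rw [statMoment_rank_two, statMoment_rank_four, crankMomentGf_two, crankMomentGf_four,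
    crank2MomentGf_two, crank2MomentGf_four, map_neg]
  have e2 : euler (2 : ℚ⟦X⟧) = 0 := euler_ofNat 2
  have e4 : euler (4 : ℚ⟦X⟧) = 0 := euler_ofNat 4
  simp only [map_ofNat, euler_mul, e2, e4, euler_overGf]
  rw [euler_dlogPhi, hl] at h1 h2
  rw [hl]
  refine mul_left_cancel₀ (a := (3 : ℚ⟦X⟧)) (by norm_num) ?_
  -- The coefficient of `ptMoment 1 3` forces -308 (3 · 77 · 8 = 6 · 308). The mixed product L_1
  -- L_1' then fixes 3200, and the linear terms in L_1 and L_1' fix -680 and 944. The preliminary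
  -- factor 3 makes these coefficients integers.
  linear_combination overGf * (-308 * h1 + 3200 * h2 - 680 * h3 + 944 * h4)

theorem m2Rank_identity :
    C 77 * statMoment (fun _ l => l.m2Rank) 4 =
      -(C 154 * euler (statMoment (fun _ l => l.m2Rank) 2)) -
        C 77 * statMoment (fun _ l => l.m2Rank) 2 - C 27 * crankMomentGf 2 +
        C 3 * euler (crankMomentGf 2) + C 24 * crankMomentGf 4 + C 71 * crank2MomentGf 2 -
        C 131 * euler (crank2MomentGf 2) - C 112 * crank2MomentGf 4 := by
  have h1 := ptMoment_two_identity
  have h2 := dlogPhi_sq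
  have h3 := six_mul_euler_lambert
  have h4 := three_mul_euler_lambert2
  have hl : dlogPhi = 2 * (lambert2 1 - lambert 1) := rfl
  rw [statMoment_m2Rank_two, statMoment_m2Rank_four, crankMomentGf_two, crankMomentGf_four,
    crank2MomentGf_two, crank2MomentGf_four, map_neg]
  have e2 : euler (2 : ℚ⟦X⟧) = 0 := euler_ofNat 2
  have e4 : euler (4 : ℚ⟦X⟧) = 0 := euler_ofNat 4
  simp only [map_ofNat, euler_mul, e2, e4, euler_overGf]
  rw [euler_dlogPhi, hl] at h1 h2
  rw [hl]
  refine mul_left_cancel₀ (a := (3 : ℚ⟦X⟧)) (by norm_num) ?_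
  -- As for the rank: `ptMoment 2 3` forces -77 (3 · 77 · 8 = 24 · 77), and the other coefficients
  -- come from matching L_1 L_1', L_1 and L_1'.
  linear_combination overGf * (-77 * h1 + 92 * h2 - 8 * h3 + 272 * h4)

theorem coeff_crankMomentGf (k n : ℕ) : coeff n (crankMomentGf k) = (crankMoment k n : ℚ) :=
  coeff_mk _ _

theorem coeff_crank2MomentGf (k n : ℕ) : coeff n (crank2MomentGf k) = (crank2Moment k n : ℚ) :=
  coeff_mk _ _

theorem corollary3p1 (n : ℕ) :
    (rankMoment 4 n : ℚ) =
        (-8 * (n : ℚ) - 1) * (rankMoment 2 n : ℚ)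
          + (-216 + 24 * (n : ℚ)) / 77 * (crankMoment 2 n : ℚ)
          + 192 / 77 * (crankMoment 4 n : ℚ)
          + (260 + 184 * (n : ℚ)) / 77 * (crank2Moment 2 n : ℚ)
          - 40 / 11 * (crank2Moment 4 n : ℚ) ∧
    (m2RankMoment 4 n : ℚ) =
        (-2 * (n : ℚ) - 1) * (m2RankMoment 2 n : ℚ)
          + (-27 + 3 * (n : ℚ)) / 77 * (crankMoment 2 n : ℚ)
          + 24 / 77 * (crankMoment 4 n : ℚ)
          + (71 - 131 * (n : ℚ)) / 77 * (crank2Moment 2 n : ℚ)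
          - 16 / 11 * (crank2Moment 4 n : ℚ) := by
  have h1 := congrArg (coeff n) rank_identity
  have h2 := congrArg (coeff n) m2Rank_identity
  simp only [map_add, map_sub, map_neg, coeff_C_mul, coeff_euler, coeff_statMoment_rank,
    coeff_statMoment_m2Rank, coeff_crankMomentGf, coeff_crank2MomentGf] at h1 h2
  constructor
  · linear_combination h1 / 77
  · linear_combination h2 / 77
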